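/- **Setting.** Let $H$ be a separable complex Hilbert space and $\alpha\in C^{2}[0,1]$ with $\alpha\ge 0$ and $\{t:\alpha(t)=0\}$ a Lebesgue null set; let $L^2_\alpha=L^2_\alpha(H,(0,1))$ be the space of $H$-valued functions with $\|u\|^2=\int_0^1\|u(t)\|_H^2\,\alpha(t)\,dt<\infty$. Let $C$ be a positive self-adjoint operator in $H$ with domain $D(C)$. For $t\in[0,1]$ let $A_i(t)$ be self-adjoint with $D(C)\subset D(A_i(t))$, commuting with $C$ (that is, $A_i(t)C\subset CA_i(t)$), and such that $t\mapsto A_i(t)f$ is continuously differentiable on $[0,1]$ for every $f\in D(C)$. Put $A(t)=\frac{\alpha'(t)}{2\alpha(t)}I+C+iA_i(t)$ on $D(C)$ for a.e. $t$, and $$l(u)=u'+A(t)u,\qquad l^{+}(v)=-\frac{(\alpha v)'}{\alpha}+A(t)^{*}v .$$ Let $L_0$ and $L_0^{+}$ be the closures in $L^2_\alpha$ of $l$ and $l^{+}$ on the linear span of the functions $\varphi f$ with $\varphi\in C_0^\infty(0,1)$, $f\in D(C)$, and let $L=(L_0^{+})^{*}$, $L^{+}=L_0^{*}$. Let $U(t,s)$,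 $t,s\in[0,1]$, be the evolution operators of $y'+iA_i(t)y=0$: bounded operators with $U(s,s)f=f$ and $\partial_tU(t,s)f+iA_i(t)U(t,s)f=0$ for $f\in D(C)$. For a unitary operator $W$ in $H$ with $CW=WC$, let $L_W$ be the restriction of $L$ to those $u\in D(L)\cap D(L^{+})$ for which $\sqrt{\alpha}\,u$ has an absolutely continuous version on $[0,1]$ with derivative in $L^2(H,(0,1))$ and $$(\sqrt{\alpha}\,u)(1)=U(1,0)\,W\,(\sqrt{\alpha}\,u)(0).$$ **Theorem.** Suppose that $C^{-1}$ exists and is a compact operator on $H$, and that the eigenvalues $\lambda_1(C)\le\lambda_2(C)\le\dots$ of $C$, counted with multiplicity, satisfy $\lambda_n(C)\sim c\,n^{\beta}$ as $n\to\infty$ with constants $0<c<\infty$, $0<\beta<\infty$. Then, for every such $W$, the inverse $L_W^{-1}$ exists and is a compact operator on $L^2_\alpha$, and its $s$-numbers (the eigenvalues of $\big((L_W^{-1})^{*}L_W^{-1}\big)^{1/2}$ in decreasing order, counted with multiplicity) satisfy $$s_n(L_W^{-1})\sim d\,n^{-\theta}\quad(n\to\infty),\qquad \theta=\frac{\beta}{1+\beta},$$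 for some constant $0<d<\infty$. Here $a_n\sim b_n$ means $a_n/b_n\to1$. -/

import Mathlib

open MeasureTheory Set Filter Topology Asymptotics
open scoped ENNReal ContDiff LinearPMap

noncomputable section

namespace WeightedExt

/-! ### Inverses, eigenvalues and `s`-numbers -/

section General

variable {E : Type*} [NormedAddCommGroup E] [InnerProductSpace ℂ E] [CompleteSpace E]

/-- `T` is the (everywhere defined, bounded) inverse of the operator with graph `G`:
`(u, g)` lies in the graph if and only if `T g = u`. -/
def IsInverse (G : Submodule ℂ (E × E)) (T : E →L[ℂ] E) : Prop :=
  ∀ u g : E, (u, g) ∈ G ↔ T g = u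

/-- The eigenspace `ker (S - μ)` of an operator that need not be defined everywhere. -/
def eigenspace (S : E →ₗ.[ℂ] E) (μ : ℝ) : Submodule ℂ E where
  carrier := {x | (x, (μ : ℂ) • x) ∈ S.graph}
  zero_mem' := by
    change ((0 : E), (μ : ℂ) • (0 : E)) ∈ S.graph
    rw [smul_zero]
    exact S.graph.zero_mem
  add_mem' := by
    intro x y hx hy
    have h := S.graph.add_mem hx hy
    simpa [smul_add] using h
  smul_mem' := by
    intro a x hx
    have h := S.graph.smul_mem a hx
    change (a • x, (μ : ℂ) • a • x) ∈ S.graph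
    rw [smul_comm (μ : ℂ) a x]
    exact h

/-- `lam 0 ≤ lam 1 ≤ …` lists all eigenvalues of the self-adjoint operator `S`, each repeated
according to its multiplicity. -/
def IsEigenvalueSeq (S : E →ₗ.[ℂ] E) (lam : ℕ → ℝ) : Prop :=
  Monotone lam ∧
    ∀ μ : ℝ, {n : ℕ | lam n = μ}.encard = Cardinal.toENat (Module.rank ℂ (eigenspace S μ))

/-- `s 0 ≥ s 1 ≥ … ≥ 0` is the sequence of `s`-numbers of the compact operator `T`: it lists the
nonzero eigenvalues of `(T* T)^{1/2}` in decreasing order and with multiplicities (followed by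
zeros if there are only finitely many of them). -/
def IsSNumberSeq (T : E →L[ℂ] E) (s : ℕ → ℝ) : Prop :=
  Antitone s ∧ (∀ n, 0 ≤ s n) ∧
    ∀ μ : ℝ, 0 < μ → {n : ℕ | s n = μ}.encard =
      Cardinal.toENat (Module.rank ℂ
        (Module.End.eigenspace ((CFC.sqrt (star T * T) : E →L[ℂ] E) : E →ₗ[ℂ] E) (μ : ℂ)))

end General

/-! ### The weighted space and the operators generated by `l` and `l⁺` -/

/-- The measure `α(t) dt` on `(0, 1)`. -/
def weight (α : ℝ → ℝ) : Measure ℝ :=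
  (volume.restrict (Ioo 0 1)).withDensity fun t => ENNReal.ofReal (α t)

/-- The weighted Hilbert space `L²_α(H, (0, 1))`. -/
abbrev L2w (H : Type*) [NormedAddCommGroup H] (α : ℝ → ℝ) : Type _ := Lp H 2 (weight α)

variable {H : Type*} [NormedAddCommGroup H] [InnerProductSpace ℂ H]

/-- `v ∈ W¹₂(H, (0, 1))`, in its absolutely continuous version on `[0, 1]`. -/
def IsW12 (v : ℝ → H) : Prop :=
  ∃ w : ℝ → H, MemLp w 2 (volume.restrict (Ioo 0 1)) ∧
    ∀ t ∈ Icc (0 : ℝ) 1, v t = v 0 + ∫ r in (0 : ℝ)..t, w r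

theorem W12.intervalIntegrable_of_mem {H : Type*} [NormedAddCommGroup H] {w : ℝ → H}
    (hw : MemLp w 2 (volume.restrict (Ioo 0 1))) {t : ℝ} (ht : t ∈ Icc (0 : ℝ) 1) :
    IntervalIntegrable w volume 0 t := by
  have h : IntegrableOn w (Ioo 0 1) := hw.integrable (by norm_num)
  rw [intervalIntegrable_iff_integrableOn_Ioo_of_le ht.1]
  exact h.mono_set (Ioo_subset_Ioo le_rfl ht.2)

theorem IsW12.add {v v' : ℝ → H} (hv : IsW12 v) (hv' : IsW12 v') : IsW12 (v + v') := by
  obtain ⟨w, hw, h⟩ := hv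
  obtain ⟨w', hw', h'⟩ := hv'
  refine ⟨w + w', hw.add hw', fun t ht => ?_⟩
  simp only [Pi.add_apply]
  rw [intervalIntegral.integral_add (W12.intervalIntegrable_of_mem hw ht)
    (W12.intervalIntegrable_of_mem hw' ht), h t ht, h' t ht]
  abel

theorem IsW12.smul {v : ℝ → H} (a : ℂ) (hv : IsW12 v) : IsW12 (a • v) := by
  obtain ⟨w, hw, h⟩ := hv
  refine ⟨a • w, hw.const_smul a, fun t ht => ?_⟩
  simp only [Pi.smul_apply]
  rw [intervalIntegral.integral_smul, h t ht, smul_add]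

variable [CompleteSpace H]

/-- `A_r(t) = (α'(t) / (2 α(t))) I + C`. -/
def Ar (α : ℝ → ℝ) (C : H →ₗ.[ℂ] H) (t : ℝ) : H →ₗ.[ℂ] H :=
  (((deriv α t / (2 * α t) : ℝ) : ℂ) • (LinearMap.id : H →ₗ[ℂ] H)) +ᵥ C

/-- `A(t) = A_r(t) + i A_i(t)`. -/
def A (α : ℝ → ℝ) (C : H →ₗ.[ℂ] H) (Ai : ℝ → H →ₗ.[ℂ] H) (t : ℝ) : H →ₗ.[ℂ] H :=
  Ar α C t + Complex.I • Ai t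

/-- `φ ∈ C_0^∞(0, 1)`, complex valued. -/
def IsTest (φ : ℝ → ℂ) : Prop :=
  ContDiff ℝ ∞ φ ∧ HasCompactSupport φ ∧ tsupport φ ⊆ Ioo 0 1

/-- The graph of the minimal operator `L₀`: the closure of the linear span of the pairs
`(φ f, l(φ f))` with `φ ∈ C_0^∞(0, 1)` and `f ∈ D(A) = D(C)`, where `l(u) = u' + A(t) u`. -/
def L0 (α : ℝ → ℝ) (C : H →ₗ.[ℂ] H) (Ai : ℝ → H →ₗ.[ℂ] H) :
    Submodule ℂ (L2w H α × L2w H α) :=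
  (Submodule.span ℂ {p | ∃ (φ : ℝ → ℂ) (f : H) (a : ℝ → H), IsTest φ ∧ f ∈ C.domain ∧
    (∀ t ∈ Ioo (0 : ℝ) 1, (f, a t) ∈ (A α C Ai t).graph) ∧
    p.1 =ᵐ[weight α] (fun t => φ t • f) ∧
    p.2 =ᵐ[weight α] (fun t => deriv φ t • f + φ t • a t)}).topologicalClosure

/-- The graph of the minimal operator `L₀⁺` generated in the same way by the formally adjoint
expression `l⁺(v) = -(α v)' / α + A(t)* v`. -/
def L0plus (α : ℝ → ℝ) (C : H →ₗ.[ℂ] H) (Ai : ℝ → H →ₗ.[ℂ] H) :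
    Submodule ℂ (L2w H α × L2w H α) :=
  (Submodule.span ℂ {p | ∃ (φ : ℝ → ℂ) (f : H) (a : ℝ → H), IsTest φ ∧ f ∈ C.domain ∧
    (∀ t ∈ Ioo (0 : ℝ) 1, (f, a t) ∈ ((A α C Ai t)†).graph) ∧
    p.1 =ᵐ[weight α] (fun t => φ t • f) ∧
    p.2 =ᵐ[weight α] (fun t =>
      -((deriv (fun r => (α r : ℂ) * φ r) t / (α t : ℂ)) • f) + φ t • a t)}).topologicalClosure

/-- The graph of the maximal operator `L = (L₀⁺)*`. -/
def Lmax (α : ℝ → ℝ) (C : H →ₗ.[ℂ] H) (Ai : ℝ → H →ₗ.[ℂ] H) :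
    Submodule ℂ (L2w H α × L2w H α) :=
  (L0plus α C Ai).adjoint

/-- The graph of the maximal operator `L⁺ = (L₀)*`. -/
def LmaxPlus (α : ℝ → ℝ) (C : H →ₗ.[ℂ] H) (Ai : ℝ → H →ₗ.[ℂ] H) :
    Submodule ℂ (L2w H α × L2w H α) :=
  (L0 α C Ai).adjoint

/-- The boundary condition `(√α u)(1) = B (√α u)(0)`, where the boundary values are those of the
absolutely continuous version `v` of `√α u` (for `u ∈ D(L) ∩ D(L⁺)` that version exists
automatically when `α` has no zero inside `(0, 1)`). -/
def BoundaryCondition (α : ℝ → ℝ) (B : H →L[ℂ] H) (u : ℝ → H) : Prop :=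
  ∃ v : ℝ → H, IsW12 v ∧ (∀ᵐ t ∂(weight α), √(α t) • u t = v t) ∧
    v 1 = B (v 0)

/-- The graph of `L_W` for a boundary operator `B` (here `B = U(1, 0) W`): the restriction of `L` to
the functions `u ∈ D(L) ∩ D(L⁺)` that satisfy `(√α u)(1) = B (√α u)(0)`. -/
def LW (α : ℝ → ℝ) (C : H →ₗ.[ℂ] H) (Ai : ℝ → H →ₗ.[ℂ] H) (B : H →L[ℂ] H) :
    Submodule ℂ (L2w H α × L2w H α) where
  carrier := {p | p ∈ Lmax α C Ai ∧ (∃ g, (p.1, g) ∈ LmaxPlus α C Ai) ∧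
    BoundaryCondition α B p.1}
  zero_mem' := by
    refine ⟨zero_mem _, ⟨0, zero_mem _⟩, 0, ⟨0, MemLp.zero, by simp⟩, ?_, by simp⟩
    filter_upwards [Lp.coeFn_zero H 2 (weight α)] with t ht
    simp only [Prod.fst_zero, ht, Pi.zero_apply, smul_zero]
  add_mem' := by
    rintro p q ⟨hp, ⟨g, hg⟩, v, hv, hpv, hvB⟩ ⟨hq, ⟨g', hg'⟩, v', hv', hqv, hvB'⟩
    refine ⟨add_mem hp hq, ⟨g + g', add_mem hg hg'⟩, v + v', hv.add hv', ?_, by simp [hvB, hvB']⟩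
    filter_upwards [Lp.coeFn_add p.1 q.1, hpv, hqv] with t ht h h'
    simp only [Prod.fst_add, ht, Pi.add_apply, smul_add, h, h']
  smul_mem' := by
    rintro a p ⟨hp, ⟨g, hg⟩, v, hv, hpv, hvB⟩
    refine ⟨Submodule.smul_mem _ a hp, ⟨a • g, Submodule.smul_mem _ a hg⟩, a • v, hv.smul a, ?_,
      by simp [hvB]⟩
    filter_upwards [Lp.coeFn_smul a p.1, hpv] with t ht h
    simp only [Prod.smul_fst, ht, Pi.smul_apply, ← h]
    exact smul_comm _ _ _

/-- The family of evolution operators of `y' + i A_i(t) y = 0` on `[0, 1]`: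
`U(s, s) f = f` and `∂U(t, s) f / ∂t + i A_i(t) U(t, s) f = 0` for all `f ∈ D`. -/
structure IsEvolutionFamily (D : Submodule ℂ H) (Ai : ℝ → H →ₗ.[ℂ] H)
    (U : ℝ → ℝ → H →L[ℂ] H) : Prop where
  initial : ∀ s ∈ Icc (0 : ℝ) 1, ∀ f ∈ D, U s s f = f
  equation : ∀ s ∈ Icc (0 : ℝ) 1, ∀ f ∈ D, ∀ t ∈ Icc (0 : ℝ) 1, ∃ y : H,
    (U t s f, y) ∈ (Ai t).graph ∧
      HasDerivWithinAt (fun r => U r s f) (-(Complex.I • y)) (Icc 0 1) t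

end WeightedExt

end

namespace WeightedExt

/-! ### Decreasing rearrangements and counting functions -/

section Rearrangement

variable {ι : Type*} {a : ι → ℝ}

/-! The substitution `v = √α u` is unitary from `L²_α` onto `L²(H, (0,1))`, and it turns `l` into
`v' + C v + i A_i(t) v`: the term `α'/(2α)` is exactly what the weight produces. The claim becomes
one about this unweighted expression under `v(1) = U(1,0) W v(0)`, whose inverse can be diagonalized
explicitly.

Since `C⁻¹` is compact, `C` has finite-dimensional eigenspaces with dense span. `W` preserves them,
so there is an orthonormal basis with `C e_k = λ_k e_k` and `W e_k = exp(iτ_k) e_k`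
(`exists_joint_eigenvectors`). The operators `U(t,0)` are isometric because `A_i(t)` is symmetric,
and preserve the eigenspaces of `C` because `A_i(t)` commutes with `C`
(`exists_isometric_evolution`). Hence the functions `x_{k,m}(t) = exp(i(τ_k + 2πm)t) U(t,0) e_k`
satisfy the boundary condition, solve `x' + C x + i A_i x = (λ_k + i(τ_k + 2πm)) x`, and form an
orthonormal basis of `L²` (`exists_eigenbasis`).

The inverse of `L_W` is therefore the diagonal operator with entries `(λ_k + i(τ_k + 2πm))⁻¹`
(`isInverse_LW`). One inclusion compares Fourier coefficients: integrating by parts against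
`x_{k,m}` leaves no boundary term, because `U(1,0) W` is isometric. The other checks the basis
vectors and passes to the limit, using that the graphs of `L` and `L⁺` and the boundary condition on
pairs (function, derivative) are closed. Zeros of `α` are handled by replacing `α` with `α + ε`, or
by testing only where `α > 0`.

The `s`-numbers are thus the reciprocals of `|λ_k + i(τ_k + 2πm)|` in decreasing order. In the disc
of radius `r`, row `k` holds `√(r² - λ_k²)/π + O(1)` points. With `λ_k ~ c k^β` the rows sum to `K
r^{(1+β)/β}` asymptotically, where `K = ∫ √(1 - (c x^β)²)/π dx` over `c x^β < 1`
(`exists_tendsto_ncard_latticeDisc`). Inverting this counting law (`rearrangement_isEquivalent`)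
gives the exponent `β/(1+β)`. -/

theorem exists_lt_setOf_le_eq (ha : ∀ ε : ℝ, 0 < ε → {i | ε ≤ a i}.Finite) {μ : ℝ} (hμ : 0 < μ) :
    ∃ μ', 0 < μ' ∧ μ' < μ ∧ {i | μ' ≤ a i} = {i | μ ≤ a i} := by
  have hfin : ({i | μ / 2 ≤ a i} \ {i | μ ≤ a i}).Finite := (ha _ (half_pos hμ)).subset sdiff_subset
  obtain ⟨x, hx, hx2⟩ : ∃ x, x < μ ∧ ∀ i ∈ ({i | μ / 2 ≤ a i} \ {i | μ ≤ a i}), a i ≤ x := by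
    rcases Set.eq_empty_or_nonempty ({i | μ / 2 ≤ a i} \ {i | μ ≤ a i}) with h | h
    · exact ⟨0, hμ, by simp [h]⟩
    · obtain ⟨j, hj, hj2⟩ := Set.exists_max_image _ a hfin h
      exact ⟨a j, not_le.1 hj.2, hj2⟩
  -- Only finitely many values lie in `[μ/2, μ)`, all at most `x`. The midpoint of `x` and `μ`
  -- passes them, and `μ/2` keeps the level inside the range where `x` is a bound.
  refine ⟨max (μ / 2) ((x + μ) / 2), lt_max_of_lt_left (half_pos hμ),
    max_lt (half_lt_self hμ) (by linarith), ?_⟩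
  ext i
  simp only [mem_ofPred_eq]
  refine ⟨fun h => ?_, fun h => (max_lt (half_lt_self hμ) (by linarith)).le.trans h⟩
  by_contra hcon
  have h1 := hx2 i ⟨(le_max_left _ _).trans h, hcon⟩
  have h2 := (le_max_right _ _).trans h
  linarith

/-- `s n` is the supremum of the levels reached by more than `n` of the `a i`. The supremum is
attained since the counting function is constant just below each level. The equivalence replaces an
explicit sorting: it determines `s` from the counting function alone. -/
theorem exists_decreasing_rearrangement [Infinite ι] (hpos : ∀ i, 0 < a i)
    (ha : ∀ ε : ℝ, 0 < ε → {i | ε ≤ a i}.Finite) :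
    ∃ s : ℕ → ℝ, Antitone s ∧ (∀ n, 0 < s n) ∧
      ∀ n μ, 0 < μ → (μ ≤ s n ↔ n < {i | μ ≤ a i}.ncard) := by
  set N : ℝ → ℕ := fun μ => {i | μ ≤ a i}.ncard with hN
  have hanti : ∀ μ μ', 0 < μ → μ ≤ μ' → N μ' ≤ N μ := fun μ μ' h0 h =>
    Set.ncard_le_ncard (fun i hi => h.trans hi) (ha μ h0)
  have hne : ∀ n, ∃ μ, 0 < μ ∧ n < N μ := by
    intro n
    obtain ⟨F, hF⟩ := Infinite.exists_subset_card_eq ι (n + 1)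
    have hFn : F.Nonempty := Finset.card_pos.1 (by omega)
    obtain ⟨j, hj, hj2⟩ := F.exists_min_image a hFn
    refine ⟨a j, hpos j, ?_⟩
    have : (F : Set ι).ncard ≤ N (a j) :=
      Set.ncard_le_ncard (fun i hi => hj2 i hi) (ha _ (hpos j))
    rw [Set.ncard_coe_finset, hF] at this
    omega
  have hbdd : ∀ n, BddAbove {μ | 0 < μ ∧ n < N μ} := by
    intro n
    obtain ⟨B, hB⟩ := ((ha 1 one_pos).image a).bddAbove
    -- A level above 1 can be reached only by the finitely many `a i ≥ 1`, which `B` bounds.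
    refine ⟨max B 1, fun μ hμ => ?_⟩
    by_contra! hcon
    have : N μ ≠ 0 := by have := hμ.2; omega
    obtain ⟨i, hi⟩ := Set.nonempty_of_ncard_ne_zero this
    have h1 : (1 : ℝ) ≤ a i := ((le_max_right _ _).trans hcon.le).trans hi
    have h2 := hB ⟨i, h1, rfl⟩
    have h3 : μ ≤ a i := hi
    have := (le_max_left B 1).trans_lt hcon
    linarith
  have key : ∀ n μ, 0 < μ → (μ ≤ sSup {μ | 0 < μ ∧ n < N μ} ↔ n < N μ) := by
    intro n μ hμ
    refine ⟨fun h => ?_, fun h => le_csSup (hbdd n) ⟨hμ, h⟩⟩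
    -- Lowering the level to `μ'` without changing the count leaves room for an element of the set
    -- above `μ'`, even when the supremum is `μ` itself.
    obtain ⟨μ', h0, h1, h2⟩ := exists_lt_setOf_le_eq ha hμ
    obtain ⟨ρ, hρ, hρ2⟩ := exists_lt_of_lt_csSup (hne n) (h1.trans_le h)
    have h3 := hanti μ' ρ h0 hρ2.le
    have h4 : N μ' = N μ := by simp only [hN, h2]
    have := hρ.2
    omega
  have hs0 : ∀ n, 0 < sSup {μ | 0 < μ ∧ n < N μ} := by
    intro n
    obtain ⟨μ, hμ⟩ := hne n
    exact hμ.1.trans_le (le_csSup (hbdd n) hμ)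
  refine ⟨fun n => sSup {μ | 0 < μ ∧ n < N μ}, ?_, hs0, key⟩
  intro m n hmn
  exact (key m _ (hs0 n)).2 (hmn.trans_lt ((key n _ (hs0 n)).1 le_rfl))

/-- If `μ'` is a level just above `μ`, the equivalence makes `{n | s n = μ}` the interval from the
count at `μ'` to the count at `μ`. Its length is the number of `a i` equal to `μ`. -/
theorem encard_rearrangement_eq {s : ℕ → ℝ}
    (ha : ∀ ε : ℝ, 0 < ε → {i | ε ≤ a i}.Finite)
    (hs : ∀ n μ, 0 < μ → (μ ≤ s n ↔ n < {i | μ ≤ a i}.ncard)) {μ : ℝ} (hμ : 0 < μ) :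
    {n | s n = μ}.encard = {i | a i = μ}.encard := by
  have hfin : {i | a i = μ}.Finite := (ha μ hμ).subset fun i hi => le_of_eq (Eq.symm hi)
  have hgt : ∃ μ', μ < μ' ∧ {i | μ' ≤ a i} = {i | μ < a i} := by
    have hf : {i | μ < a i}.Finite := (ha μ hμ).subset fun i (hi : μ < a i) => hi.le
    rcases Set.eq_empty_or_nonempty {i | μ < a i} with h | h
    · refine ⟨μ + 1, by linarith, ?_⟩
      rw [h, Set.eq_empty_iff_forall_notMem]
      intro i hi
      have : i ∈ {i | μ < a i} := by
        have : μ + 1 ≤ a i := hi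
        exact (by linarith : μ < a i)
      rw [h] at this
      exact this
    · obtain ⟨j, hj, hj2⟩ := Set.exists_min_image _ a hf h
      refine ⟨a j, hj, ?_⟩
      ext i
      exact ⟨fun hi => show μ < a i from lt_of_lt_of_le hj hi, fun hi => hj2 i hi⟩
  obtain ⟨μ', h1, h2⟩ := hgt
  have hset : {n | s n = μ} = Set.Ico ({i | μ' ≤ a i}.ncard) ({i | μ ≤ a i}.ncard) := by
    ext n
    rw [mem_ofPred_eq, mem_Ico, ← hs n μ hμ, ← not_lt (a := n), ← hs n μ' (hμ.trans h1)]
    constructor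
    · rintro rfl
      exact ⟨not_le.2 h1, le_rfl⟩
    · rintro ⟨h3, h4⟩
      refine le_antisymm ?_ h4
      by_contra! hcon
      have h5 := (hs n (s n) (hμ.trans hcon)).1 le_rfl
      have h6 : {i | s n ≤ a i}.ncard ≤ {i | μ' ≤ a i}.ncard := by
        refine Set.ncard_le_ncard ?_ (ha _ (hμ.trans h1))
        rw [h2]
        exact fun i hi => lt_of_lt_of_le hcon hi
      exact h3 ((hs n μ' (hμ.trans h1)).2 (h5.trans_le h6))
  have hunion : {i | μ ≤ a i} = {i | a i = μ} ∪ {i | μ' ≤ a i} := by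
    rw [h2]
    ext i
    simp only [mem_ofPred_eq, mem_union]
    rw [le_iff_eq_or_lt, eq_comm]
  have hcard : {i | μ ≤ a i}.ncard = {i | a i = μ}.ncard + {i | μ' ≤ a i}.ncard := by
    rw [hunion]
    refine Set.ncard_union_eq ?_ hfin (ha _ (hμ.trans h1))
    rw [h2, Set.disjoint_left]
    intro i hi hi2
    exact (ne_of_gt (show μ < a i from hi2)) hi
  rw [hset, hcard, ← Finset.coe_Ico, Set.encard_coe_eq_coe_finsetCard, Nat.card_Ico,
    Nat.add_sub_cancel, hfin.cast_ncard_eq]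

/-- Inversion of the power asymptotics of a counting function. -/
theorem rearrangement_isEquivalent {s : ℕ → ℝ} {N : ℝ → ℕ} {K p : ℝ} (hK : 0 < K) (hp : 0 < p)
    (hs0 : ∀ n, 0 < s n) (hs : ∀ n r, 0 < r → (r⁻¹ ≤ s n ↔ n < N r))
    (hN : Tendsto (fun r : ℝ => (N r : ℝ) / r ^ p) atTop (𝓝 K)) :
    s ~[atTop] fun n => K ^ (1 / p) * ((n : ℝ) + 1) ^ (-(1 / p)) := by
  set r : ℕ → ℝ := fun n => (s n)⁻¹ with hr
  have hr0 : ∀ n, 0 < r n := fun n => inv_pos.2 (hs0 n)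
  -- With `r n = 1 / s n`, at least `n + 1` points lie within `r n` and at most `n` within any
  -- smaller radius. These two bounds squeeze `(n + 1) / (r n)^p`.
  have hup : ∀ n, n < N (r n) := fun n => (hs n _ (hr0 n)).1 (by simp [hr])
  have hlow : ∀ n q, 0 < q → q < r n → N q ≤ n := by
    intro n q hq h
    by_contra! hcon
    have := (hs n q hq).2 hcon
    have h3 : s n < q⁻¹ := by
      rw [lt_inv_comm₀ (hs0 n) hq]; exact h
    linarith
  have hrt : Tendsto r atTop atTop := by
    rw [tendsto_atTop_atTop]
    intro b
    have hb : 0 < max b 1 := lt_max_of_lt_right one_pos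
    refine ⟨N (max b 1), fun n hn => ?_⟩
    by_contra! hcon
    have h1 : r n ≤ max b 1 := hcon.le.trans (le_max_left _ _)
    have h2 : (max b 1)⁻¹ ≤ s n := by
      rw [inv_le_comm₀ hb (hs0 n)]; exact h1
    have := (hs n _ hb).1 h2
    omega
  have hlim : Tendsto (fun n : ℕ => ((n : ℝ) + 1) / (r n) ^ p) atTop (𝓝 K) := by
    have h1 : Tendsto (fun n => (N (r n) : ℝ) / (r n) ^ p) atTop (𝓝 K) := hN.comp hrt
    have hrp : Tendsto (fun n => (r n) ^ p) atTop atTop := (tendsto_rpow_atTop hp).comp hrt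
    rw [tendsto_order]
    constructor
    · intro c hc
      -- Multiplicities may make `N (r n)` exceed `n + 1`, so the lower bound uses the radius `δ r
      -- n`, where the count is at most `n`; the loss `δ^p` can be taken close to 1.
      obtain ⟨δ, hδ0, hδ1, hδ⟩ : ∃ δ : ℝ, 0 < δ ∧ δ < 1 ∧ c < K * δ ^ p := by
        have : Tendsto (fun δ : ℝ => K * δ ^ p) (𝓝[<] 1) (𝓝 (K * 1 ^ p)) := by
          refine Tendsto.const_mul _ ?_
          exact ((Real.continuousAt_rpow_const 1 p (Or.inl one_ne_zero)).tendsto).mono_left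
            nhdsWithin_le_nhds
        rw [Real.one_rpow, mul_one] at this
        have h3 := (this.eventually (lt_mem_nhds hc)).and
          (Ioo_mem_nhdsLT (show (0 : ℝ) < 1 from one_pos))
        obtain ⟨δ, hd, hd2⟩ := h3.exists
        exact ⟨δ, hd2.1, hd2.2, hd⟩
      have h4 : Tendsto (fun n => (N (δ * r n) : ℝ) / (δ * r n) ^ p) atTop (𝓝 K) :=
        hN.comp (hrt.const_mul_atTop hδ0)
      have h5 : Tendsto (fun n => (N (δ * r n) : ℝ) / (r n) ^ p) atTop (𝓝 (K * δ ^ p)) := by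
        refine (h4.mul_const (δ ^ p)).congr fun n => ?_
        rw [Real.mul_rpow hδ0.le (hr0 n).le]
        have := (Real.rpow_pos_of_pos hδ0 p).ne'
        have := (Real.rpow_pos_of_pos (hr0 n) p).ne'
        field_simp
      filter_upwards [h5.eventually (lt_mem_nhds hδ)] with n hn
      refine hn.trans_le ?_
      have h6 : N (δ * r n) ≤ n :=
        hlow n _ (mul_pos hδ0 (hr0 n)) (mul_lt_of_lt_one_left (hr0 n) hδ1)
      have h7 : (N (δ * r n) : ℝ) ≤ n + 1 := by
        have : (N (δ * r n) : ℝ) ≤ n := by exact_mod_cast h6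
        linarith
      have := Real.rpow_nonneg (hr0 n).le p
      gcongr
    · intro c hc
      filter_upwards [h1.eventually (gt_mem_nhds hc)] with n hn
      refine lt_of_le_of_lt ?_ hn
      have h7 : ((n : ℝ) + 1) ≤ N (r n) := by exact_mod_cast hup n
      have := Real.rpow_nonneg (hr0 n).le p
      gcongr
  have hlim2 : Tendsto (fun n : ℕ => (((n : ℝ) + 1) / (r n) ^ p) ^ (1 / p)) atTop (𝓝 (K ^ (1 / p))) :=
    ((Real.continuousAt_rpow_const K (1 / p) (Or.inl hK.ne')).tendsto).comp hlim
  have hKp : 0 < K ^ (1 / p) := Real.rpow_pos_of_pos hK _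
  have hsr : ∀ n, s n = (((n : ℝ) + 1) / (r n) ^ p) ^ (1 / p) * ((n : ℝ) + 1) ^ (-(1 / p)) := by
    intro n
    have hn : (0 : ℝ) < n + 1 := by positivity
    rw [Real.div_rpow hn.le (Real.rpow_nonneg (hr0 n).le p), ← Real.rpow_mul (hr0 n).le,
      mul_one_div_cancel hp.ne', Real.rpow_one, div_mul_eq_mul_div, ← Real.rpow_add hn,
      add_neg_cancel, Real.rpow_zero, hr]
    simp
  have h8 : (fun n : ℕ => (((n : ℝ) + 1) / (r n) ^ p) ^ (1 / p)) ~[atTop] fun _ => K ^ (1 / p) :=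
    (isEquivalent_const_iff_tendsto hKp.ne').2 hlim2
  have h9 := h8.mul (IsEquivalent.refl (u := fun n : ℕ => ((n : ℝ) + 1) ^ (-(1 / p))) (l := atTop))
  refine h9.congr_left (Eventually.of_forall fun n => ?_)
  simp only [Pi.mul_apply]
  rw [← hsr]

end Rearrangement

/-! ### Counting lattice points -/

/-- The number of `m : ℤ` with `|τ + 2πm| ≤ ρ`. -/
noncomputable def latticeCount (τ ρ : ℝ) : ℕ := {m : ℤ | |τ + 2 * Real.pi * m| ≤ ρ}.ncard

theorem lattice_eq_Icc (τ ρ : ℝ) : {m : ℤ | |τ + 2 * Real.pi * m| ≤ ρ} =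
    ↑(Finset.Icc ⌈(-ρ - τ) / (2 * Real.pi)⌉ ⌊(ρ - τ) / (2 * Real.pi)⌋) := by
  have hpi : 0 < 2 * Real.pi := by positivity
  ext m
  simp only [mem_ofPred_eq, Finset.coe_Icc, mem_Icc, Int.ceil_le, Int.le_floor, abs_le,
    div_le_iff₀ hpi, le_div_iff₀ hpi]
  constructor <;> rintro ⟨h1, h2⟩ <;> constructor <;> linarith

theorem lattice_finite (τ ρ : ℝ) : {m : ℤ | |τ + 2 * Real.pi * m| ≤ ρ}.Finite := by
  rw [lattice_eq_Icc]; exact Finset.finite_toSet _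

/-- An interval of length `2ρ` meets a progression of step `2π` in `ρ/π` points up to one. The error
is uniform in `τ`, so the phases coming from `W` do not influence the asymptotics. -/
theorem abs_latticeCount_sub_le (τ : ℝ) {ρ : ℝ} (hρ : 0 ≤ ρ) :
    |(latticeCount τ ρ : ℝ) - ρ / Real.pi| ≤ 1 := by
  have hpi : 0 < Real.pi := Real.pi_pos
  have hcard : (latticeCount τ ρ : ℤ) =
      ⌊(ρ - τ) / (2 * Real.pi)⌋ + 1 - ⌈(-ρ - τ) / (2 * Real.pi)⌉ := by
    rw [latticeCount, lattice_eq_Icc, Set.ncard_coe_finset, Int.card_Icc, Int.toNat_of_nonneg]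
    have h1 := Int.lt_floor_add_one ((ρ - τ) / (2 * Real.pi))
    have h2 : (-ρ - τ) / (2 * Real.pi) ≤ (ρ - τ) / (2 * Real.pi) := by gcongr; linarith
    have h3 : ⌈(-ρ - τ) / (2 * Real.pi)⌉ ≤ ⌊(ρ - τ) / (2 * Real.pi)⌋ + 1 := by
      rw [Int.ceil_le]; push_cast; linarith
    linarith
  have hc2 : (latticeCount τ ρ : ℝ) =
      ⌊(ρ - τ) / (2 * Real.pi)⌋ + 1 - ⌈(-ρ - τ) / (2 * Real.pi)⌉ := by exact_mod_cast hcard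
  have hdiff : (ρ - τ) / (2 * Real.pi) - (-ρ - τ) / (2 * Real.pi) = ρ / Real.pi := by
    field_simp; ring
  have h1 := Int.lt_floor_add_one ((ρ - τ) / (2 * Real.pi))
  have h2 := Int.floor_le ((ρ - τ) / (2 * Real.pi))
  have h3 := Int.ceil_lt_add_one ((-ρ - τ) / (2 * Real.pi))
  have h4 := Int.le_ceil ((-ρ - τ) / (2 * Real.pi))
  rw [hc2, abs_le]
  constructor <;> linarith

section Counting

/-- Writing a sum as the integral of a step function makes the sum over rows accessible to dominated
convergence. -/
theorem integrableOn_integral_floor (g : ℕ → ℝ) (n : ℕ) :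
    IntegrableOn (fun x : ℝ => g ⌊x⌋₊) (Ico 0 n) ∧
      ∫ x in Ico (0 : ℝ) n, g ⌊x⌋₊ = ∑ k ∈ Finset.range n, g k := by
  induction n with
  | zero => simp
  | succ n ih =>
    have hu : Ico (0 : ℝ) ((n + 1 : ℕ) : ℝ) = Ico 0 (n : ℝ) ∪ Ico (n : ℝ) (n + 1) := by
      push_cast
      rw [Ico_union_Ico_eq_Ico (by positivity) (by linarith)]
    have heq : EqOn (fun x : ℝ => g ⌊x⌋₊) (fun _ => g n) (Ico (n : ℝ) (n + 1)) := by
      intro x hx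
      have : ⌊x⌋₊ = n := (Nat.floor_eq_iff ((Nat.cast_nonneg n).trans hx.1)).2 hx
      simp only [this]
    have hint : IntegrableOn (fun x : ℝ => g ⌊x⌋₊) (Ico (n : ℝ) (n + 1)) :=
      (integrableOn_congr_fun heq measurableSet_Ico).2 (integrableOn_const (by simp))
    rw [hu, Finset.sum_range_succ]
    refine ⟨ih.1.union hint, ?_⟩
    rw [setIntegral_union (Set.disjoint_left.2 fun x hx hx2 => not_lt.2 hx2.1 hx.2)
      measurableSet_Ico ih.1 hint, ih.2, setIntegral_congr_fun measurableSet_Ico heq]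
    simp

theorem integral_floor_Ioi (g : ℕ → ℝ) (n : ℕ) (hg : ∀ k, n ≤ k → g k = 0) :
    ∫ x in Ioi (0 : ℝ), g ⌊x⌋₊ = ∑ k ∈ Finset.range n, g k := by
  rw [← integral_Ici_eq_integral_Ioi, ← (integrableOn_integral_floor g n).2]
  refine setIntegral_eq_of_subset_of_forall_sdiff_eq_zero measurableSet_Ici Ico_subset_Ici_self ?_
  intro x hx
  refine hg _ (Nat.le_floor ?_)
  by_contra! hcon
  exact hx.2 ⟨hx.1, hcon⟩

variable {lam τ : ℕ → ℝ}

/-- The set of indices of the eigenvalues `λ_k + i(τ_k + 2πm)` in the disc of radius `r`. -/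
def latticeDisc (lam τ : ℕ → ℝ) (r : ℝ) : Set (ℕ × ℤ) :=
  {p | √(lam p.1 ^ 2 + (τ p.1 + 2 * Real.pi * p.2) ^ 2) ≤ r}

/-- The number of points of `latticeDisc` in the `k`-th row. -/
noncomputable def rowCount (lam τ : ℕ → ℝ) (r : ℝ) (k : ℕ) : ℕ :=
  if lam k ≤ r then latticeCount (τ k) √(r ^ 2 - lam k ^ 2) else 0

theorem mem_latticeDisc_iff (hpos : ∀ k, 0 < lam k) {r : ℝ} {p : ℕ × ℤ} :
    p ∈ latticeDisc lam τ r ↔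
      lam p.1 ≤ r ∧ |τ p.1 + 2 * Real.pi * p.2| ≤ √(r ^ 2 - lam p.1 ^ 2) := by
  have h0 := hpos p.1
  have key : ∀ x : ℝ, √(lam p.1 ^ 2 + x ^ 2) ≤ r ↔ lam p.1 ≤ r ∧ |x| ≤ √(r ^ 2 - lam p.1 ^ 2) := by
    intro x
    constructor
    · intro h
      have hr : 0 ≤ r := (Real.sqrt_nonneg _).trans h
      rw [Real.sqrt_le_left hr] at h
      refine ⟨?_, Real.abs_le_sqrt (by linarith)⟩
      exact le_of_sq_le_sq (by nlinarith [sq_nonneg x]) hr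
    · rintro ⟨h1, h2⟩
      have hr : 0 ≤ r := h0.le.trans h1
      have h3 : 0 ≤ r ^ 2 - lam p.1 ^ 2 := by nlinarith
      rw [Real.sqrt_le_left hr]
      have h4 := (Real.le_sqrt (abs_nonneg x) h3).1 h2
      rw [sq_abs] at h4
      linarith
  exact key _

theorem latticeDisc_finite (hpos : ∀ k, 0 < lam k) (r : ℝ) {n : ℕ} (hn : ∀ k, n ≤ k → r < lam k) :
    (latticeDisc lam τ r).Finite ∧
      (latticeDisc lam τ r).ncard = ∑ k ∈ Finset.range n, rowCount lam τ r k := by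
  classical
  set F : Finset (ℕ × ℤ) := (Finset.range n).sigma (fun k =>
    if lam k ≤ r then (lattice_finite (τ k) √(r ^ 2 - lam k ^ 2)).toFinset else ∅) |>.map
      (Equiv.sigmaEquivProd ℕ ℤ).toEmbedding with hF
  have hset : latticeDisc lam τ r = ↑F := by
    ext p
    rw [mem_latticeDisc_iff hpos]
    simp only [hF, Finset.coe_map, Equiv.coe_toEmbedding, Set.mem_image, Finset.mem_coe,
      Finset.mem_sigma, Finset.mem_range]
    constructor
    · rintro ⟨h1, h2⟩
      refine ⟨⟨p.1, p.2⟩, ⟨?_, ?_⟩, rfl⟩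
      · by_contra! hcon
        exact absurd h1 (not_le.2 (hn _ hcon))
      · simp only [h1, if_true, Set.Finite.mem_toFinset]
        exact h2
    · rintro ⟨q, ⟨h1, h2⟩, rfl⟩
      split_ifs at h2 with h3
      · rw [Set.Finite.mem_toFinset] at h2
        exact ⟨h3, h2⟩
      · simp at h2
  refine ⟨hset ▸ F.finite_toSet, ?_⟩
  rw [hset, Set.ncard_coe_finset, hF, Finset.card_map, Finset.card_sigma]
  refine Finset.sum_congr rfl fun k _ => ?_
  rw [rowCount]
  split_ifs with h
  · rw [latticeCount, Set.ncard_eq_toFinset_card _ (lattice_finite _ _)]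
  · simp

/-- The limiting profile of the rows. -/
noncomputable def profile (y : ℝ) : ℝ := √(1 - y ^ 2) / Real.pi

theorem profile_le_one (y : ℝ) : profile y ≤ 1 := by
  have h1 : √(1 - y ^ 2) ≤ 1 := Real.sqrt_le_one.2 (by nlinarith [sq_nonneg y])
  have h2 : (1 : ℝ) ≤ Real.pi := by linarith [Real.two_le_pi]
  rw [profile, div_le_one Real.pi_pos]
  linarith

theorem profile_nonneg (y : ℝ) : 0 ≤ profile y := by
  have := Real.pi_pos
  unfold profile; positivity

theorem profile_eq_zero {y : ℝ} (hy : 1 ≤ y) : profile y = 0 := by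
  rw [profile, Real.sqrt_eq_zero_of_nonpos (by nlinarith), zero_div]

theorem continuous_profile : Continuous profile := by
  unfold profile; fun_prop

/-- After division by `r` the main term `√(r² - λ_k²)/π` depends on `λ_k / r` only, and the lattice
error becomes `1/r`, uniformly in `k`. For rows outside the disc both terms vanish, as the real
square root is zero on negative numbers. -/
theorem abs_rowCount_div_sub_le {r : ℝ} (hr : 0 < r) (k : ℕ) :
    |(rowCount lam τ r k : ℝ) / r - profile (lam k / r)| ≤ 1 / r := by
  rw [rowCount]
  split_ifs with h
  · have h1 := abs_latticeCount_sub_le (τ k) (Real.sqrt_nonneg (r ^ 2 - lam k ^ 2))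
    have h2 : profile (lam k / r) = √(r ^ 2 - lam k ^ 2) / Real.pi / r := by
      have : 1 - (lam k / r) ^ 2 = (r ^ 2 - lam k ^ 2) / r ^ 2 := by field_simp
      rw [profile, this, Real.sqrt_div' _ (sq_nonneg r), Real.sqrt_sq hr.le, div_right_comm]
    rw [h2, ← sub_div, abs_div, abs_of_pos hr]
    gcongr
  · have h1 : 1 ≤ lam k / r := by rw [one_le_div hr]; exact (not_le.1 h).le
    rw [profile_eq_zero h1]
    simp [hr.le]

/-- Indices of size `r^{1/β}` are those whose eigenvalue is comparable to `r`; this is the rescaling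
under which the row counts have a limit. -/
theorem tendsto_eigenvalue_div {c β : ℝ} (hc : 0 < c) (hβ : 0 < β)
    (hasymp : lam ~[atTop] fun n => c * ((n : ℝ) + 1) ^ β) {x : ℝ} (hx : 0 < x) :
    Tendsto (fun r : ℝ => lam ⌊x * r ^ (1 / β)⌋₊ / r) atTop (𝓝 (c * x ^ β)) := by
  have hρ : Tendsto (fun r : ℝ => r ^ (1 / β)) atTop atTop := tendsto_rpow_atTop (by positivity)
  have hk : Tendsto (fun r : ℝ => ⌊x * r ^ (1 / β)⌋₊) atTop atTop :=
    tendsto_nat_floor_atTop.comp (hρ.const_mul_atTop hx)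
  have hpos : ∀ n : ℕ, 0 < c * ((n : ℝ) + 1) ^ β := fun n => by positivity
  have h1 : Tendsto (fun n : ℕ => lam n / (c * ((n : ℝ) + 1) ^ β)) atTop (𝓝 1) :=
    (isEquivalent_iff_tendsto_one (Eventually.of_forall fun n => (hpos n).ne')).1 hasymp
  have h2 := h1.comp hk
  have h3 : Tendsto (fun r : ℝ => ((⌊x * r ^ (1 / β)⌋₊ : ℝ) + 1) / r ^ (1 / β)) atTop (𝓝 x) := by
    have h4 : Tendsto (fun r : ℝ => (⌊x * r ^ (1 / β)⌋₊ : ℝ) / r ^ (1 / β)) atTop (𝓝 x) :=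
      (tendsto_nat_floor_mul_div_atTop hx.le).comp hρ
    have h5 : Tendsto (fun r : ℝ => 1 / r ^ (1 / β)) atTop (𝓝 0) :=
      tendsto_const_nhds.div_atTop hρ
    simpa [add_div] using h4.add h5
  have h6 : Tendsto (fun r : ℝ => c * (((⌊x * r ^ (1 / β)⌋₊ : ℝ) + 1) / r ^ (1 / β)) ^ β) atTop
      (𝓝 (c * x ^ β)) :=
    ((Real.continuousAt_rpow_const x β (Or.inl hx.ne')).tendsto.comp h3).const_mul c
  have h7 := h2.mul h6
  rw [one_mul] at h7
  refine h7.congr' ?_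
  filter_upwards [eventually_gt_atTop 0] with r hr
  have h8 : (0 : ℝ) < r ^ (1 / β) := Real.rpow_pos_of_pos hr _
  have h9 : (r ^ (1 / β)) ^ β = r := by
    rw [← Real.rpow_mul hr.le, one_div_mul_cancel hβ.ne', Real.rpow_one]
  have h10 := hpos ⌊x * r ^ (1 / β)⌋₊
  have h11 : (0 : ℝ) < ((⌊x * r ^ (1 / β)⌋₊ : ℝ) + 1) ^ β := by positivity
  simp only [Function.comp]
  rw [Real.div_rpow (by positivity) h8.le, h9]
  field_simp

/-- Weyl asymptotics for the points `λ_k + i(τ_k + 2πm)`. -/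
theorem exists_tendsto_ncard_latticeDisc (hpos : ∀ k, 0 < lam k) {c β : ℝ} (hc : 0 < c)
    (hβ : 0 < β) (hasymp : lam ~[atTop] fun n => c * ((n : ℝ) + 1) ^ β) :
    (∀ r, (latticeDisc lam τ r).Finite) ∧ ∃ K : ℝ, 0 < K ∧
      Tendsto (fun r : ℝ => ((latticeDisc lam τ r).ncard : ℝ) / r ^ ((1 + β) / β)) atTop (𝓝 K) := by
  have hpos' : ∀ n : ℕ, 0 < c * ((n : ℝ) + 1) ^ β := fun n => by positivity
  have hlow : ∃ k₀ : ℕ, ∀ k, k₀ ≤ k → c / 2 * ((k : ℝ) + 1) ^ β < lam k := by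
    have h1 : Tendsto (fun n : ℕ => lam n / (c * ((n : ℝ) + 1) ^ β)) atTop (𝓝 1) :=
      (isEquivalent_iff_tendsto_one (Eventually.of_forall fun n => (hpos' n).ne')).1 hasymp
    obtain ⟨k₀, hk⟩ := eventually_atTop.1
      (h1.eventually (lt_mem_nhds (show (1 / 2 : ℝ) < 1 by norm_num)))
    refine ⟨k₀, fun k hkk => ?_⟩
    have := hk k hkk
    rw [lt_div_iff₀ (hpos' k)] at this
    linarith
  obtain ⟨k₀, hk₀⟩ := hlow
  have htop : Tendsto lam atTop atTop := by
    refine tendsto_atTop_mono' _ (eventually_atTop.2 ⟨k₀, fun k hk => (hk₀ k hk).le⟩) ?_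
    refine Tendsto.const_mul_atTop (by positivity) ((tendsto_rpow_atTop hβ).comp ?_)
    exact tendsto_natCast_atTop_atTop.atTop_add tendsto_const_nhds
  have hex : ∀ r, ∃ n : ℕ, ∀ k, n ≤ k → r < lam k := fun r =>
    eventually_atTop.1 (htop.eventually_gt_atTop r)
  refine ⟨fun r => (hex r).elim fun n hn => (latticeDisc_finite hpos r hn).1, ?_⟩
  -- The substitution `y = x r^{1/β}` in the step-function integral contributes `r^{1/β}`, the
  -- normalization of the rows contributes `r`, and together they give `r^{(1+β)/β}`.
  have hint : ∀ r : ℝ, 0 < r → ∫ x in Ioi (0 : ℝ),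
      (rowCount lam τ r ⌊x * r ^ (1 / β)⌋₊ : ℝ) / r =
        ((latticeDisc lam τ r).ncard : ℝ) / r ^ ((1 + β) / β) := by
    intro r hr
    obtain ⟨n, hn⟩ := hex r
    have hρ : 0 < r ^ (1 / β) := Real.rpow_pos_of_pos hr _
    have h1 := integral_comp_mul_right_Ioi
      (fun y : ℝ => (rowCount lam τ r ⌊y⌋₊ : ℝ) / r) 0 hρ
    rw [h1, zero_mul, integral_floor_Ioi (fun k => (rowCount lam τ r k : ℝ) / r) n,
      (latticeDisc_finite hpos r hn).2, ← Finset.sum_div, smul_eq_mul]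
    · have : r ^ ((1 + β) / β) = r ^ (1 / β) * r := by
        rw [add_div, div_self hβ.ne', Real.rpow_add hr, Real.rpow_one]
      rw [this]
      push_cast
      field_simp
    · intro k hk
      simp [rowCount, not_le.2 (hn k hk)]
  -- Beyond `X` every rescaled row is empty once `r ≥ 1`: `x > k₀` makes the lower bound on the
  -- eigenvalues available, and `x > (2/c)^{1/β}` pushes that bound above `r`.
  set X : ℝ := max k₀ ((2 / c) ^ (1 / β)) with hX
  have hXc : ∀ x, X < x → 1 < c / 2 * x ^ β := by
    intro x hx
    have h1 : (2 / c) ^ (1 / β) < x := (le_max_right _ _).trans_lt hx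
    have h2 : ((2 / c) ^ (1 / β)) ^ β < x ^ β :=
      Real.rpow_lt_rpow (by positivity) h1 hβ
    rw [← Real.rpow_mul (by positivity), one_div_mul_cancel hβ.ne', Real.rpow_one] at h2
    calc (1 : ℝ) = c / 2 * (2 / c) := by field_simp
      _ < _ := by gcongr
  -- The constant 2 is 1 for the profile plus 1 for the lattice error `1/r` with `r ≥ 1`.
  have hbd : Integrable ((Ioc 0 X).indicator (fun _ : ℝ => (2 : ℝ)))
      (volume.restrict (Ioi (0 : ℝ))) := by
    refine (IntegrableOn.integrable_indicator ?_ measurableSet_Ioc).restrict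
    exact integrableOn_const (by simp)
  have hlim : Tendsto (fun r : ℝ => ∫ x in Ioi (0 : ℝ),
      (rowCount lam τ r ⌊x * r ^ (1 / β)⌋₊ : ℝ) / r) atTop
        (𝓝 (∫ x in Ioi (0 : ℝ), profile (c * x ^ β))) := by
    refine tendsto_integral_filter_of_dominated_convergence
      ((Ioc 0 X).indicator (fun _ : ℝ => (2 : ℝ))) ?_ ?_ hbd ?_
    · refine Eventually.of_forall fun r => Measurable.aestronglyMeasurable ?_
      have h1 : Measurable fun k : ℕ => (rowCount lam τ r k : ℝ) / r := measurable_from_nat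
      exact h1.comp (Nat.measurable_floor.comp (measurable_id.mul_const _))
    · filter_upwards [eventually_ge_atTop 1] with r hr
      have hr0 : 0 < r := one_pos.trans_le hr
      have hρ1 : 1 ≤ r ^ (1 / β) := Real.one_le_rpow hr (by positivity)
      filter_upwards [ae_restrict_mem measurableSet_Ioi] with x hx
      have hx0 : 0 < x := hx
      rw [Real.norm_eq_abs, abs_of_nonneg (by positivity)]
      by_cases hxX : x ≤ X
      · rw [indicator_of_mem (show x ∈ Ioc 0 X from ⟨hx0, hxX⟩)]
        have h1 := (abs_le.1 (abs_rowCount_div_sub_le (lam := lam) (τ := τ) hr0 ⌊x * r ^ (1 / β)⌋₊)).2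
        have h2 := profile_le_one (lam ⌊x * r ^ (1 / β)⌋₊ / r)
        have h3 : 1 / r ≤ 1 := by rw [div_le_one hr0]; exact hr
        linarith
      · push Not at hxX
        have hk : k₀ ≤ ⌊x * r ^ (1 / β)⌋₊ := by
          refine Nat.le_floor ?_
          calc (k₀ : ℝ) ≤ x := (le_max_left _ _).trans hxX.le
            _ ≤ x * r ^ (1 / β) := le_mul_of_one_le_right hx0.le hρ1
        have h1 := hk₀ _ hk
        have h2 : r < lam ⌊x * r ^ (1 / β)⌋₊ := by
          refine lt_trans ?_ h1
          have h3 : x * r ^ (1 / β) ≤ (⌊x * r ^ (1 / β)⌋₊ : ℝ) + 1 := (Nat.lt_floor_add_one _).le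
          have h4 : (x * r ^ (1 / β)) ^ β ≤ ((⌊x * r ^ (1 / β)⌋₊ : ℝ) + 1) ^ β :=
            Real.rpow_le_rpow (by positivity) h3 hβ.le
          rw [Real.mul_rpow hx0.le (by positivity), ← Real.rpow_mul hr0.le,
            one_div_mul_cancel hβ.ne', Real.rpow_one] at h4
          have h5 := hXc x hxX
          calc r = 1 * r := (one_mul r).symm
            _ < c / 2 * x ^ β * r := by gcongr
            _ = c / 2 * (x ^ β * r) := by ring
            _ ≤ _ := by gcongr
        rw [rowCount, if_neg (not_le.2 h2)]
        simp only [Nat.cast_zero, zero_div]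
        exact indicator_nonneg (fun _ _ => by norm_num) _
    · filter_upwards [ae_restrict_mem measurableSet_Ioi] with x hx
      have h1 : Tendsto (fun r : ℝ => profile (lam ⌊x * r ^ (1 / β)⌋₊ / r)) atTop
          (𝓝 (profile (c * x ^ β))) :=
        (continuous_profile.tendsto _).comp (tendsto_eigenvalue_div hc hβ hasymp hx)
      have h2 : Tendsto (fun r : ℝ => (rowCount lam τ r ⌊x * r ^ (1 / β)⌋₊ : ℝ) / r -
          profile (lam ⌊x * r ^ (1 / β)⌋₊ / r)) atTop (𝓝 0) := by
        refine squeeze_zero_norm' ?_ (tendsto_const_nhds.div_atTop tendsto_id :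
          Tendsto (fun r : ℝ => 1 / r) atTop (𝓝 0))
        filter_upwards [eventually_gt_atTop 0] with r hr
        exact abs_rowCount_div_sub_le hr _
      simpa using h2.add h1
  have hmeas : Measurable fun x : ℝ => profile (c * x ^ β) :=
    continuous_profile.measurable.comp ((measurable_id.pow_const β).const_mul c)
  have hintg : Integrable (fun x : ℝ => profile (c * x ^ β)) (volume.restrict (Ioi (0 : ℝ))) := by
    refine hbd.mono' hmeas.aestronglyMeasurable ?_
    filter_upwards [ae_restrict_mem measurableSet_Ioi] with x hx
    rw [Real.norm_eq_abs, abs_of_nonneg (profile_nonneg _)]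
    by_cases hxX : x ≤ X
    · rw [indicator_of_mem (show x ∈ Ioc 0 X from ⟨hx, hxX⟩)]
      linarith [profile_le_one (c * x ^ β)]
    · push Not at hxX
      have := hXc x hxX
      rw [profile_eq_zero (by linarith)]
      exact indicator_nonneg (fun _ _ => by norm_num) _
  refine ⟨∫ x in Ioi (0 : ℝ), profile (c * x ^ β), ?_, ?_⟩
  · rw [integral_pos_iff_support_of_nonneg (fun x => profile_nonneg _) hintg]
    -- The limit constant is positive because the profile is positive wherever `c x^β < 1`.
    have hsub : Ioo 0 ((1 / c) ^ (1 / β)) ⊆ Function.support (fun x : ℝ => profile (c * x ^ β)) := by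
      intro x hx
      have h2 : x ^ β < ((1 / c) ^ (1 / β)) ^ β := Real.rpow_lt_rpow hx.1.le hx.2 hβ
      rw [← Real.rpow_mul (by positivity), one_div_mul_cancel hβ.ne', Real.rpow_one,
        lt_div_iff₀ hc] at h2
      have h3 : 0 ≤ x ^ β := Real.rpow_nonneg hx.1.le _
      have h4 : 0 < 1 - (c * x ^ β) ^ 2 := by
        have : 0 ≤ c * x ^ β := by positivity
        nlinarith
      have := Real.pi_pos
      exact (div_pos (Real.sqrt_pos.2 h4) this).ne'
    refine lt_of_lt_of_le ?_ (measure_mono hsub)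
    rw [Measure.restrict_apply measurableSet_Ioo, Set.inter_eq_left.2 Ioo_subset_Ioi_self,
      Real.volume_Ioo]
    simp only [sub_zero, ENNReal.ofReal_pos]
    positivity
  · refine hlim.congr' ?_
    filter_upwards [eventually_gt_atTop 0] with r hr
    exact hint r hr

end Counting

/-! ### Diagonal operators -/

section Diagonal

variable {ι : Type*} {E : Type*} [NormedAddCommGroup E] [InnerProductSpace ℂ E]

/-- `D` is diagonal in the Hilbert basis `b`, with diagonal entries `d`. -/
def IsDiag (b : HilbertBasis ι ℂ E) (d : ι → ℂ) (D : E →L[ℂ] E) : Prop :=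
  ∀ x i, inner ℂ (b i) (D x) = d i * inner ℂ (b i) x

variable {b : HilbertBasis ι ℂ E} {d d' : ι → ℂ} {D D' : E →L[ℂ] E}

theorem _root_.HilbertBasis.ext_inner (b : HilbertBasis ι ℂ E) {x y : E}
    (h : ∀ i, inner ℂ (b i) x = inner ℂ (b i) y) : x = y := by
  refine b.repr.injective ?_
  ext i
  simpa only [b.repr_apply_apply] using h i

theorem IsDiag.ext (h : IsDiag b d D) (h' : IsDiag b d D') : D = D' := by
  ext x
  exact b.ext_inner fun i => by rw [h, h']

theorem IsDiag.apply_basis (h : IsDiag b d D) (i : ι) : D (b i) = d i • b i := by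
  classical
  refine b.ext_inner fun j => ?_
  rw [h, inner_smul_right]
  by_cases hij : j = i
  · rw [hij]
  · rw [orthonormal_iff_ite.1 b.orthonormal, if_neg hij, mul_zero, mul_zero]

theorem IsDiag.sub (h : IsDiag b d D) (h' : IsDiag b d' D') : IsDiag b (d - d') (D - D') := by
  intro x i
  simp only [sub_apply, inner_sub_right, h x i, h' x i, Pi.sub_apply]
  ring

theorem IsDiag.mul (h : IsDiag b d D) (h' : IsDiag b d' D') : IsDiag b (d * d') (D * D') := by
  intro x i
  rw [mul_apply_eq_comp, h, h', Pi.mul_apply, mul_assoc]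

theorem IsDiag.opNorm_le (h : IsDiag b d D) {K : ℝ} (hK : 0 ≤ K) (hd : ∀ i, ‖d i‖ ≤ K) :
    ‖D‖ ≤ K := by
  refine ContinuousLinearMap.opNorm_le_bound _ hK fun x => ?_
  have hsq : ∀ y : E, HasSum (fun i => ‖inner ℂ (b i) y‖ ^ 2) (‖y‖ ^ 2) := by
    intro y
    have h1 := (b.hasSum_inner_mul_inner y y).mapL Complex.reCLM
    have h2 : Complex.reCLM (inner ℂ y y) = ‖y‖ ^ 2 := by
      rw [inner_self_eq_norm_sq_to_K]
      norm_cast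
    rw [h2] at h1
    refine h1.congr_fun ?_ |> id
    intro i
    have : (inner ℂ y (b i) : ℂ) * inner ℂ (b i) y = ((‖inner ℂ (b i) y‖ ^ 2 : ℝ) : ℂ) := by
      rw [← inner_conj_symm, mul_comm, Complex.mul_conj, Complex.normSq_eq_norm_sq]
    simp [this, -Complex.ofReal_pow]
  have hle : ‖D x‖ ^ 2 ≤ K ^ 2 * ‖x‖ ^ 2 := by
    refine hasSum_le (fun i => ?_) (hsq (D x)) ((hsq x).mul_left (K ^ 2))
    rw [h, norm_mul, mul_pow]
    have := hd i
    gcongr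
  rw [← mul_pow] at hle
  exact le_of_sq_le_sq hle (by positivity)

theorem exists_isDiag (b : HilbertBasis ι ℂ E) {d : ι → ℂ} {K : ℝ} (hd : ∀ i, ‖d i‖ ≤ K) :
    ∃ D : E →L[ℂ] E, IsDiag b d D := by
  have hmem : ∀ f : lp (fun _ : ι => ℂ) 2, Memℓp (fun i => d i * f i) 2 := by
    intro f
    have h1 := (lp.memℓp f).summable (by norm_num)
    -- `max K 0` covers an empty index set, where `K` may be negative.
    refine memℓp_gen ((h1.mul_left ((max K 0) ^ (2 : ENNReal).toReal)).of_nonneg_of_le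
      (fun i => by positivity) fun i => ?_)
    rw [norm_mul, Real.mul_rpow (norm_nonneg _) (norm_nonneg _)]
    have := (hd i).trans (le_max_left K 0)
    gcongr
  let M : lp (fun _ : ι => ℂ) 2 →ₗ[ℂ] lp (fun _ : ι => ℂ) 2 :=
    { toFun := fun f => ⟨fun i => d i * f i, hmem f⟩
      map_add' := fun f g => by ext i; exact mul_add _ _ _
      map_smul' := fun a f => by ext i; simp [mul_left_comm] }
  have hM : ∀ f, ‖M f‖ ≤ max K 0 * ‖f‖ := by
    intro f
    have h2 : (0 : ℝ) < (2 : ENNReal).toReal := by norm_num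
    have h1 := fun f : lp (fun _ : ι => ℂ) 2 => lp.hasSum_norm h2 f
    have h3 : ‖M f‖ ^ (2 : ENNReal).toReal ≤ (max K 0 * ‖f‖) ^ (2 : ENNReal).toReal := by
      rw [Real.mul_rpow (le_max_right _ _) (norm_nonneg _)]
      refine hasSum_le (fun i => ?_) (h1 (M f)) ((h1 f).mul_left _)
      change ‖d i * f i‖ ^ _ ≤ _
      rw [norm_mul, Real.mul_rpow (norm_nonneg _) (norm_nonneg _)]
      have := (hd i).trans (le_max_left K 0)
      gcongr
    have h0 : 0 ≤ max K 0 * ‖f‖ := mul_nonneg (le_max_right _ _) (norm_nonneg _)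
    exact (Real.rpow_le_rpow_iff (norm_nonneg _) h0 h2).1 h3
  refine ⟨(b.repr.symm : lp (fun _ : ι => ℂ) 2 →L[ℂ] E) ∘L (M.mkContinuous _ hM) ∘L
    (b.repr : E →L[ℂ] lp (fun _ : ι => ℂ) 2), fun x i => ?_⟩
  rw [← b.repr_apply_apply, ← b.repr_apply_apply]
  simp [M]

theorem isCompactOperator_rankOne (x y : E) :
    IsCompactOperator ((innerSL ℂ x).smulRight y : E →L[ℂ] E) := by
  have h : IsCompactOperator (innerSL ℂ x : E →L[ℂ] ℂ) :=
    isCompactOperator_of_locallyCompactSpace_dom (innerSL ℂ x)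
  exact h.clm_comp (ContinuousLinearMap.toSpanSingleton ℂ y)

/-- An eigenvector has no coefficient at an index with `a i ≠ μ`. Finiteness of the remaining
indices makes its expansion a finite sum, so the algebraic span is already the eigenspace. -/
theorem IsDiag.rank_eigenspace {a : ι → ℝ} (h : IsDiag b (fun i => (a i : ℂ)) D) {μ : ℝ}
    (hfin : {i | a i = μ}.Finite) :
    Cardinal.toENat (Module.rank ℂ (Module.End.eigenspace (D : E →ₗ[ℂ] E) (μ : ℂ))) =
      {i | a i = μ}.encard := by
  have hspan : Module.End.eigenspace (D : E →ₗ[ℂ] E) (μ : ℂ) =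
      Submodule.span ℂ (Set.range fun i : {i | a i = μ} => b i) := by
    refine le_antisymm (fun x hx => ?_) (Submodule.span_le.2 ?_)
    · rw [Module.End.mem_eigenspace_iff, ContinuousLinearMap.coe_coe] at hx
      have hzero : ∀ i ∉ hfin.toFinset, b.repr x i • b i = 0 := by
        intro i hi
        rw [Set.Finite.mem_toFinset, mem_ofPred_eq] at hi
        have h1 := h x i
        rw [hx, inner_smul_right] at h1
        have h2 : ((a i : ℂ) - μ) * inner ℂ (b i) x = 0 := by rw [sub_mul, h1, sub_self]
        rcases mul_eq_zero.1 h2 with h3 | h3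
        · exact absurd (by exact_mod_cast sub_eq_zero.1 h3) hi
        · rw [b.repr_apply_apply, h3, zero_smul]
      rw [(b.hasSum_repr x).unique (hasSum_sum_of_ne_finset_zero hzero)]
      refine Submodule.sum_mem _ fun i hi => Submodule.smul_mem _ _ (Submodule.subset_span ?_)
      exact ⟨⟨i, (Set.Finite.mem_toFinset _).1 hi⟩, rfl⟩
    · rintro _ ⟨⟨i, hi⟩, rfl⟩
      rw [SetLike.mem_coe, Module.End.mem_eigenspace_iff, ContinuousLinearMap.coe_coe,
        h.apply_basis]
      simp only [show a i = μ from hi]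
  have hli : LinearIndependent ℂ (fun i : {i | a i = μ} => b i) :=
    b.orthonormal.linearIndependent.comp _ Subtype.val_injective
  rw [hspan, rank_span hli, ← Cardinal.toENat_lift,
    Cardinal.mk_range_eq_of_injective hli.injective, Cardinal.toENat_lift]
  rfl

variable [CompleteSpace E]

theorem IsDiag.star (h : IsDiag b d D) : IsDiag b (star d) (star D) := by
  intro x i
  rw [ContinuousLinearMap.star_eq_adjoint, ContinuousLinearMap.adjoint_inner_right,
    h.apply_basis, inner_smul_left, Pi.star_apply]
  rfl

/-- Cutting off the entries of modulus below `1/(n+1)` leaves a finite-rank operator within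
`1/(n+1)` of `D` in norm. -/
theorem IsDiag.isCompactOperator (h : IsDiag b d D)
    (hd : ∀ ε : ℝ, 0 < ε → {i | ε ≤ ‖d i‖}.Finite) : IsCompactOperator D := by
  classical
  have hpos : ∀ n : ℕ, (0 : ℝ) < 1 / ((n : ℝ) + 1) := fun n => by positivity
  set F : ℕ → Finset ι := fun n => (hd _ (hpos n)).toFinset with hF
  set G : ℕ → E →L[ℂ] E := fun n => ∑ i ∈ F n, (innerSL ℂ (b i)).smulRight (d i • b i) with hG
  have hGd : ∀ n, IsDiag b (fun i => if i ∈ F n then d i else 0) (G n) := by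
    intro n x i
    simp only [hG, sum_apply, ContinuousLinearMap.smulRight_apply,
      innerSL_apply_apply, inner_sum, inner_smul_right, orthonormal_iff_ite.1 b.orthonormal]
    split_ifs with hi
    · rw [Finset.sum_eq_single_of_mem i hi]
      · simp [mul_comm]
      · intro j _ hj
        simp [hj.symm]
    · rw [Finset.sum_eq_zero, zero_mul]
      intro j hj
      have : i ≠ j := fun hij => hi (hij ▸ hj)
      simp [this]
  have hcomp : ∀ n, IsCompactOperator (G n) := by
    intro n
    have : G n ∈ compactOperator (RingHom.id ℂ) E E :=
      Submodule.sum_mem _ fun i _ => isCompactOperator_rankOne _ _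
    exact this
  have hlim : Tendsto G atTop (𝓝 D) := by
    rw [tendsto_iff_norm_sub_tendsto_zero]
    refine squeeze_zero (fun _ => norm_nonneg _) (fun n => ?_) tendsto_one_div_add_atTop_nhds_zero_nat
    refine ((hGd n).sub h).opNorm_le (hpos n).le fun i => ?_
    simp only [Pi.sub_apply]
    split_ifs with hi
    · rw [sub_self, norm_zero]
      exact (hpos n).le
    · simp only [hF, Set.Finite.mem_toFinset, mem_ofPred_eq, not_le] at hi
      simpa using hi.le
  exact isCompactOperator_of_tendsto hlim (Eventually.of_forall hcomp)

/-- By uniqueness of the positive square root it suffices that the diagonal operator with entries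
`|d i|` is positive and squares to `D* D`. Positivity comes from writing it as `Q* Q` with `Q`
diagonal with entries `√|d i|`. -/
theorem IsDiag.sqrt_star_mul_self (h : IsDiag b d D) {K : ℝ} (hd : ∀ i, ‖d i‖ ≤ K) :
    IsDiag b (fun i => (‖d i‖ : ℂ)) (CFC.sqrt (Star.star D * D)) := by
  have hq : ∀ i, ‖((√‖d i‖ : ℝ) : ℂ)‖ ≤ √K := fun i => by
    rw [Complex.norm_real, Real.norm_of_nonneg (Real.sqrt_nonneg _)]
    exact Real.sqrt_le_sqrt (hd i)
  obtain ⟨Q, hQ⟩ := exists_isDiag b hq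
  have hP : IsDiag b (fun i => (‖d i‖ : ℂ)) (Star.star Q * Q) := by
    have := hQ.star.mul hQ
    convert this using 1
    ext i
    have h1 : √‖d i‖ * √‖d i‖ = ‖d i‖ := Real.mul_self_sqrt (norm_nonneg _)
    simp only [Pi.mul_apply, Pi.star_apply, RCLike.star_def, Complex.conj_ofReal]
    rw [← Complex.ofReal_mul, h1]
  have hPP : (Star.star Q * Q) * (Star.star Q * Q) = Star.star D * D := by
    refine IsDiag.ext (hP.mul hP) ?_
    convert h.star.mul h using 1
    ext i
    simp only [Pi.mul_apply, Pi.star_apply, RCLike.star_def]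
    rw [mul_comm (starRingEnd ℂ (d i)), Complex.mul_conj, Complex.normSq_eq_norm_sq]
    push_cast
    ring
  rw [CFC.sqrt_unique hPP (star_mul_self_nonneg Q)]
  exact hP

theorem IsDiag.isSNumberSeq (h : IsDiag b d D) {K : ℝ} (hd : ∀ i, ‖d i‖ ≤ K)
    (hfin : ∀ ε : ℝ, 0 < ε → {i | ε ≤ ‖d i‖}.Finite) {s : ℕ → ℝ} (hanti : Antitone s)
    (hpos : ∀ n, 0 < s n)
    (hs : ∀ n μ, 0 < μ → (μ ≤ s n ↔ n < {i | μ ≤ ‖d i‖}.ncard)) : IsSNumberSeq D s := by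
  refine ⟨hanti, fun n => (hpos n).le, fun μ hμ => ?_⟩
  rw [(h.sqrt_star_mul_self hd).rank_eigenspace
    ((hfin μ hμ).subset fun i hi => le_of_eq (Eq.symm hi))]
  exact encard_rearrangement_eq hfin hs hμ

end Diagonal

/-! ### Joint eigenvectors -/

section JointEigenvectors

variable {H : Type*} [NormedAddCommGroup H] [InnerProductSpace ℂ H]

/-- A linear isometry is diagonalizable on each finite-dimensional invariant subspace. -/
theorem exists_orthonormal_eigenvectors (W : H →ₗᵢ[ℂ] H) (d : ℕ) :
    ∀ K : Submodule ℂ H, FiniteDimensional ℂ K → Module.finrank ℂ K = d → (∀ x ∈ K, W x ∈ K) →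
      ∃ v : Fin d → H, Orthonormal ℂ v ∧ ∀ i, v i ∈ K ∧
        ∃ θ : ℝ, W (v i) = Complex.exp (θ * Complex.I) • v i := by
  induction d with
  | zero =>
    intro K _ _ _
    exact ⟨Fin.elim0, ⟨fun i => i.elim0, fun i => i.elim0⟩, fun i => i.elim0⟩
  | succ d ih =>
    intro K hK hd hWK
    have hnt : Nontrivial K := Module.nontrivial_of_finrank_pos (R := ℂ) (by omega)
    obtain ⟨z, hz⟩ := Module.End.exists_eigenvalue ((W : H →ₗ[ℂ] H).restrict hWK)
    obtain ⟨x, hx⟩ := hz.exists_hasEigenvector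
    have hx0 : (x : H) ≠ 0 := fun h => hx.2 (Subtype.ext h)
    have hWx : W x = z • (x : H) := congrArg Subtype.val hx.apply_eq_smul
    have hnx : ‖(x : H)‖ ≠ 0 := norm_ne_zero_iff.2 hx0
    have hz1 : ‖z‖ = 1 := by
      have h1 : ‖W x‖ = ‖(x : H)‖ := W.norm_map x
      rw [hWx, norm_smul] at h1
      exact (mul_eq_right₀ hnx).1 h1
    set v : H := ((‖(x : H)‖⁻¹ : ℝ) : ℂ) • (x : H) with hv
    have hv1 : ‖v‖ = 1 := by
      rw [hv, norm_smul, Complex.norm_real, norm_inv, norm_norm, inv_mul_cancel₀ hnx]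
    have hvK : v ∈ K := K.smul_mem _ x.2
    have hWv : W v = z • v := by rw [hv, map_smul, hWx, smul_comm]
    have hvz : Complex.exp (Complex.arg z * Complex.I) = z := by
      have := Complex.norm_mul_exp_arg_mul_I z
      rwa [hz1, Complex.ofReal_one, one_mul] at this
    have hle : Submodule.span ℂ {v} ≤ K := (Submodule.span_singleton_le_iff_mem _ _).2 hvK
    have hfin : FiniteDimensional ℂ ((Submodule.span ℂ {v})ᗮ ⊓ K : Submodule ℂ H) :=
      Submodule.finiteDimensional_of_le inf_le_right
    have hrank : Module.finrank ℂ ((Submodule.span ℂ {v})ᗮ ⊓ K : Submodule ℂ H) = d := by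
      have h1 := Submodule.finrank_add_inf_finrank_orthogonal hle
      have hv0 : v ≠ 0 := fun h => by simp [h] at hv1
      rw [finrank_span_singleton hv0, hd] at h1
      omega
    -- The orthogonal complement of `v` in `K` is again invariant: for `y ⟂ v`, `⟨W v, W y⟩ = ⟨v, y⟩
    -- = 0` while `W v = z v` with `z ≠ 0`.
    obtain ⟨f, hf, hf2⟩ := ih _ hfin hrank (by
      intro y hy
      refine ⟨?_, hWK y hy.2⟩
      have h1 := Submodule.mem_orthogonal_singleton_iff_inner_right.1 hy.1
      rw [SetLike.mem_coe, Submodule.mem_orthogonal_singleton_iff_inner_right]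
      have h2 : inner ℂ (W v) (W y) = inner ℂ v y := W.inner_map_map v y
      rw [hWv, inner_smul_left, h1] at h2
      refine (mul_eq_zero.1 h2).resolve_left fun h3 => ?_
      rw [map_eq_zero] at h3
      simp [h3] at hz1)
    have hperp : ∀ i, inner ℂ v (f i) = 0 := fun i =>
      Submodule.mem_orthogonal_singleton_iff_inner_right.1 (hf2 i).1.1
    refine ⟨Fin.cons v f, ⟨fun i => ?_, fun i j hij => ?_⟩, fun i => ?_⟩
    · refine Fin.cases ?_ (fun i => ?_) i
      · simpa using hv1
      · simpa using hf.1 i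
    · revert hij
      refine Fin.cases (Fin.cases (fun h => absurd rfl h) (fun j _ => ?_) j)
        (fun i => Fin.cases (fun _ => ?_) (fun j hij => ?_) j) i
      · simpa using hperp j
      · simpa using inner_eq_zero_symm.1 (hperp i)
      · simpa using hf.2 (fun h => hij (congrArg Fin.succ h))
    · refine Fin.cases ?_ (fun i => ?_) i
      · exact ⟨by simpa using hvK, Complex.arg z, by simp [hvz, hWv]⟩
      · simpa using ⟨(hf2 i).1.2, (hf2 i).2⟩

variable {C : H →ₗ.[ℂ] H} {lam : ℕ → ℝ}

/-- `Cardinal.toENat` sends every infinite cardinal to `⊤`, so finiteness of the index set is what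
forces the rank to be a natural number. -/
theorem finrank_eigenspace_eq_card {μ : ℝ} (hfin : {n : ℕ | lam n = μ}.Finite)
    (hlam : {n : ℕ | lam n = μ}.encard = Cardinal.toENat (Module.rank ℂ (eigenspace C μ))) :
    FiniteDimensional ℂ (eigenspace C μ) ∧
      Module.finrank ℂ (eigenspace C μ) = Nat.card {n : ℕ | lam n = μ} := by
  have h1 : {n : ℕ | lam n = μ}.encard = (Nat.card {n : ℕ | lam n = μ} : ℕ∞) := by
    rw [← hfin.cast_ncard_eq]; rfl
  rw [h1, eq_comm, Cardinal.toENat_eq_natCast] at hlam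
  refine ⟨?_, Module.finrank_eq_of_rank_eq hlam⟩
  rw [FiniteDimensional, ← Module.rank_lt_aleph0_iff, hlam]
  exact Cardinal.natCast_lt_aleph0

/-- The eigenvalues of a nonnegative invertible self-adjoint operator are positive. -/
theorem eigenvalue_pos (hC_pos : ∀ x : C.domain, 0 ≤ (inner ℂ (x : H) (C x)).re) {S : H →L[ℂ] H}
    (hS : IsInverse C.graph S) {μ : ℝ} {x : H} (hx0 : x ≠ 0) (hx : x ∈ eigenspace C μ) :
    0 < μ := by
  have hx' : (x, (μ : ℂ) • x) ∈ C.graph := hx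
  refine lt_of_le_of_ne ?_ ?_
  · obtain ⟨a, h1, h2⟩ := (LinearPMap.mem_graph_iff C).1 hx'
    have h3 := hC_pos a
    simp only at h1 h2
    rw [h1, h2, inner_smul_right, inner_self_eq_norm_sq_to_K, Complex.re_ofReal_mul] at h3
    have h4 : (0 : ℝ) < ‖x‖ ^ 2 := by have := norm_pos_iff.2 hx0; positivity
    have h5 : (((‖x‖ : ℂ)) ^ 2).re = ‖x‖ ^ 2 := by norm_cast
    change 0 ≤ μ * (((‖x‖ : ℂ)) ^ 2).re at h3
    rw [h5] at h3
    exact nonneg_of_mul_nonneg_left h3 h4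
  · rintro rfl
    rw [Complex.ofReal_zero, zero_smul, hS, map_zero] at hx'
    exact hx0 hx'.symm

variable [CompleteSpace H]

theorem inner_graph_symm {C : H →ₗ.[ℂ] H} (hC : IsSelfAdjoint C) {x y x' y' : H}
    (h : (x, y) ∈ C.graph) (h' : (x', y') ∈ C.graph) : inner ℂ y x' = inner ℂ x y' := by
  obtain ⟨a, rfl, rfl⟩ := (LinearPMap.mem_graph_iff C).1 h
  obtain ⟨b, rfl, rfl⟩ := (LinearPMap.mem_graph_iff C).1 h'
  have h1 := LinearPMap.adjoint_isFormalAdjoint hC.dense_domain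
  rw [LinearPMap.isSelfAdjoint_def.1 hC] at h1
  exact h1 a b

/-- An orthonormal sequence of eigenvectors belonging to the eigenvalue sequence is total. -/
theorem orthogonal_span_eigenvectors_eq_bot (hC : IsSelfAdjoint C) {S : H →L[ℂ] H}
    (hS : IsInverse C.graph S) (hScpt : IsCompactOperator S)
    (hfin : ∀ μ, {n : ℕ | lam n = μ}.Finite)
    (hlam : ∀ μ : ℝ, {n : ℕ | lam n = μ}.encard =
      Cardinal.toENat (Module.rank ℂ (eigenspace C μ)))
    {x : ℕ → H} (hx : Orthonormal ℂ x) (hxC : ∀ n, x n ∈ eigenspace C (lam n)) :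
    (Submodule.span ℂ (Set.range x))ᗮ = ⊥ := by
  have hSg : ∀ y, (S y, y) ∈ C.graph := fun y => (hS _ _).2 rfl
  have hsymm : S.IsSymmetric := fun y z => (inner_graph_symm hC (hSg y) (hSg z)).symm
  -- The spectral theorem for the compact symmetric operator `S = C⁻¹` reduces totality to showing
  -- that each eigenvector of `S` lies in the span of the `x n`.
  have htot := ContinuousLinearMap.orthogonalComplement_iSup_eigenspaces_eq_bot hScpt hsymm
  refine eq_bot_iff.2 (le_trans (Submodule.orthogonal_le (iSup_le fun κ => ?_)) htot.le)
  intro z hz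
  rw [Module.End.mem_eigenspace_iff, ContinuousLinearMap.coe_coe] at hz
  by_cases hz0 : z = 0
  · rw [hz0]; exact zero_mem _
  have hκ0 : κ ≠ 0 := by
    rintro rfl
    rw [zero_smul] at hz
    have h1 : ((0 : H), z) ∈ C.graph := hz ▸ hSg z
    exact hz0 (LinearPMap.graph_fst_eq_zero_snd C h1 rfl)
  have hκr : ((κ.re : ℝ) : ℂ) = κ := by
    have h1 : inner ℂ (S z) z = inner ℂ z (S z) := hsymm z z
    rw [hz, inner_smul_left, inner_smul_right] at h1
    have h2 := mul_right_cancel₀ (inner_self_ne_zero.2 hz0) h1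
    exact Complex.conj_eq_iff_re.1 h2
  obtain ⟨hfd, hcard⟩ := finrank_eigenspace_eq_card (hfin κ.re⁻¹) (hlam κ.re⁻¹)
  have hzE : z ∈ eigenspace C κ.re⁻¹ := by
    change (z, ((κ.re⁻¹ : ℝ) : ℂ) • z) ∈ C.graph
    rw [hS, map_smul, hz, Complex.ofReal_inv, hκr, smul_smul, inv_mul_cancel₀ hκ0, one_smul]
  have : Fintype {n : ℕ | lam n = κ.re⁻¹} := (hfin _).fintype
  let w : {n : ℕ | lam n = κ.re⁻¹} → eigenspace C κ.re⁻¹ := fun n => ⟨x n, by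
    have h1 := hxC n
    rwa [show lam n = κ.re⁻¹ from n.2] at h1⟩
  have hw : LinearIndependent ℂ w := by
    refine LinearIndependent.of_comp (eigenspace C κ.re⁻¹).subtype ?_
    exact hx.linearIndependent.comp _ Subtype.val_injective
  -- The multiplicity count is used here: the `x n` with `λ_n = 1/κ` are independent and as many as
  -- the dimension of the eigenspace.
  have hspan := hw.span_eq_top_of_card_eq_finrank' (by rw [hcard, Nat.card_eq_fintype_card])
  have hz1 : (⟨z, hzE⟩ : eigenspace C κ.re⁻¹) ∈ Submodule.span ℂ (Set.range w) := by
    rw [hspan]; trivial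
  have hz2 := Submodule.mem_map_of_mem (f := (eigenspace C κ.re⁻¹).subtype) hz1
  rw [Submodule.map_span] at hz2
  refine Submodule.span_mono ?_ hz2
  rintro _ ⟨_, ⟨n, rfl⟩, rfl⟩
  exact ⟨n, rfl⟩

/-- An orthonormal eigenbasis of `C`, ordered along `lam`, which also diagonalizes `W`. -/
theorem exists_joint_eigenvectors (hC : IsSelfAdjoint C)
    (hfin : ∀ μ, {n : ℕ | lam n = μ}.Finite)
    (hlam : ∀ μ : ℝ, {n : ℕ | lam n = μ}.encard =
      Cardinal.toENat (Module.rank ℂ (eigenspace C μ)))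
    (W : H →ₗᵢ[ℂ] H) (hW : ∀ x y : H, (x, y) ∈ C.graph → (W x, W y) ∈ C.graph) :
    ∃ (e : ℕ → H) (θ : ℕ → ℝ), Orthonormal ℂ e ∧ (∀ n, e n ∈ eigenspace C (lam n)) ∧
      ∀ n, W (e n) = Complex.exp (θ n * Complex.I) • e n := by
  have key : ∀ μ : ℝ, ∃ f : ℕ → H, Orthonormal ℂ (fun n : {n : ℕ | lam n = μ} => f n) ∧
      ∀ n, lam n = μ → f n ∈ eigenspace C μ ∧
        ∃ θ : ℝ, W (f n) = Complex.exp (θ * Complex.I) • f n := by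
    intro μ
    obtain ⟨hfd, hcard⟩ := finrank_eigenspace_eq_card (hfin μ) (hlam μ)
    obtain ⟨v, hv, hv2⟩ := exists_orthonormal_eigenvectors W _ (eigenspace C μ) hfd rfl (by
      intro x hx
      have := hW _ _ hx
      rw [map_smul] at this
      exact this)
    have : Finite {n : ℕ | lam n = μ} := (hfin μ)
    let q : {n : ℕ | lam n = μ} ≃ Fin (Module.finrank ℂ (eigenspace C μ)) :=
      Finite.equivFinOfCardEq hcard.symm
    classical
    -- The value 0 off the index set of `μ` is a default; `f μ n` is only used for `μ = lam n`.
    refine ⟨fun n => if h : lam n = μ then v (q ⟨n, h⟩) else 0, ?_, ?_⟩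
    · have h1 := hv.comp q q.injective
      convert h1 using 1
      ext n
      simp [show lam n = μ from n.2]
    · intro n hn
      simp only [hn, dif_pos]
      exact hv2 _
  choose f hf hf2 using key
  choose θ hθ using fun n => (hf2 (lam n) n rfl).2
  refine ⟨fun n => f (lam n) n, θ, ⟨fun n => (hf (lam n)).1 ⟨n, rfl⟩, fun n m hnm => ?_⟩,
    fun n => (hf2 (lam n) n rfl).1, hθ⟩
  by_cases h : lam n = lam m
  · have h1 := (hf (lam m)).2 (i := ⟨n, h⟩) (j := ⟨m, rfl⟩) (fun h2 => hnm (congrArg Subtype.val h2))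
    simp only at h1 ⊢
    rwa [h]
  · have h1 := inner_graph_symm hC (hf2 (lam n) n rfl).1 (hf2 (lam m) m rfl).1
    simp only [inner_smul_left, inner_smul_right, Complex.conj_ofReal] at h1
    have h2 : ((lam n : ℂ) - lam m) * inner ℂ (f (lam n) n) (f (lam m) m) = 0 := by
      rw [sub_mul, h1, sub_self]
    refine (mul_eq_zero.1 h2).resolve_left fun h3 => h ?_
    exact_mod_cast sub_eq_zero.1 h3

end JointEigenvectors

/-! ### Strongly continuous families and evolution operators -/

section StronglyContinuous

variable {X H : Type*} [TopologicalSpace X] [NormedAddCommGroup H] [InnerProductSpace ℂ H]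

/-- Uniformly bounded strongly continuous families are jointly continuous. -/
theorem continuous_uncurry_of_strong {M : X → H →L[ℂ] H} (hM : ∀ x, Continuous fun t => M t x)
    {K : ℝ} (hK : ∀ t, ‖M t‖ ≤ K) : Continuous fun p : X × H => M p.1 p.2 := by
  rw [continuous_iff_continuousAt]
  rintro ⟨t₀, x₀⟩
  have h1 : Tendsto (fun p : X × H => M p.1 x₀) (𝓝 (t₀, x₀)) (𝓝 (M t₀ x₀)) :=
    ((hM x₀).comp continuous_fst).tendsto (t₀, x₀)
  have h2 : Tendsto (fun p : X × H => M p.1 (p.2 - x₀)) (𝓝 (t₀, x₀)) (𝓝 0) := by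
    have h3 : Tendsto (fun p : X × H => K * ‖p.2 - x₀‖) (𝓝 (t₀, x₀)) (𝓝 0) := by
      have h4 : Continuous fun p : X × H => K * ‖p.2 - x₀‖ := by fun_prop
      simpa using h4.tendsto (t₀, x₀)
    refine squeeze_zero_norm (fun p => ?_) h3
    exact (M p.1).le_of_opNorm_le (hK _) _
  have h5 := h2.add h1
  rw [zero_add] at h5
  refine h5.congr fun p => ?_
  rw [map_sub, sub_add_cancel]

theorem continuous_of_dense_of_bounded {M : X → H →L[ℂ] H} {K : ℝ} (hK : ∀ t, ‖M t‖ ≤ K)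
    {D : Set H} (hD : Dense D) (hM : ∀ x ∈ D, Continuous fun t => M t x) (x : H) :
    Continuous fun t => M t x := by
  refine continuous_of_uniform_approx_of_continuous fun u hu => ?_
  obtain ⟨ε, hε, hεu⟩ := Metric.mem_uniformity_dist.1 hu
  have hK0 : 0 < |K| + 1 := by positivity
  obtain ⟨y, hy, hxy⟩ := hD.exists_dist_lt x (div_pos hε hK0)
  refine ⟨fun t => M t y, hM y hy, fun t => hεu ?_⟩
  rw [dist_eq_norm] at hxy
  rw [dist_eq_norm, ← map_sub]
  calc ‖M t (x - y)‖ ≤ K * ‖x - y‖ := (M t).le_of_opNorm_le (hK t) _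
    _ ≤ (|K| + 1) * ‖x - y‖ := by gcongr; linarith [le_abs_self K]
    _ < ε := by rwa [lt_div_iff₀' hK0] at hxy

end StronglyContinuous

section Evolution

variable {H : Type*} [NormedAddCommGroup H] [InnerProductSpace ℂ H]
  {C : H →ₗ.[ℂ] H} {Ai : ℝ → H →ₗ.[ℂ] H} {S : H →L[ℂ] H}

/-- The inclusion `A_i C ⊂ C A_i` is turned into `C⁻¹ A_i ⊂ A_i C⁻¹`. In this form `C⁻¹` maps
solutions of the evolution equation to solutions. -/
theorem commute_resolvent (hS : IsInverse C.graph S)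
    (hAi_comm : ∀ t ∈ Icc (0 : ℝ) 1, ∀ x y z : H,
      (x, y) ∈ C.graph → (y, z) ∈ (Ai t).graph → ∃ w, (x, w) ∈ (Ai t).graph ∧ (w, z) ∈ C.graph)
    {t : ℝ} (ht : t ∈ Icc (0 : ℝ) 1) {y z : H} (h : (y, z) ∈ (Ai t).graph) :
    (S y, S z) ∈ (Ai t).graph := by
  obtain ⟨w, h1, h2⟩ := hAi_comm t ht (S y) y z ((hS _ _).2 rfl) h
  rwa [(hS _ _).1 h2]

theorem mem_eigenspace_iff_resolvent (hS : IsInverse C.graph S) {μ : ℝ} (hμ : μ ≠ 0) {x : H} :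
    x ∈ eigenspace C μ ↔ S x = (μ : ℂ)⁻¹ • x := by
  have hμ' : (μ : ℂ) ≠ 0 := by exact_mod_cast hμ
  change (x, (μ : ℂ) • x) ∈ C.graph ↔ _
  rw [hS, map_smul, ← eq_inv_smul_iff₀ hμ']

variable [CompleteSpace H]

/-- The operators `A_i(t) C⁻¹` are bounded, uniformly in `t`, and strongly continuous. -/
theorem exists_bounded_comp_resolvent (hS : IsInverse C.graph S)
    (hAi : ∀ t ∈ Icc (0 : ℝ) 1, IsSelfAdjoint (Ai t))
    (hAi_C1 : ∀ f ∈ C.domain, ∃ a : ℝ → H, ContDiffOn ℝ 1 a (Icc 0 1) ∧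
      ∀ t ∈ Icc (0 : ℝ) 1, (f, a t) ∈ (Ai t).graph) :
    ∃ M : ℝ → H →L[ℂ] H, (∀ t ∈ Icc (0 : ℝ) 1, ∀ x, (S x, M t x) ∈ (Ai t).graph) ∧
      (∀ x, Continuous fun t => M t x) ∧ ∃ K, ∀ t, ‖M t‖ ≤ K := by
  have hdom : ∀ x, S x ∈ C.domain := fun x =>
    LinearPMap.mem_domain_of_mem_graph ((hS (S x) x).2 rfl)
  have hex : ∀ t : Icc (0 : ℝ) 1, ∃ B : H →L[ℂ] H, ∀ x, (S x, B x) ∈ (Ai t).graph := by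
    intro t
    have hd : ∀ x, S x ∈ (Ai t).domain := fun x => by
      obtain ⟨a, -, ha⟩ := hAi_C1 _ (hdom x)
      exact LinearPMap.mem_domain_of_mem_graph (ha t t.2)
    let B : H →ₗ[ℂ] H := (Ai t).toFun ∘ₗ LinearMap.codRestrict (Ai t).domain (S : H →ₗ[ℂ] H) hd
    have hB : ∀ x, (S x, B x) ∈ (Ai t).graph := fun x => (Ai t).mem_graph ⟨S x, hd x⟩
    -- `A_i(t) C⁻¹` is everywhere defined, and closed because `A_i(t)` is, so the closed graph
    -- theorem applies.
    refine ⟨ContinuousLinearMap.ofSeqClosedGraph (g := B) fun v x y hv hBv => ?_, hB⟩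
    have hcl : IsClosed ((Ai t).graph : Set (H × H)) := (hAi t t.2).isClosed
    have h1 : (S x, y) ∈ (Ai t).graph :=
      hcl.mem_of_tendsto (((S.continuous.tendsto x).comp hv).prodMk_nhds hBv)
        (Eventually.of_forall fun n => hB (v n))
    exact LinearPMap.mem_graph_snd_inj _ h1 (hB x) rfl
  choose B hB using hex
  have hcont : ∀ x, Continuous fun t => B t x := by
    intro x
    obtain ⟨a, ha, ha2⟩ := hAi_C1 _ (hdom x)
    have h1 : (fun t : Icc (0 : ℝ) 1 => B t x) = (Icc (0 : ℝ) 1).domRestrict a := by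
      ext t
      exact LinearPMap.mem_graph_snd_inj _ (hB t x) (ha2 t t.2) rfl
    rw [h1]
    exact ha.continuousOn.domRestrict
  -- Each orbit is the continuous image of the compact interval, so pointwise bounds exist and
  -- become uniform.
  obtain ⟨K, hK⟩ := banach_steinhaus (g := B) (by
    intro x
    obtain ⟨K, hK⟩ := (isCompact_range (hcont x)).isBounded.exists_norm_le
    exact ⟨K, fun t => hK _ ⟨t, rfl⟩⟩)
  refine ⟨fun t => B (projIcc 0 1 zero_le_one t), fun t ht x => ?_, fun x =>
    (hcont x).comp continuous_projIcc, K, fun t => hK _⟩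
  simpa only [projIcc_of_mem zero_le_one ht] using hB ⟨t, ht⟩ x

/-- The norm of a solution of `y' + i A_i(t) y = 0` is constant. -/
theorem norm_solution_eq (hAi : ∀ t ∈ Icc (0 : ℝ) 1, IsSelfAdjoint (Ai t)) {q y : ℝ → H}
    (hq : ∀ t ∈ Icc (0 : ℝ) 1, (q t, y t) ∈ (Ai t).graph)
    (hd : ∀ t ∈ Icc (0 : ℝ) 1, HasDerivWithinAt q (-(Complex.I • y t)) (Icc 0 1) t)
    {s t : ℝ} (hs : s ∈ Icc (0 : ℝ) 1) (ht : t ∈ Icc (0 : ℝ) 1) : ‖q t‖ = ‖q s‖ := by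
  have h1 : ∀ r ∈ Icc (0 : ℝ) 1,
      HasDerivWithinAt (fun r => (inner ℂ (q r) (q r) : ℂ)) 0 (Icc 0 1) r := by
    intro r hr
    have h2 := (hd r hr).inner ℂ (hd r hr)
    have h3 := inner_graph_symm (hAi r hr) (hq r hr) (hq r hr)
    -- The derivative of `‖q‖²` is `⟨q, -iy⟩ + ⟨-iy, q⟩`, which vanishes because `⟨y, q⟩ = ⟨q, y⟩`
    -- by symmetry of `A_i`.
    have h4 : (0 : ℂ) = inner ℂ (q r) (-(Complex.I • y r)) + inner ℂ (-(Complex.I • y r)) (q r) := by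
      rw [inner_neg_right, inner_neg_left, inner_smul_left, inner_smul_right, h3, Complex.conj_I]
      ring
    rw [h4]
    exact h2
  have h4 := (convex_Icc (0 : ℝ) 1).is_const_of_fderivWithin_eq_zero (𝕜 := ℝ)
    (fun r hr => (h1 r hr).differentiableWithinAt)
    (fun r hr => by
      have := (h1 r hr).hasFDerivWithinAt.fderivWithin
        ((uniqueDiffOn_Icc (zero_lt_one' ℝ)) r hr)
      rw [this]; ext; simp) ht hs
  simp only [inner_self_eq_norm_sq_to_K] at h4
  have h5 : ‖q t‖ ^ 2 = ‖q s‖ ^ 2 := by exact_mod_cast h4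
  exact (sq_eq_sq₀ (norm_nonneg _) (norm_nonneg _)).1 h5

/-- The operators `U(t, 0)`, extended to all `t`, and their action on the eigenspaces of `C`. -/
theorem exists_isometric_evolution (hC : IsSelfAdjoint C) (hS : IsInverse C.graph S)
    (hAi : ∀ t ∈ Icc (0 : ℝ) 1, IsSelfAdjoint (Ai t))
    (hAi_comm : ∀ t ∈ Icc (0 : ℝ) 1, ∀ x y z : H,
      (x, y) ∈ C.graph → (y, z) ∈ (Ai t).graph → ∃ w, (x, w) ∈ (Ai t).graph ∧ (w, z) ∈ C.graph)
    {M : ℝ → H →L[ℂ] H} (hM : ∀ t ∈ Icc (0 : ℝ) 1, ∀ x, (S x, M t x) ∈ (Ai t).graph)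
    {U : ℝ → ℝ → H →L[ℂ] H} (hU : IsEvolutionFamily C.domain Ai U) :
    ∃ V : ℝ → H →ₗᵢ[ℂ] H, (∀ x, Continuous fun t => V t x) ∧ (∀ x, V 0 x = x) ∧
      (∀ x, V 1 x = U 1 0 x) ∧ ∀ μ : ℝ, μ ≠ 0 → ∀ x ∈ eigenspace C μ,
        (∀ t, V t x ∈ eigenspace C μ) ∧ ∀ t ∈ Icc (0 : ℝ) 1,
          HasDerivWithinAt (fun r => V r x) (-(Complex.I • (μ : ℂ) • M t (V t x))) (Icc 0 1) t := by
  have h0 : (0 : ℝ) ∈ Icc (0 : ℝ) 1 := ⟨le_rfl, zero_le_one⟩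
  have h1 : (1 : ℝ) ∈ Icc (0 : ℝ) 1 := ⟨zero_le_one, le_rfl⟩
  have hsol : ∀ f ∈ C.domain, ∃ y : ℝ → H, ∀ t ∈ Icc (0 : ℝ) 1, (U t 0 f, y t) ∈ (Ai t).graph ∧
      HasDerivWithinAt (fun r => U r 0 f) (-(Complex.I • y t)) (Icc 0 1) t := by
    intro f hf
    have := fun t : Icc (0 : ℝ) 1 => hU.equation 0 h0 f hf t t.2
    choose y hy using this
    exact ⟨fun t => y (projIcc 0 1 zero_le_one t), fun t ht => by
      simpa only [projIcc_of_mem zero_le_one ht] using hy ⟨t, ht⟩⟩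
  have hzero : ∀ x, U 0 0 x = x := by
    intro x
    have := Continuous.ext_on hC.dense_domain (U 0 0).continuous continuous_id
      (fun f hf => hU.initial 0 h0 f hf)
    exact congrFun this x
  have hnorm : ∀ t ∈ Icc (0 : ℝ) 1, ∀ x, ‖U t 0 x‖ = ‖x‖ := by
    intro t ht x
    refine congrFun (Continuous.ext_on hC.dense_domain (U t 0).continuous.norm
      continuous_norm fun f hf => ?_) x
    obtain ⟨y, hy⟩ := hsol f hf
    have := norm_solution_eq hAi (fun t ht => (hy t ht).1) (fun t ht => (hy t ht).2) h0 ht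
    simpa only [hzero] using this
  let V : ℝ → H →ₗᵢ[ℂ] H := fun t =>
    ⟨(U (projIcc 0 1 zero_le_one t) 0 : H →ₗ[ℂ] H), hnorm _ (projIcc 0 1 zero_le_one t).2⟩
  have hV : ∀ t ∈ Icc (0 : ℝ) 1, ∀ x, V t x = U t 0 x := by
    intro t ht x
    change U (projIcc 0 1 zero_le_one t) 0 x = _
    rw [projIcc_of_mem zero_le_one ht]
  refine ⟨V, fun x => ?_, fun x => (hV 0 h0 x).trans (hzero x), hV 1 h1, fun μ hμ x hx => ?_⟩
  · refine continuous_of_dense_of_bounded (M := fun t => (V t).toContinuousLinearMap) (K := 1)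
      (fun t => (V t).norm_toContinuousLinearMap_le) hC.dense_domain (fun f hf => ?_) x
    obtain ⟨y, hy⟩ := hsol f hf
    have h2 : ContinuousOn (fun r => U r 0 f) (Icc 0 1) :=
      fun t ht => (hy t ht).2.continuousWithinAt
    exact h2.domRestrict.comp continuous_projIcc
  · have hxd : x ∈ C.domain := LinearPMap.mem_domain_of_mem_graph (show (x, (μ : ℂ) • x) ∈ C.graph from hx)
    obtain ⟨y, hy⟩ := hsol x hxd
    have hSx := (mem_eigenspace_iff_resolvent hS hμ).1 hx
    have hmem : ∀ t ∈ Icc (0 : ℝ) 1, U t 0 x ∈ eigenspace C μ := by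
      intro t ht
      rw [mem_eigenspace_iff_resolvent hS hμ]
      -- `C⁻¹ U(t,0)x - μ⁻¹ U(t,0)x` solves the same equation and starts at 0. Conservation of the
      -- norm keeps it zero, so `U(t,0)x` stays in the eigenspace.
      have h2 := norm_solution_eq hAi (q := fun t => S (U t 0 x) - (μ : ℂ)⁻¹ • U t 0 x)
        (y := fun t => S (y t) - (μ : ℂ)⁻¹ • y t)
        (fun t ht => (Ai t).graph.sub_mem (commute_resolvent hS hAi_comm ht (hy t ht).1)
          ((Ai t).graph.smul_mem _ (hy t ht).1))
        (fun t ht => by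
          have h3 := ((S.restrictScalars ℝ).hasFDerivAt.comp_hasDerivWithinAt t (hy t ht).2).sub
            ((hy t ht).2.const_smul (μ : ℂ)⁻¹)
          have h4 : -(Complex.I • (S (y t) - (μ : ℂ)⁻¹ • y t)) =
              S (-(Complex.I • y t)) - (μ : ℂ)⁻¹ • -(Complex.I • y t) := by
            rw [map_neg, map_smul, smul_neg, smul_comm _ Complex.I (y t), smul_sub]
            abel
          rw [h4]
          exact h3) h0 ht
      simp only [hzero, hSx, sub_self, norm_zero, norm_eq_zero] at h2
      exact sub_eq_zero.1 h2
    refine ⟨fun t => hmem _ (projIcc 0 1 zero_le_one t).2, fun t ht => ?_⟩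
    -- On the eigenspace `V t x = S (μ V t x)`, so `A_i` acts there as the bounded operator `μ M t`.
    have h3 : y t = (μ : ℂ) • M t (V t x) := by
      refine LinearPMap.mem_graph_snd_inj _ (hy t ht).1
        ((Ai t).graph.smul_mem (μ : ℂ) (hM t ht (V t x))) ?_
      have hμ' : (μ : ℂ) ≠ 0 := by exact_mod_cast hμ
      simp only [hV t ht x]
      rw [(mem_eigenspace_iff_resolvent hS hμ).1 (hmem t ht), smul_inv_smul₀ hμ']
    rw [← h3]
    exact (hy t ht).2.congr (fun r hr => hV r hr x) (hV t ht x)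

end Evolution

/-! ### The unweighted space `L²(H, (0, 1))` -/

/-- Lebesgue measure on `(0, 1)`. -/
noncomputable abbrev unitMeasure : Measure ℝ := volume.restrict (Ioo 0 1)

instance : IsProbabilityMeasure unitMeasure := ⟨by simp [unitMeasure]⟩

/-- The unweighted Hilbert space `L²(H, (0, 1))`. -/
abbrev L2unit (H : Type*) [NormedAddCommGroup H] : Type _ := Lp H 2 unitMeasure

section Weight

variable {H : Type*} [NormedAddCommGroup H] [InnerProductSpace ℂ H] {α : ℝ → ℝ}

theorem ae_weight_eq (hm : AEMeasurable α unitMeasure) (hpos : ∀ᵐ t ∂unitMeasure, 0 < α t) :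
    ae (weight α) = ae unitMeasure := by
  ext s
  change (∀ᵐ t ∂weight α, t ∈ s) ↔ ∀ᵐ t ∂unitMeasure, t ∈ s
  rw [weight, ae_withDensity_iff' hm.ennreal_ofReal]
  refine eventually_congr ?_
  filter_upwards [hpos] with t ht
  simp [ht]

theorem eLpNorm_weight (hm : AEMeasurable α unitMeasure) (hpos : ∀ᵐ t ∂unitMeasure, 0 < α t)
    (u : ℝ → H) (hu : AEStronglyMeasurable u unitMeasure) :
    eLpNorm u 2 (weight α) = eLpNorm (fun t => √(α t) • u t) 2 unitMeasure := by
  rw [eLpNorm_eq_lintegral_rpow_enorm_toReal (by norm_num) (by norm_num),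
    eLpNorm_eq_lintegral_rpow_enorm_toReal (by norm_num) (by norm_num), weight,
    lintegral_withDensity_eq_lintegral_mul₀ hm.ennreal_ofReal (hu.enorm.pow_const _)]
  congr 1
  refine lintegral_congr_ae ?_
  filter_upwards [hpos] with t ht
  simp only [Pi.mul_apply, ENNReal.toReal_ofNat, ENNReal.rpow_ofNat, enorm_smul, mul_pow]
  congr 1
  rw [Real.enorm_of_nonneg (Real.sqrt_nonneg _), ← ENNReal.ofReal_pow (Real.sqrt_nonneg _),
    Real.sq_sqrt ht.le]

theorem memLp_weight_iff (hm : AEMeasurable α unitMeasure) (hpos : ∀ᵐ t ∂unitMeasure, 0 < α t)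
    {u : ℝ → H} (hu : AEStronglyMeasurable u unitMeasure) :
    MemLp u 2 (weight α) ↔ MemLp (fun t => √(α t) • u t) 2 unitMeasure := by
  have hm' : AEMeasurable (fun t => √(α t)) unitMeasure := hm.sqrt
  rw [MemLp, MemLp, eLpNorm_weight hm hpos u hu]
  refine and_congr_left fun _ => ⟨fun _ => hm'.aestronglyMeasurable.smul hu, fun _ => ?_⟩
  exact hu.mono_ac (withDensity_absolutelyContinuous _ _)

/-- Multiplication by `√α` is a unitary operator from `L²_α` onto `L²`. -/
theorem exists_weight_isometry (hm : AEMeasurable α unitMeasure)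
    (hpos : ∀ᵐ t ∂unitMeasure, 0 < α t) :
    ∃ J : L2w H α ≃ₗᵢ[ℂ] L2unit H, ∀ u, J u =ᵐ[unitMeasure] fun t => √(α t) • u t := by
  have hae := ae_weight_eq hm hpos
  have hac : unitMeasure ≪ weight α := Measure.ae_le_iff_absolutelyContinuous.1 hae.ge
  have hmeas : ∀ u : L2w H α, AEStronglyMeasurable u unitMeasure := fun u =>
    (Lp.aestronglyMeasurable u).mono_ac hac
  have hmem : ∀ u : L2w H α, MemLp (fun t => √(α t) • u t) 2 unitMeasure := fun u =>
    (memLp_weight_iff hm hpos (hmeas u)).1 (Lp.memLp u)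
  let J₀ : L2w H α →ₗᵢ[ℂ] L2unit H :=
    { toFun := fun u => (hmem u).toLp _
      map_add' := fun u v => by
        ext1
        have h1 : (u + v : L2w H α) =ᵐ[unitMeasure] u + v := by
          rw [EventuallyEq, ← hae]; exact Lp.coeFn_add u v
        filter_upwards [(hmem (u + v)).coeFn_toLp, (hmem u).coeFn_toLp, (hmem v).coeFn_toLp, h1,
          Lp.coeFn_add ((hmem u).toLp _) ((hmem v).toLp _)] with t h2 h3 h4 h5 h6
        rw [h2, h5, h6, Pi.add_apply, Pi.add_apply, h3, h4, smul_add]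
      map_smul' := fun a u => by
        ext1
        have h1 : (a • u : L2w H α) =ᵐ[unitMeasure] a • u := by
          rw [EventuallyEq, ← hae]; exact Lp.coeFn_smul a u
        filter_upwards [(hmem (a • u)).coeFn_toLp, (hmem u).coeFn_toLp, h1,
          Lp.coeFn_smul a ((hmem u).toLp _)] with t h2 h3 h5 h6
        rw [h2, h5, RingHom.id_apply, h6, Pi.smul_apply, Pi.smul_apply, h3, smul_comm]
      norm_map' := fun u => by
        change ‖(hmem u).toLp _‖ = _
        rw [Lp.norm_toLp, Lp.norm_def, eLpNorm_weight hm hpos u (hmeas u)] }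
  have hJ₀ : ∀ u, J₀ u =ᵐ[unitMeasure] fun t => √(α t) • u t := fun u => (hmem u).coeFn_toLp
  have hsurj : Function.Surjective J₀ := by
    intro x
    have h1 : AEStronglyMeasurable (fun t => (√(α t))⁻¹ • x t) unitMeasure :=
      hm.sqrt.inv.aestronglyMeasurable.smul (Lp.aestronglyMeasurable x)
    have h2 : (fun t => √(α t) • (√(α t))⁻¹ • x t) =ᵐ[unitMeasure] x := by
      filter_upwards [hpos] with t ht
      rw [smul_inv_smul₀ (Real.sqrt_pos.2 ht).ne']
    have h3 : MemLp (fun t => (√(α t))⁻¹ • x t) 2 (weight α) :=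
      (memLp_weight_iff hm hpos h1).2 ((memLp_congr_ae h2).2 (Lp.memLp x))
    refine ⟨h3.toLp _, ?_⟩
    ext1
    have h4 : h3.toLp _ =ᵐ[unitMeasure] fun t => (√(α t))⁻¹ • x t := by
      rw [EventuallyEq, ← hae]; exact h3.coeFn_toLp
    filter_upwards [hJ₀ (h3.toLp _), h4, h2] with t h5 h6 h7
    rw [h5, h6, h7]
  exact ⟨LinearIsometryEquiv.ofSurjective J₀ hsurj, hJ₀⟩

end Weight

/-! ### Fourier analysis on the unit interval and bases moving with `t` -/

section MovingBasis

variable {H : Type*} [NormedAddCommGroup H] [InnerProductSpace ℂ H]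

theorem unitMeasure_integral_eq {E : Type*} [NormedAddCommGroup E] [NormedSpace ℝ E] (f : ℝ → E) :
    ∫ t, f t ∂unitMeasure = ∫ t in (0 : ℝ)..1, f t := by
  rw [intervalIntegral.integral_of_le zero_le_one, unitMeasure, integral_Ioc_eq_integral_Ioo]

theorem memLp_of_continuousOn {E : Type*} [NormedAddCommGroup E] {f : ℝ → E}
    (hf : ContinuousOn f (Icc 0 1)) (p : ℝ≥0∞) : MemLp f p unitMeasure := by
  obtain ⟨K, hK⟩ := (isCompact_Icc (a := (0 : ℝ)) (b := 1)).exists_bound_of_continuousOn hf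
  refine MemLp.of_bound (hf.integrableOn_Icc.mono_set Ioo_subset_Icc_self).1 K ?_
  filter_upwards [ae_restrict_mem measurableSet_Ioo] with t ht
  exact hK t ⟨ht.1.le, ht.2.le⟩

theorem integral_exp_two_pi (n : ℤ) :
    ∫ t in (0 : ℝ)..1, Complex.exp ((2 * Real.pi * n : ℝ) * t * Complex.I) =
      if n = 0 then 1 else 0 := by
  split_ifs with h
  · simp [h]
  · have hc : (2 * Real.pi * n : ℝ) * Complex.I ≠ 0 := by
      have := Real.pi_ne_zero
      simp [h]
    have h1 := integral_exp_mul_complex (a := 0) (b := 1) hc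
    have h2 : Complex.exp ((2 * Real.pi * n : ℝ) * Complex.I) = 1 := by
      rw [Complex.exp_eq_one_iff]
      exact ⟨n, by push_cast; ring⟩
    simp only [Complex.ofReal_one, mul_one, Complex.ofReal_zero, mul_zero, Complex.exp_zero, h2,
      sub_self, zero_div] at h1
    rw [← h1]
    refine intervalIntegral.integral_congr fun t _ => ?_
    exact congrArg Complex.exp (by ring)

/-- Fourier completeness on `(0, 1)`. -/
theorem ae_eq_zero_of_fourier {f : ℝ → ℂ} (hf : MemLp f 2 unitMeasure)
    (h : ∀ n : ℤ, ∫ t, Complex.exp ((-(2 * Real.pi * n) : ℝ) * t * Complex.I) * f t ∂unitMeasure = 0) :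
    f =ᵐ[unitMeasure] 0 := by
  have hIoc : unitMeasure = volume.restrict (Ioc 0 1) := restrict_Ioo_eq_restrict_Ioc
  have h1 := hasSum_sq_fourierCoeffOn (zero_lt_one' ℝ) (f := f) (hIoc ▸ hf)
  have h2 : ∀ n : ℤ, fourierCoeffOn (zero_lt_one' ℝ) f n = 0 := by
    intro n
    rw [fourierCoeffOn_eq_integral, ← unitMeasure_integral_eq]
    refine smul_eq_zero_of_right _ ((integral_congr_ae (Eventually.of_forall fun t => ?_)).trans (h n))
    simp only [smul_eq_mul]
    rw [fourier_coe_apply]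
    congr 2
    push_cast
    simp only [sub_zero, div_one]
    ring
  simp only [h2, norm_zero, ne_eq, OfNat.ofNat_ne_zero, not_false_eq_true, zero_pow, sub_zero,
    inv_one, one_smul] at h1
  have h3 := h1.unique hasSum_zero
  rw [← unitMeasure_integral_eq, integral_eq_zero_iff_of_nonneg (fun t => by positivity)
    hf.integrable_norm_pow'] at h3
  filter_upwards [h3] with t ht
  simpa using ht

/-- The functions `exp(i(τ_k + 2πm)t) h_k(t)` form a Hilbert basis if `(h_k(t))` is one for all
`t`. -/
theorem exists_moving_basis [CompleteSpace H] {h : ℕ → ℝ → H} (hcont : ∀ k, Continuous (h k))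
    (horth : ∀ t, Orthonormal ℂ fun k => h k t)
    (htot : ∀ t, (Submodule.span ℂ (Set.range fun k => h k t))ᗮ = ⊥) (τ : ℕ → ℝ) :
    ∃ b : HilbertBasis (ℕ × ℤ) ℂ (L2unit H), ∀ p, b p =ᵐ[unitMeasure] fun t =>
      Complex.exp ((τ p.1 + 2 * Real.pi * p.2 : ℝ) * t * Complex.I) • h p.1 t := by
  set F : ℕ × ℤ → ℝ → H := fun p t =>
    Complex.exp ((τ p.1 + 2 * Real.pi * p.2 : ℝ) * t * Complex.I) • h p.1 t with hF
  have hFc : ∀ p, Continuous (F p) := fun p => by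
    have := hcont p.1
    fun_prop
  have hmem : ∀ p, MemLp (F p) 2 unitMeasure := fun p => memLp_of_continuousOn (hFc p).continuousOn 2
  set v : ℕ × ℤ → L2unit H := fun p => (hmem p).toLp (F p) with hv
  have hvF : ∀ p, v p =ᵐ[unitMeasure] F p := fun p => (hmem p).coeFn_toLp
  have hortho : Orthonormal ℂ v := by
    classical
    rw [orthonormal_iff_ite]
    rintro ⟨k, m⟩ ⟨k', m'⟩
    have h1 : inner ℂ (v (k, m)) (v (k', m')) =
        ∫ t, (if k = k' then Complex.exp ((2 * Real.pi * (m' - m : ℤ) : ℝ) * t * Complex.I) else 0)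
          ∂unitMeasure := by
      rw [L2.inner_def]
      refine integral_congr_ae ?_
      filter_upwards [hvF (k, m), hvF (k', m')] with t h2 h3
      rw [h2, h3]
      simp only [hF, inner_smul_left, inner_smul_right, orthonormal_iff_ite.1 (horth t)]
      split_ifs with hk
      · subst hk
        rw [← Complex.exp_conj, mul_one, ← Complex.exp_add]
        congr 1
        simp only [map_mul, Complex.conj_ofReal, Complex.conj_I]
        push_cast
        ring
      · ring
    rw [h1]
    by_cases hk : k = k'
    · simp only [hk, if_true, Prod.mk.injEq, true_and]
      rw [unitMeasure_integral_eq, integral_exp_two_pi]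
      refine if_congr ?_ rfl rfl
      rw [sub_eq_zero, eq_comm]
    · simp [hk]
  have hcomplete : (Submodule.span ℂ (Set.range v))ᗮ = ⊥ := by
    rw [eq_bot_iff]
    intro g hg
    rw [Submodule.mem_bot]
    have h1 : ∀ p, inner ℂ (v p) g = 0 := fun p =>
      Submodule.inner_right_of_mem_orthogonal (Submodule.subset_span (Set.mem_range_self p)) hg
    -- For fixed `k`, the inner products of `g` with the functions indexed by `(k, n)` are the
    -- Fourier coefficients of the scalar function `f`, so `f` vanishes almost everywhere.
    have h2 : ∀ k, ∀ᵐ t ∂unitMeasure, inner ℂ (h k t) (g t) = 0 := by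
      intro k
      set f : ℝ → ℂ := fun t =>
        inner ℂ (Complex.exp ((τ k : ℝ) * t * Complex.I) • h k t) (g t) with hf
      have hc : Continuous fun t : ℝ => Complex.exp ((τ k : ℝ) * t * Complex.I) • h k t := by
        have := hcont k
        fun_prop
      have hnorm : ∀ t : ℝ, ‖Complex.exp ((τ k : ℝ) * t * Complex.I) • h k t‖ = 1 := by
        intro t
        rw [norm_smul, (horth t).1 k, mul_one]
        have := Complex.norm_exp_ofReal_mul_I (τ k * t)
        push_cast at this
        exact this
      have hfm : MemLp f 2 unitMeasure := by
        refine (Lp.memLp g).mono (hc.aestronglyMeasurable.inner (Lp.aestronglyMeasurable g)) ?_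
        refine Eventually.of_forall fun t => ?_
        refine (norm_inner_le_norm _ _).trans ?_
        rw [hnorm, one_mul]
      have h3 := ae_eq_zero_of_fourier hfm (fun n => by
        rw [← h1 (k, n), L2.inner_def]
        refine integral_congr_ae ?_
        filter_upwards [hvF (k, n)] with t ht
        rw [ht]
        simp only [hf, hF, inner_smul_left]
        rw [← mul_assoc, ← Complex.exp_conj, ← Complex.exp_conj, ← Complex.exp_add]
        congr 2
        simp only [map_mul, Complex.conj_ofReal, Complex.conj_I]
        push_cast
        ring)
      filter_upwards [h3] with t ht
      simp only [hf, Pi.zero_apply, inner_smul_left] at ht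
      exact (mul_eq_zero.1 ht).resolve_left (by simp [Complex.exp_ne_zero])
    ext1
    -- Countably many `k` share one null set; off it, `g t` is orthogonal to the total family `h k
    -- t`.
    filter_upwards [ae_all_iff.2 h2, Lp.coeFn_zero H 2 unitMeasure] with t ht h0
    rw [h0, Pi.zero_apply, ← Submodule.mem_bot ℂ, ← htot t, Submodule.mem_orthogonal]
    intro y hy
    induction hy using Submodule.span_induction with
    | mem y hy => obtain ⟨k, rfl⟩ := hy; exact ht k
    | zero => exact inner_zero_left _
    | add y z _ _ hy hz => rw [inner_add_left, hy, hz, add_zero]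
    | smul a y _ hy => rw [inner_smul_left, hy, mul_zero]
  refine ⟨HilbertBasis.mkOfOrthogonalEqBot hortho hcomplete, fun p => ?_⟩
  rw [HilbertBasis.coe_mkOfOrthogonalEqBot]
  exact hvF p

/-- A bounded strongly continuous family acts on `L²` by pointwise multiplication. -/
theorem exists_multiplication_operator {M : ℝ → H →L[ℂ] H} (hM : ∀ x, Continuous fun t => M t x)
    {K : ℝ} (hK : ∀ t, ‖M t‖ ≤ K) :
    ∃ T : L2unit H →L[ℂ] L2unit H, ∀ x, T x =ᵐ[unitMeasure] fun t => M t (x t) := by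
  have hbd : ∀ (x : ℝ → H) t, ‖M t (x t)‖ ≤ K * ‖x t‖ := fun x t => (M t).le_of_opNorm_le (hK t) _
  have hmem : ∀ x : L2unit H, MemLp (fun t => M t (x t)) 2 unitMeasure := by
    intro x
    refine MemLp.of_le_mul (Lp.memLp x) ?_ (Eventually.of_forall (hbd x))
    exact (continuous_uncurry_of_strong hM hK).comp_aestronglyMeasurable
      (aestronglyMeasurable_id.prodMk (Lp.aestronglyMeasurable x))
  let T : L2unit H →ₗ[ℂ] L2unit H :=
    { toFun := fun x => (hmem x).toLp _
      map_add' := fun x y => by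
        ext1
        filter_upwards [(hmem (x + y)).coeFn_toLp, (hmem x).coeFn_toLp, (hmem y).coeFn_toLp,
          Lp.coeFn_add x y, Lp.coeFn_add ((hmem x).toLp _) ((hmem y).toLp _)] with t h2 h3 h4 h5 h6
        rw [h2, h5, h6, Pi.add_apply, Pi.add_apply, h3, h4, map_add]
      map_smul' := fun a x => by
        ext1
        filter_upwards [(hmem (a • x)).coeFn_toLp, (hmem x).coeFn_toLp, Lp.coeFn_smul a x,
          Lp.coeFn_smul a ((hmem x).toLp _)] with t h2 h3 h5 h6
        rw [h2, h5, RingHom.id_apply, h6, Pi.smul_apply, Pi.smul_apply, h3, map_smul] }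
  refine ⟨T.mkContinuous K fun x => ?_, fun x => (hmem x).coeFn_toLp⟩
  refine Lp.norm_le_mul_norm_of_ae_le_mul ?_
  filter_upwards [(hmem x).coeFn_toLp] with t ht
  exact (congrArg norm ht).trans_le (hbd x t)

end MovingBasis

/-! ### Primitives of `L²` functions and the boundary condition -/

section Primitive

variable {H : Type*} [NormedAddCommGroup H] [InnerProductSpace ℂ H]

theorem primitive_congr {f g : ℝ → H} (h : f =ᵐ[unitMeasure] g) {t : ℝ} (ht : t ∈ Icc (0 : ℝ) 1) :
    ∫ r in (0 : ℝ)..t, f r = ∫ r in (0 : ℝ)..t, g r := by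
  rw [unitMeasure, restrict_Ioo_eq_restrict_Ioc] at h
  refine intervalIntegral.integral_congr_ae_restrict ?_
  rw [uIoc_of_le ht.1]
  exact ae_restrict_of_ae_restrict_of_subset (Ioc_subset_Ioc_right ht.2) h

/-- On an interval of length one the `L¹` norm is at most the `L²` norm. The primitive at each point
thus depends continuously on the `L²` function, which lets boundary values pass to limits. -/
theorem norm_primitive_le (x : L2unit H) {t : ℝ} (ht : t ∈ Icc (0 : ℝ) 1) :
    ‖∫ r in (0 : ℝ)..t, x r‖ ≤ ‖x‖ := by
  have hx1 : Integrable x unitMeasure := (Lp.memLp x).integrable (by norm_num)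
  calc ‖∫ r in (0 : ℝ)..t, x r‖ ≤ ∫ r in Ioc 0 t, ‖x r‖ := by
        rw [intervalIntegral.integral_of_le ht.1]
        exact norm_integral_le_integral_norm _
    _ = ∫ r in Ioo 0 t, ‖x r‖ := integral_Ioc_eq_integral_Ioo
    _ ≤ ∫ r, ‖x r‖ ∂unitMeasure :=
        setIntegral_mono_set hx1.norm (Eventually.of_forall fun r => norm_nonneg _)
          (Ioo_subset_Ioo_right ht.2).eventuallyLE
    _ = (eLpNorm x 1 unitMeasure).toReal := by
        rw [integral_norm_eq_lintegral_enorm hx1.1, eLpNorm_one_eq_lintegral_enorm]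
    _ ≤ (eLpNorm x 2 unitMeasure).toReal :=
        ENNReal.toReal_mono (Lp.memLp x).2.ne
          (eLpNorm_le_eLpNorm_of_exponent_le (by norm_num) hx1.1)
    _ = ‖x‖ := rfl

theorem primitive_sub (x y : L2unit H) {t : ℝ} (ht : t ∈ Icc (0 : ℝ) 1) :
    ∫ r in (0 : ℝ)..t, (x - y : L2unit H) r =
      (∫ r in (0 : ℝ)..t, x r) - ∫ r in (0 : ℝ)..t, y r := by
  rw [primitive_congr (Lp.coeFn_sub x y) ht, ← intervalIntegral.integral_sub
    (W12.intervalIntegrable_of_mem (Lp.memLp x) ht) (W12.intervalIntegrable_of_mem (Lp.memLp y) ht)]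
  rfl

/-- The pairs `(x, w)` such that `x' = w` and `x(1) = B x(0)`. -/
def boundarySpace (B : H →L[ℂ] H) : Submodule ℂ (L2unit H × L2unit H) where
  carrier := {p | ∃ v₀ : H, (∀ᵐ t ∂unitMeasure, p.1 t = v₀ + ∫ r in (0 : ℝ)..t, p.2 r) ∧
    v₀ + ∫ r in (0 : ℝ)..1, p.2 r = B v₀}
  zero_mem' := by
    have h0 : ∀ t ∈ Icc (0 : ℝ) 1, ∫ r in (0 : ℝ)..t, (0 : L2unit H) r = 0 := fun t ht => by
      rw [primitive_congr (Lp.coeFn_zero H 2 unitMeasure) ht]; simp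
    refine ⟨0, ?_, by simp only [Prod.snd_zero, h0 1 ⟨zero_le_one, le_rfl⟩, add_zero, map_zero]⟩
    filter_upwards [Lp.coeFn_zero H 2 unitMeasure, ae_restrict_mem measurableSet_Ioo] with t h1 ht
    rw [Prod.fst_zero, Prod.snd_zero, h1, h0 t ⟨ht.1.le, ht.2.le⟩, Pi.zero_apply, add_zero]
  add_mem' := by
    rintro p q ⟨v, hv, hvB⟩ ⟨v', hv', hvB'⟩
    have h0 : ∀ t ∈ Icc (0 : ℝ) 1, ∫ r in (0 : ℝ)..t, (p.2 + q.2 : L2unit H) r =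
        (∫ r in (0 : ℝ)..t, p.2 r) + ∫ r in (0 : ℝ)..t, q.2 r := fun t ht => by
      rw [primitive_congr (Lp.coeFn_add p.2 q.2) ht, ← intervalIntegral.integral_add
        (W12.intervalIntegrable_of_mem (Lp.memLp _) ht)
        (W12.intervalIntegrable_of_mem (Lp.memLp _) ht)]
      rfl
    refine ⟨v + v', ?_, ?_⟩
    · filter_upwards [Lp.coeFn_add p.1 q.1, ae_restrict_mem measurableSet_Ioo, hv, hv']
        with t h1 ht h2 h3
      rw [Prod.fst_add, Prod.snd_add, h1, h0 t ⟨ht.1.le, ht.2.le⟩, Pi.add_apply, h2, h3]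
      abel
    · rw [Prod.snd_add, h0 1 ⟨zero_le_one, le_rfl⟩, map_add, ← hvB, ← hvB']
      abel
  smul_mem' := by
    rintro a p ⟨v, hv, hvB⟩
    have h0 : ∀ t ∈ Icc (0 : ℝ) 1, ∫ r in (0 : ℝ)..t, (a • p.2 : L2unit H) r =
        a • ∫ r in (0 : ℝ)..t, p.2 r := fun t ht => by
      rw [primitive_congr (Lp.coeFn_smul a p.2) ht, ← intervalIntegral.integral_smul]
      rfl
    refine ⟨a • v, ?_, ?_⟩
    · filter_upwards [Lp.coeFn_smul a p.1, ae_restrict_mem measurableSet_Ioo, hv] with t h1 ht h2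
      rw [Prod.smul_fst, Prod.smul_snd, h1, h0 t ⟨ht.1.le, ht.2.le⟩, Pi.smul_apply, h2, smul_add]
    · rw [Prod.smul_snd, h0 1 ⟨zero_le_one, le_rfl⟩, map_smul, ← hvB, smul_add]

/-- Convergence of the derivatives in `L²` gives convergence of the primitives at every point; the
initial values are recovered from a subsequence of the functions converging almost everywhere. -/
theorem isClosed_boundarySpace (B : H →L[ℂ] H) :
    IsClosed (boundarySpace B : Set (L2unit H × L2unit H)) := by
  refine IsSeqClosed.isClosed fun p q hp hpq => ?_
  have hpq1 : Tendsto (fun n => (p n).1) atTop (𝓝 q.1) := (continuous_fst.tendsto q).comp hpq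
  have hpq2 : Tendsto (fun n => (p n).2) atTop (𝓝 q.2) := (continuous_snd.tendsto q).comp hpq
  choose v hv hvB using hp
  obtain ⟨ns, hns, hae⟩ := (tendstoInMeasure_of_tendsto_Lp hpq1).exists_seq_tendsto_ae
  have hR : ∀ t ∈ Icc (0 : ℝ) 1, Tendsto (fun n => ∫ r in (0 : ℝ)..t, (p (ns n)).2 r) atTop
      (𝓝 (∫ r in (0 : ℝ)..t, q.2 r)) := by
    intro t ht
    rw [tendsto_iff_norm_sub_tendsto_zero]
    refine squeeze_zero (fun _ => norm_nonneg _) (fun n => ?_)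
      (tendsto_iff_norm_sub_tendsto_zero.1 (hpq2.comp hns.tendsto_atTop))
    rw [← primitive_sub _ _ ht]
    exact norm_primitive_le _ ht
  have hall := (hae.and (ae_all_iff.2 hv)).and (ae_restrict_mem measurableSet_Ioo)
  -- One point of convergence suffices: there the initial value is the function minus its primitive,
  -- and both converge.
  obtain ⟨t₀, ⟨h1, h2⟩, h3⟩ := hall.exists
  have hv₀ : Tendsto (fun n => v (ns n)) atTop (𝓝 (q.1 t₀ - ∫ r in (0 : ℝ)..t₀, q.2 r)) := by
    refine (h1.sub (hR t₀ ⟨h3.1.le, h3.2.le⟩)).congr fun n => ?_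
    rw [h2 (ns n), add_sub_cancel_right]
  refine ⟨q.1 t₀ - ∫ r in (0 : ℝ)..t₀, q.2 r, ?_, ?_⟩
  · filter_upwards [hall] with t ht
    have h4 := hv₀.add (hR t ⟨ht.2.1.le, ht.2.2.le⟩)
    refine tendsto_nhds_unique ht.1.1 (h4.congr fun n => ?_)
    rw [ht.1.2 (ns n)]
  · have h4 := hv₀.add (hR 1 ⟨zero_le_one, le_rfl⟩)
    refine tendsto_nhds_unique h4 ((((B.continuous.tendsto _).comp hv₀)).congr fun n => ?_)
    exact (hvB (ns n)).symm

end Primitive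

/-! ### Integration by parts -/

section IntegrationByParts

theorem integrable_of_continuousOn {E : Type*} [NormedAddCommGroup E] {f : ℝ → E}
    (hf : ContinuousOn f (Icc 0 1)) : Integrable f unitMeasure :=
  hf.integrableOn_Icc.mono_set Ioo_subset_Icc_self

theorem integral_deriv_unit {E : Type*} [NormedAddCommGroup E] [NormedSpace ℝ E] [CompleteSpace E]
    {x x' : ℝ → E} (hx : ∀ t ∈ Icc (0 : ℝ) 1, HasDerivWithinAt x (x' t) (Icc 0 1) t)
    (hx' : ContinuousOn x' (Icc 0 1)) {s t : ℝ} (hs : s ∈ Icc (0 : ℝ) 1) (ht : t ∈ Icc (0 : ℝ) 1)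
    (hst : s ≤ t) : ∫ r in s..t, x' r = x t - x s := by
  have hsub : Icc s t ⊆ Icc 0 1 := Icc_subset_Icc hs.1 ht.2
  refine intervalIntegral.integral_eq_sub_of_hasDerivAt_of_le hst
    (fun r hr => (hx r (hsub hr)).continuousWithinAt.mono hsub) (fun r hr => ?_)
    ((hx'.mono hsub).intervalIntegrable_of_Icc hst)
  exact (hx r (hsub ⟨hr.1.le, hr.2.le⟩)).hasDerivAt
    (Icc_mem_nhds (hs.1.trans_lt hr.1) (hr.2.trans_le ht.2))

variable {H : Type*} [NormedAddCommGroup H] [InnerProductSpace ℂ H] [CompleteSpace H]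

/-- Integration by parts against a primitive of a square integrable function. -/
theorem integral_inner_deriv_add {x x' : ℝ → H}
    (hx : ∀ t ∈ Icc (0 : ℝ) 1, HasDerivWithinAt x (x' t) (Icc 0 1) t)
    (hx' : ContinuousOn x' (Icc 0 1)) {v w : ℝ → H} (hw : MemLp w 2 unitMeasure)
    (hv : ∀ t ∈ Icc (0 : ℝ) 1, v t = v 0 + ∫ r in (0 : ℝ)..t, w r) :
    ∫ t, (inner ℂ (x' t) (v t) + inner ℂ (x t) (w t) : ℂ) ∂unitMeasure =
      inner ℂ (x 1) (v 1) - inner ℂ (x 0) (v 0) := by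
  have m0 : (0 : ℝ) ∈ Icc (0 : ℝ) 1 := ⟨le_rfl, zero_le_one⟩
  have m1 : (1 : ℝ) ∈ Icc (0 : ℝ) 1 := ⟨zero_le_one, le_rfl⟩
  have hxc : ContinuousOn x (Icc 0 1) := fun t ht => (hx t ht).continuousWithinAt
  have hwi : Integrable w unitMeasure := hw.integrable (by norm_num)
  have hx'i := integrable_of_continuousOn hx'
  have hxi := integrable_of_continuousOn hxc
  -- Since `v` is only a primitive, the product rule is replaced by Fubini on the triangle `r ≤ t`:
  -- integrating out `r` produces `v t - v 0`, integrating out `t` produces `x 1 - x r`.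
  set F : ℝ → ℝ → ℂ := fun t r => if r ≤ t then inner ℂ (x' t) (w r) else 0 with hF
  have hFint : Integrable (Function.uncurry F) (unitMeasure.prod unitMeasure) := by
    have h1 : Integrable (fun p : ℝ × ℝ => ‖x' p.1‖ * ‖w p.2‖) (unitMeasure.prod unitMeasure) :=
      hx'i.norm.mul_prod hwi.norm
    have h2 : AEStronglyMeasurable (fun p : ℝ × ℝ => (inner ℂ (x' p.1) (w p.2) : ℂ))
        (unitMeasure.prod unitMeasure) := hx'i.1.comp_fst.inner hwi.1.comp_snd
    have h3 : Integrable (fun p : ℝ × ℝ => (inner ℂ (x' p.1) (w p.2) : ℂ))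
        (unitMeasure.prod unitMeasure) :=
      h1.mono' h2 (Eventually.of_forall fun p => norm_inner_le_norm _ _)
    have h4 : MeasurableSet {p : ℝ × ℝ | p.2 ≤ p.1} := measurableSet_le measurable_snd measurable_fst
    refine (h3.indicator h4).congr (Eventually.of_forall fun p => ?_)
    simp only [hF, Function.uncurry, Set.indicator_apply, mem_ofPred_eq]
  have hswap := integral_integral_swap (f := F) hFint
  have hin1 : ∀ t ∈ Ioo (0 : ℝ) 1, ∫ r, F t r ∂unitMeasure =
      inner ℂ (x' t) (v t) - inner ℂ (x' t) (v 0) := by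
    intro t ht
    have ht' : t ∈ Icc (0 : ℝ) 1 := ⟨ht.1.le, ht.2.le⟩
    have h1 : F t = (Iic t).indicator fun r => inner ℂ (x' t) (w r) := by
      ext r; simp only [hF, Set.indicator_apply, mem_Iic]
    have h2 : Ioo (0 : ℝ) 1 ∩ Iic t = Ioc 0 t := by
      ext r
      simp only [mem_inter_iff, mem_Ioo, mem_Iic, mem_Ioc]
      exact ⟨fun h => ⟨h.1.1, h.2⟩, fun h => ⟨⟨h.1, h.2.trans_lt ht.2⟩, h.2⟩⟩
    rw [hv t ht', inner_add_right, add_sub_cancel_left, h1, setIntegral_indicator measurableSet_Iic,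
      h2, ← intervalIntegral.integral_of_le ht.1.le]
    exact (innerSL ℂ (x' t)).intervalIntegral_comp_comm (W12.intervalIntegrable_of_mem hw ht')
  have hin2 : ∀ r ∈ Ioo (0 : ℝ) 1, ∫ t, F t r ∂unitMeasure =
      inner ℂ (x 1) (w r) - inner ℂ (x r) (w r) := by
    intro r hr
    have hr' : r ∈ Icc (0 : ℝ) 1 := ⟨hr.1.le, hr.2.le⟩
    have h1 : (fun t => F t r) = (Ici r).indicator fun t => inner ℂ (x' t) (w r) := by
      ext t; simp only [hF, Set.indicator_apply, mem_Ici]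
    have h2 : Ioo (0 : ℝ) 1 ∩ Ici r = Ico r 1 := by
      ext t
      simp only [mem_inter_iff, mem_Ioo, mem_Ici, mem_Ico]
      exact ⟨fun h => ⟨h.2, h.1.2⟩, fun h => ⟨⟨hr.1.trans_le h.1, h.2⟩, h.1⟩⟩
    have h3 : ∀ t ∈ Icc (0 : ℝ) 1, HasDerivWithinAt (fun t => (inner ℂ (x t) (w r) : ℂ))
        (inner ℂ (x' t) (w r)) (Icc 0 1) t := by
      intro t ht
      have h4 := (hx t ht).inner ℂ (hasDerivWithinAt_const t (Icc 0 1) (w r))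
      simpa using h4
    have h4 : ContinuousOn (fun t => (inner ℂ (x' t) (w r) : ℂ)) (Icc 0 1) :=
      hx'.inner continuousOn_const
    rw [h1, setIntegral_indicator measurableSet_Ici, h2, integral_Ico_eq_integral_Ioo,
      ← integral_Ioc_eq_integral_Ioo, ← intervalIntegral.integral_of_le hr.2.le,
      integral_deriv_unit h3 h4 hr' m1 hr.2.le]
  have hwx : ∀ a : H, Integrable (fun t => (inner ℂ a (w t) : ℂ)) unitMeasure := fun a =>
    (innerSL ℂ a).integrable_comp hwi
  have hxv₀ : Integrable (fun t => (inner ℂ (x' t) (v 0) : ℂ)) unitMeasure :=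
    integrable_of_continuousOn (hx'.inner continuousOn_const)
  have hmem : ∀ᵐ t ∂unitMeasure, t ∈ Ioo (0 : ℝ) 1 := ae_restrict_mem measurableSet_Ioo
  have hxw : Integrable (fun t => (inner ℂ (x t) (w t) : ℂ)) unitMeasure := by
    have h1 := (hwx (x 1)).sub hFint.integral_prod_right
    refine h1.congr ?_
    filter_upwards [hmem] with r hr
    simp only [Pi.sub_apply, Function.uncurry_apply_pair]
    rw [hin2 r hr, sub_sub_cancel]
  have hxv : Integrable (fun t => (inner ℂ (x' t) (v t) : ℂ)) unitMeasure := by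
    refine (hFint.integral_prod_left.add hxv₀).congr ?_
    filter_upwards [hmem] with t ht
    simp only [Pi.add_apply, Function.uncurry_apply_pair]
    rw [hin1 t ht, sub_add_cancel]
  rw [integral_congr_ae (hmem.mono fun t ht => hin1 t ht),
    integral_congr_ae (hmem.mono fun t ht => hin2 t ht), integral_sub hxv hxv₀,
    integral_sub (hwx _) hxw] at hswap
  have hfin1 : ∫ t, (inner ℂ (x' t) (v 0) : ℂ) ∂unitMeasure =
      inner ℂ (x 1) (v 0) - inner ℂ (x 0) (v 0) := by
    have h3 : ∀ t ∈ Icc (0 : ℝ) 1, HasDerivWithinAt (fun t => (inner ℂ (x t) (v 0) : ℂ))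
        (inner ℂ (x' t) (v 0)) (Icc 0 1) t := by
      intro t ht
      have h4 := (hx t ht).inner ℂ (hasDerivWithinAt_const t (Icc 0 1) (v 0))
      simpa using h4
    rw [unitMeasure_integral_eq, integral_deriv_unit h3 (hx'.inner continuousOn_const) m0 m1
      zero_le_one]
  have hfin2 : ∫ t, (inner ℂ (x 1) (w t) : ℂ) ∂unitMeasure =
      inner ℂ (x 1) (v 1) - inner ℂ (x 1) (v 0) := by
    rw [hv 1 m1, inner_add_right, add_sub_cancel_left, unitMeasure_integral_eq]
    exact (innerSL ℂ (x 1)).intervalIntegral_comp_comm (W12.intervalIntegrable_of_mem hw m1)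
  rw [integral_add hxv hxw]
  rw [hfin1, hfin2] at hswap
  linear_combination hswap

/-- The formal derivative of `√α χ`. -/
noncomputable def weightedDeriv (α : ℝ → ℝ) (χ χ' : ℝ → ℂ) (t : ℝ) : ℂ :=
  (√(α t) : ℝ) * χ' t + (deriv α t / (2 * √(α t)) : ℝ) * χ t

/-- Integration by parts for `√α χ`, where `α` may have zeros. -/
theorem integral_weightedDeriv_mul_add {α : ℝ → ℝ} (hα : ContDiffOn ℝ 2 α (Icc 0 1))
    (hα_nonneg : ∀ t ∈ Icc (0 : ℝ) 1, 0 ≤ α t) (hpos : ∀ᵐ t ∂unitMeasure, 0 < α t)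
    {χ χ' : ℝ → ℂ} (hχ : ∀ t, HasDerivAt χ (χ' t) t) (hχ' : Continuous χ') (h0 : χ 0 = 0)
    (h1 : χ 1 = 0)
    (hint : Integrable (fun t => ((deriv α t / (2 * √(α t)) : ℝ) : ℂ) * χ t) unitMeasure)
    {y y' : ℝ → ℂ} (hy : ∀ t ∈ Icc (0 : ℝ) 1, HasDerivWithinAt y (y' t) (Icc 0 1) t)
    (hy' : ContinuousOn y' (Icc 0 1)) :
    ∫ t, (weightedDeriv α χ χ' t * y t + (√(α t) : ℝ) * χ t * y' t) ∂unitMeasure = 0 := by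
  have m0 : (0 : ℝ) ∈ Icc (0 : ℝ) 1 := ⟨le_rfl, zero_le_one⟩
  have m1 : (1 : ℝ) ∈ Icc (0 : ℝ) 1 := ⟨zero_le_one, le_rfl⟩
  have hyc : ContinuousOn y (Icc 0 1) := fun t ht => (hy t ht).continuousWithinAt
  have hχc : Continuous χ := continuous_iff_continuousAt.2 fun t => (hχ t).continuousAt
  have hαc : ContinuousOn α (Icc 0 1) := hα.continuousOn
  -- `deriv α` is not controlled at the endpoints. The derivative within `[0,1]` is continuous up to
  -- them and agrees with it inside.
  set β : ℝ → ℝ := derivWithin α (Icc 0 1) with hβ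
  have hβc : ContinuousOn β (Icc 0 1) :=
    hα.continuousOn_derivWithin (uniqueDiffOn_Icc zero_lt_one) (by norm_num)
  have hβα : ∀ t ∈ Ioo (0 : ℝ) 1, deriv α t = β t := fun t ht =>
    (derivWithin_of_mem_nhds (Icc_mem_nhds ht.1 ht.2)).symm
  have hαd : ∀ t ∈ Icc (0 : ℝ) 1, HasDerivWithinAt α (β t) (Icc 0 1) t := fun t ht =>
    ((hα.differentiableOn (by norm_num)) t ht).hasDerivWithinAt
  obtain ⟨K, hK⟩ := isCompact_Icc.exists_bound_of_continuousOn hyc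
  -- `F n` is the derivative of `√(α + 1/(n+1)) χ y`, which is differentiable also at the zeros of
  -- `α`. Its integral is zero because `χ` vanishes at both ends.
  set F : ℕ → ℝ → ℂ := fun n t =>
    ((√(α t + 1 / ((n : ℝ) + 1)) : ℝ) * χ' t +
      (β t / (2 * √(α t + 1 / ((n : ℝ) + 1))) : ℝ) * χ t) * y t +
      (√(α t + 1 / ((n : ℝ) + 1)) : ℝ) * χ t * y' t with hF
  have hε : ∀ n : ℕ, (0 : ℝ) < 1 / ((n : ℝ) + 1) := fun n => by positivity
  have hε1 : ∀ n : ℕ, 1 / ((n : ℝ) + 1) ≤ 1 := fun n => by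
    rw [div_le_one (by positivity)]
    linarith [(Nat.cast_nonneg n : (0 : ℝ) ≤ n)]
  have hαε : ∀ n : ℕ, ∀ t ∈ Icc (0 : ℝ) 1, 0 < α t + 1 / ((n : ℝ) + 1) := fun n t ht =>
    add_pos_of_nonneg_of_pos (hα_nonneg t ht) (hε n)
  have hsc : ∀ n : ℕ, ContinuousOn (fun t => √(α t + 1 / ((n : ℝ) + 1))) (Icc 0 1) := fun n =>
    (hαc.add continuousOn_const).sqrt
  have hFc : ∀ n, ContinuousOn (F n) (Icc 0 1) := by
    intro n
    have h2 : ContinuousOn (fun t => β t / (2 * √(α t + 1 / ((n : ℝ) + 1)))) (Icc 0 1) :=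
      hβc.div (continuousOn_const.mul (hsc n)) fun t ht =>
        (mul_pos two_pos (Real.sqrt_pos.2 (hαε n t ht))).ne'
    have h3 := Complex.continuous_ofReal.comp_continuousOn h2
    have h4 := Complex.continuous_ofReal.comp_continuousOn (hsc n)
    exact ((((h4.mul hχ'.continuousOn).add (h3.mul hχc.continuousOn)).mul hyc).add
      ((h4.mul hχc.continuousOn).mul hy'))
  have hzero : ∀ n, ∫ t, F n t ∂unitMeasure = 0 := by
    intro n
    have h2 : ∀ t ∈ Icc (0 : ℝ) 1,
        HasDerivWithinAt (fun t => ((√(α t + 1 / ((n : ℝ) + 1)) : ℝ) : ℂ) * χ t * y t) (F n t)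
          (Icc 0 1) t := by
      intro t ht
      have h3 := (((hαd t ht).add_const (1 / ((n : ℝ) + 1))).sqrt (hαε n t ht).ne').ofReal_comp
      have h4 := (h3.mul (hχ t).hasDerivWithinAt).mul (hy t ht)
      refine h4.congr_deriv ?_
      simp only [hF, Pi.mul_apply]
      ring
    rw [unitMeasure_integral_eq, integral_deriv_unit h2 (hFc n) m0 m1 zero_le_one, h0, h1]
    simp
  have hlim : Tendsto (fun n => ∫ t, F n t ∂unitMeasure) atTop
      (𝓝 (∫ t, (weightedDeriv α χ χ' t * y t + (√(α t) : ℝ) * χ t * y' t) ∂unitMeasure)) := by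
    -- Increasing `α` under the root in the denominator only shrinks the term with `α'`, so it is
    -- dominated by its limit, which `hint` makes integrable.
    refine tendsto_integral_of_dominated_convergence (fun t =>
      √(α t + 1) * (‖χ' t‖ * ‖y t‖ + ‖χ t‖ * ‖y' t‖) +
        ‖((deriv α t / (2 * √(α t)) : ℝ) : ℂ) * χ t‖ * K)
      (fun n => (integrable_of_continuousOn (hFc n)).1) ?_ (fun n => ?_) ?_
    · refine (integrable_of_continuousOn ?_).add (hint.norm.mul_const K)
      exact (hαc.add continuousOn_const).sqrt.mul
        ((hχ'.norm.continuousOn.mul hyc.norm).add (hχc.norm.continuousOn.mul hy'.norm))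
    · filter_upwards [hpos, ae_restrict_mem measurableSet_Ioo] with t hαt ht
      have ht' : t ∈ Icc (0 : ℝ) 1 := ⟨ht.1.le, ht.2.le⟩
      have h2 : √(α t + 1 / ((n : ℝ) + 1)) ≤ √(α t + 1) :=
        Real.sqrt_le_sqrt (by linarith [hε1 n])
      have h3 : √(α t) ≤ √(α t + 1 / ((n : ℝ) + 1)) :=
        Real.sqrt_le_sqrt (by linarith [hε n])
      have h4 : 0 < √(α t) := Real.sqrt_pos.2 hαt
      have h5 : ‖((β t / (2 * √(α t + 1 / ((n : ℝ) + 1))) : ℝ) : ℂ) * χ t‖ ≤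
          ‖((deriv α t / (2 * √(α t)) : ℝ) : ℂ) * χ t‖ := by
        rw [norm_mul, norm_mul, Complex.norm_real, Complex.norm_real, hβα t ht, norm_div, norm_div,
          Real.norm_of_nonneg (by positivity : 0 ≤ 2 * √(α t + 1 / ((n : ℝ) + 1))),
          Real.norm_of_nonneg (by positivity : 0 ≤ 2 * √(α t))]
        gcongr
      have h6 := hK t ht'
      have h7 : ∀ z : ℂ, ‖((√(α t + 1 / ((n : ℝ) + 1)) : ℝ) : ℂ) * z‖ ≤ √(α t + 1) * ‖z‖ := by
        intro z
        rw [norm_mul, Complex.norm_real, Real.norm_of_nonneg (Real.sqrt_nonneg _)]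
        gcongr
      calc ‖F n t‖ ≤ (‖((√(α t + 1 / ((n : ℝ) + 1)) : ℝ) : ℂ) * χ' t‖ +
            ‖((β t / (2 * √(α t + 1 / ((n : ℝ) + 1))) : ℝ) : ℂ) * χ t‖) * ‖y t‖ +
            ‖((√(α t + 1 / ((n : ℝ) + 1)) : ℝ) : ℂ) * χ t‖ * ‖y' t‖ := by
            refine (norm_add_le _ _).trans ?_
            rw [norm_mul _ (y t), norm_mul _ (y' t)]
            gcongr
            exact norm_add_le _ _
        _ = ‖((√(α t + 1 / ((n : ℝ) + 1)) : ℝ) : ℂ) * χ' t‖ * ‖y t‖ +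
            ‖((√(α t + 1 / ((n : ℝ) + 1)) : ℝ) : ℂ) * χ t‖ * ‖y' t‖ +
            ‖((β t / (2 * √(α t + 1 / ((n : ℝ) + 1))) : ℝ) : ℂ) * χ t‖ * ‖y t‖ := by ring
        _ ≤ (√(α t + 1) * ‖χ' t‖) * ‖y t‖ + (√(α t + 1) * ‖χ t‖) * ‖y' t‖ +
            ‖((deriv α t / (2 * √(α t)) : ℝ) : ℂ) * χ t‖ * K := by
            gcongr
            · exact h7 _
            · exact h7 _
        _ = _ := by ring
    · filter_upwards [hpos, ae_restrict_mem measurableSet_Ioo] with t hαt ht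
      have h2 : Tendsto (fun n : ℕ => √(α t + 1 / ((n : ℝ) + 1))) atTop (𝓝 √(α t)) := by
        have h3 : Tendsto (fun n : ℕ => α t + 1 / ((n : ℝ) + 1)) atTop (𝓝 (α t + 0)) :=
          tendsto_const_nhds.add tendsto_one_div_add_atTop_nhds_zero_nat
        rw [add_zero] at h3
        exact (Real.continuous_sqrt.tendsto _).comp h3
      have h3 : Tendsto (fun n : ℕ => β t / (2 * √(α t + 1 / ((n : ℝ) + 1)))) atTop
          (𝓝 (β t / (2 * √(α t)))) :=
        tendsto_const_nhds.div (h2.const_mul 2) (mul_pos two_pos (Real.sqrt_pos.2 hαt)).ne'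
      have h4 := (Complex.continuous_ofReal.tendsto _).comp h2
      have h5 := (Complex.continuous_ofReal.tendsto _).comp h3
      rw [weightedDeriv, hβα t ht]
      exact (((h4.mul_const _).add (h5.mul_const _)).mul_const _).add
        ((h4.mul_const _).mul_const _)
  simp only [hzero] at hlim
  exact tendsto_nhds_unique hlim tendsto_const_nhds

end IntegrationByParts

/-! ### Graphs and adjoints -/

section Adjoints

variable {E : Type*} [NormedAddCommGroup E] [InnerProductSpace ℂ E]

/-- The set of `p` pairing correctly with `q` is a closed subspace, so only generators need
checking. -/
theorem mem_adjoint_closure_span {s : Set (E × E)} {q : E × E}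
    (h : ∀ p ∈ s, inner ℂ p.2 q.1 = inner ℂ p.1 q.2) :
    q ∈ (Submodule.span ℂ s).topologicalClosure.adjoint := by
  rw [Submodule.mem_adjoint_iff]
  intro a b hab
  have hcl : IsClosed {p : E × E | inner ℂ p.2 q.1 = inner ℂ p.1 q.2} :=
    isClosed_eq (continuous_snd.inner continuous_const) (continuous_fst.inner continuous_const)
  have hsub : (Submodule.span ℂ s : Set (E × E)) ⊆ {p | inner ℂ p.2 q.1 = inner ℂ p.1 q.2} := by
    intro p hp
    induction hp using Submodule.span_induction with
    | mem p hp => exact h p hp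
    | zero => simp
    | add p p' _ _ hp hp' =>
      change inner ℂ (p.2 + p'.2) q.1 = inner ℂ (p.1 + p'.1) q.2
      rw [inner_add_left, inner_add_left, hp, hp']
    | smul a p _ hp =>
      change inner ℂ (a • p.2) q.1 = inner ℂ (a • p.1) q.2
      rw [inner_smul_left, inner_smul_left, hp]
  exact sub_eq_zero.2 (closure_minimal hsub hcl hab)

theorem isClosed_graph_adjoint (g : Submodule ℂ (E × E)) :
    IsClosed (g.adjoint : Set (E × E)) := by
  have : (g.adjoint : Set (E × E)) =
      ⋂ p ∈ g, {x : E × E | inner ℂ p.2 x.1 - inner ℂ p.1 x.2 = 0} := by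
    ext x
    simp only [SetLike.mem_coe, Submodule.mem_adjoint_iff, mem_iInter, mem_ofPred_eq, Prod.forall]
  rw [this]
  refine isClosed_biInter fun p _ => isClosed_eq ?_ continuous_const
  exact (continuous_const.inner continuous_fst).sub (continuous_const.inner continuous_snd)

/-- To be in a closed subspace for all vectors it is enough to be so on a Hilbert basis. -/
theorem _root_.HilbertBasis.mem_of_isClosed {ι F G : Type*} [NormedAddCommGroup F]
    [NormedSpace ℂ F] [NormedAddCommGroup G] [NormedSpace ℂ G] (b : HilbertBasis ι ℂ E)
    {Z : Submodule ℂ (F × G)} (hZ : IsClosed (Z : Set (F × G))) (P : E →L[ℂ] F) (Q : E →L[ℂ] G)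
    (h : ∀ i, (P (b i), Q (b i)) ∈ Z) (x : E) : (P x, Q x) ∈ Z := by
  have h1 : Submodule.span ℂ (Set.range b) ≤ Z.comap (P.prod Q : E →ₗ[ℂ] F × G) := by
    rw [Submodule.span_le]
    rintro _ ⟨i, rfl⟩
    exact h i
  have h2 : IsClosed ((Z.comap (P.prod Q : E →ₗ[ℂ] F × G)) : Set E) :=
    hZ.preimage (P.prod Q).continuous
  have h3 := Submodule.topologicalClosure_minimal _ h1 h2
  rw [b.dense_span] at h3
  exact h3 (Submodule.mem_top (x := x))

end Adjoints

/-! ### The coefficient `A(t)` and its adjoint on `D(C)` -/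

section CoefficientGraphs

variable {H : Type*} [NormedAddCommGroup H] [InnerProductSpace ℂ H]
  {α : ℝ → ℝ} {C : H →ₗ.[ℂ] H} {Ai : ℝ → H →ₗ.[ℂ] H} {t : ℝ}

theorem mem_graph_A {f c a : H} (hc : (f, c) ∈ C.graph) (ha : (f, a) ∈ (Ai t).graph) :
    (f, ((deriv α t / (2 * α t) : ℝ) : ℂ) • f + c + Complex.I • a) ∈ (A α C Ai t).graph := by
  obtain ⟨x, hx, rfl⟩ := (LinearPMap.mem_graph_iff _).1 hc
  obtain ⟨y, hy, rfl⟩ := (LinearPMap.mem_graph_iff _).1 ha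
  have hx' : (x : H) = f := hx
  have hy' : (y : H) = f := hy
  have hxd : f ∈ (A α C Ai t).domain :=
    ⟨show f ∈ C.domain from hx' ▸ x.2, show f ∈ (Ai t).domain from hy' ▸ y.2⟩
  refine (LinearPMap.mem_graph_iff _).2 ⟨⟨f, hxd⟩, rfl, ?_⟩
  obtain rfl : x = ⟨f, hxd.1⟩ := Subtype.ext hx
  obtain rfl : y = ⟨f, hxd.2⟩ := Subtype.ext hy
  rfl

variable [CompleteSpace H]

/-- Symmetry of `C` and `A_i(t)` gives the formal adjoint identity, with the sign of `i A_i`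
reversed. Density of `D(A(t)) = D(C)` makes the adjoint single-valued, so the vector found is its
value. -/
theorem mem_graph_A_adjoint (hC : IsSelfAdjoint C) (hAi : IsSelfAdjoint (Ai t))
    (hdom : C.domain ≤ (Ai t).domain) {f c a : H} (hc : (f, c) ∈ C.graph)
    (ha : (f, a) ∈ (Ai t).graph) :
    (f, ((deriv α t / (2 * α t) : ℝ) : ℂ) • f + c - Complex.I • a) ∈ ((A α C Ai t)†).graph := by
  have hd : (A α C Ai t).domain = C.domain := inf_eq_left.2 hdom
  have hdense : Dense ((A α C Ai t).domain : Set H) := by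
    rw [hd]
    exact hC.dense_domain
  have key : ∀ x : (A α C Ai t).domain,
      inner ℂ (((deriv α t / (2 * α t) : ℝ) : ℂ) • f + c - Complex.I • a) (x : H) =
        inner ℂ f (A α C Ai t x) := by
    intro x
    have hxC : (x : H) ∈ C.domain := x.2.1
    have hxA : (x : H) ∈ (Ai t).domain := x.2.2
    have h1 : A α C Ai t x = ((deriv α t / (2 * α t) : ℝ) : ℂ) • (x : H) + C ⟨x, hxC⟩ +
      Complex.I • Ai t ⟨x, hxA⟩ := rfl
    have h2 := inner_graph_symm hC hc (C.mem_graph ⟨x, hxC⟩)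
    have h3 := inner_graph_symm hAi ha ((Ai t).mem_graph ⟨x, hxA⟩)
    rw [h1, inner_sub_left, inner_add_left, inner_add_right, inner_add_right, inner_smul_left,
      inner_smul_right, inner_smul_left, inner_smul_right, Complex.conj_ofReal, Complex.conj_I,
      h2, h3]
    ring
  have hmem : f ∈ ((A α C Ai t)†).domain := LinearPMap.mem_adjoint_domain_of_exists _ ⟨_, key⟩
  exact (LinearPMap.mem_graph_iff _).2 ⟨⟨f, hmem⟩, rfl,
    LinearPMap.adjoint_apply_eq hdense ⟨f, hmem⟩ key⟩

end CoefficientGraphs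

/-! ### Eigenfunctions of the maximal operators -/

section Eigenfunctions

variable {H : Type*} [NormedAddCommGroup H] [InnerProductSpace ℂ H]
  {α : ℝ → ℝ} {C : H →ₗ.[ℂ] H} {Ai : ℝ → H →ₗ.[ℂ] H}

theorem IsTest.hasDerivAt {φ : ℝ → ℂ} (hφ : IsTest φ) (t : ℝ) : HasDerivAt φ (deriv φ t) t :=
  (hφ.1.differentiable (by simp) t).hasDerivAt

theorem IsTest.continuous_deriv {φ : ℝ → ℂ} (hφ : IsTest φ) : Continuous (deriv φ) :=
  hφ.1.continuous_deriv (by simp)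

theorem IsTest.eq_zero {φ : ℝ → ℂ} (hφ : IsTest φ) {t : ℝ} (ht : t ∉ Ioo (0 : ℝ) 1) : φ t = 0 :=
  image_eq_zero_of_notMem_tsupport fun h => ht (hφ.2.2 h)

theorem integrable_inner_of_continuousOn {N x : ℝ → H} (hN : Integrable N unitMeasure)
    (hx : ContinuousOn x (Icc 0 1)) :
    Integrable (fun t => (inner ℂ (N t) (x t) : ℂ)) unitMeasure := by
  obtain ⟨K, hK⟩ := isCompact_Icc.exists_bound_of_continuousOn hx
  refine (hN.norm.mul_const K).mono' (hN.1.inner (integrable_of_continuousOn hx).1) ?_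
  filter_upwards [ae_restrict_mem measurableSet_Ioo] with t ht
  refine (norm_inner_le_norm _ _).trans ?_
  have := hK t ⟨ht.1.le, ht.2.le⟩
  gcongr

/-- The image of `φ f` under `l` (for `σ = 1`) or `l⁺` (for `σ = -1`), multiplied by `√α`. -/
noncomputable def scaledImage (α : ℝ → ℝ) (σ : ℝ) (φ : ℝ → ℂ) (f c : H) (a : ℝ → H) (t : ℝ) : H :=
  (σ * weightedDeriv α φ (deriv φ) t) • f +
    ((√(α t) : ℝ) * φ t) • (c + (σ * Complex.I) • a t)

/-- Near zeros of `α` the term is not estimated directly. The full image is integrable because the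
generator lies in the Hilbert space; pairing with `f ≠ 0` and subtracting the continuous terms
isolates it. -/
theorem integrable_weight_term (hα : ContDiffOn ℝ 2 α (Icc 0 1)) {φ : ℝ → ℂ} (hφ : IsTest φ)
    {f c : H} (hf : f ≠ 0) {a : ℝ → H} (ha : ContinuousOn a (Icc 0 1)) {σ : ℝ} (hσ : σ ≠ 0)
    (hN : Integrable (scaledImage α σ φ f c a) unitMeasure) :
    Integrable (fun t => ((deriv α t / (2 * √(α t)) : ℝ) : ℂ) * φ t) unitMeasure := by
  have hs : ContinuousOn (fun t => ((√(α t) : ℝ) : ℂ)) (Icc 0 1) :=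
    Complex.continuous_ofReal.comp_continuousOn hα.continuousOn.sqrt
  have h1 : Integrable (fun t => ((√(α t) : ℝ) * φ t) • (c + (σ * Complex.I) • a t))
      unitMeasure := by
    refine integrable_of_continuousOn ?_
    exact (hs.mul hφ.1.continuous.continuousOn).smul
      (continuousOn_const.add (ha.const_smul (σ * Complex.I)))
  have h2 : Integrable (fun t => ((√(α t) : ℝ) : ℂ) * deriv φ t) unitMeasure :=
    integrable_of_continuousOn (hs.mul hφ.continuous_deriv.continuousOn)
  have h3 := (((innerSL ℂ f).integrable_comp (hN.sub h1)).const_mul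
    ((σ : ℂ) * inner ℂ f f)⁻¹).sub h2
  refine h3.congr (Eventually.of_forall fun t => ?_)
  have hff : (inner ℂ f f : ℂ) ≠ 0 := inner_self_ne_zero.2 hf
  have hσ' : (σ : ℂ) ≠ 0 := by exact_mod_cast hσ
  simp only [Pi.sub_apply, scaledImage, add_sub_cancel_right, innerSL_apply_apply, inner_smul_right,
    weightedDeriv]
  field_simp
  ring

variable {J : L2w H α ≃ₗᵢ[ℂ] L2unit H}

theorem inner_weight_eq (u g : L2w H α) :
    inner ℂ u g = ∫ t, (inner ℂ (J u t) (J g t) : ℂ) ∂unitMeasure := by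
  rw [← J.inner_map_map, L2.inner_def]

/-- `√α p` for the second component `p` of a generator of the graph of `L₀⁺`. -/
theorem sqrt_smul_generator_plus (hα : ContDiffOn ℝ 2 α (Icc 0 1)) {φ : ℝ → ℂ} (hφ : IsTest φ)
    (f c a : H) {t : ℝ} (ht : t ∈ Ioo (0 : ℝ) 1) (hαt : 0 < α t) :
    √(α t) • (-((deriv (fun r => (α r : ℂ) * φ r) t / (α t : ℂ)) • f) +
        φ t • (((deriv α t / (2 * α t) : ℝ) : ℂ) • f + c - Complex.I • a)) =
      scaledImage α (-1) φ f c (fun _ => a) t := by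
  have hd : HasDerivAt α (deriv α t) t :=
    ((hα.differentiableOn (by norm_num)).differentiableAt (Icc_mem_nhds ht.1 ht.2)).hasDerivAt
  have h1 : deriv (fun r => (α r : ℂ) * φ r) t = deriv α t * φ t + α t * deriv φ t :=
    (hd.ofReal_comp.mul (hφ.hasDerivAt t)).deriv
  have hs0 : √(α t) ≠ 0 := (Real.sqrt_pos.2 hαt).ne'
  have hs : α t = √(α t) ^ 2 := (Real.sq_sqrt hαt.le).symm
  have hs0' : ((√(α t) : ℝ) : ℂ) ≠ 0 := by exact_mod_cast hs0
  have hs' : (α t : ℂ) = ((√(α t) : ℝ) : ℂ) ^ 2 := by exact_mod_cast hs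
  rw [h1, scaledImage, weightedDeriv, ← Complex.coe_smul]
  push_cast
  rw [hs']
  match_scalars <;> field_simp
  ring

theorem sqrt_smul_generator {φ : ℝ → ℂ} (f c a : H) {t : ℝ} (hαt : 0 < α t) :
    √(α t) • (deriv φ t • f +
        φ t • (((deriv α t / (2 * α t) : ℝ) : ℂ) • f + c + Complex.I • a)) =
      scaledImage α 1 φ f c (fun _ => a) t := by
  have hs0 : √(α t) ≠ 0 := (Real.sqrt_pos.2 hαt).ne'
  have hs : α t = √(α t) ^ 2 := (Real.sq_sqrt hαt.le).symm
  have hs0' : ((√(α t) : ℝ) : ℂ) ≠ 0 := by exact_mod_cast hs0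
  have hs' : (α t : ℂ) = ((√(α t) : ℝ) : ℂ) ^ 2 := by exact_mod_cast hs
  rw [scaledImage, weightedDeriv, ← Complex.coe_smul]
  push_cast
  rw [hs']
  match_scalars <;> field_simp

variable [CompleteSpace H]

/-- Moving the derivative from `√α φ` to `x` produces `-i A_i x`, which cancels the `A_i` term of
the image after symmetry is used; `λ` and `θ` remain. The sign `σ` treats `l` and `l⁺` together. -/
theorem integral_inner_scaledImage (hα : ContDiffOn ℝ 2 α (Icc 0 1))
    (hα_nonneg : ∀ t ∈ Icc (0 : ℝ) 1, 0 ≤ α t) (hpos : ∀ᵐ t ∂unitMeasure, 0 < α t)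
    (hC : IsSelfAdjoint C) (hAi : ∀ t ∈ Icc (0 : ℝ) 1, IsSelfAdjoint (Ai t))
    {φ : ℝ → ℂ} (hφ : IsTest φ) {f c : H} (hc : (f, c) ∈ C.graph) {a : ℝ → H}
    (ha : ContinuousOn a (Icc 0 1)) (hag : ∀ t ∈ Icc (0 : ℝ) 1, (f, a t) ∈ (Ai t).graph)
    {σ : ℝ} (hσ : σ ≠ 0) (hN : Integrable (scaledImage α σ φ f c a) unitMeasure)
    {x z : ℝ → H} {lam θ : ℝ} (hx : ∀ t ∈ Icc (0 : ℝ) 1, x t ∈ eigenspace C lam)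
    (hz : ∀ t ∈ Icc (0 : ℝ) 1, (x t, z t) ∈ (Ai t).graph) (hzc : ContinuousOn z (Icc 0 1))
    (hx' : ∀ t ∈ Icc (0 : ℝ) 1,
      HasDerivWithinAt x ((θ * Complex.I) • x t - Complex.I • z t) (Icc 0 1) t) :
    ∫ t, (inner ℂ (scaledImage α σ φ f c a t) (x t) : ℂ) ∂unitMeasure =
      (lam - σ * (θ * Complex.I)) *
        ∫ t, (inner ℂ (((√(α t) : ℝ) * φ t) • f) (x t) : ℂ) ∂unitMeasure := by
  have hxc : ContinuousOn x (Icc 0 1) := fun t ht => (hx' t ht).continuousWithinAt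
  have hs : ContinuousOn (fun t => ((√(α t) : ℝ) : ℂ)) (Icc 0 1) :=
    Complex.continuous_ofReal.comp_continuousOn hα.continuousOn.sqrt
  have hmem : ∀ᵐ t ∂unitMeasure, t ∈ Ioo (0 : ℝ) 1 := ae_restrict_mem measurableSet_Ioo
  -- The integrability of the weight term is extracted by dividing by `⟨f, f⟩`, so `f = 0` is
  -- separate; then the image vanishes.
  by_cases hf : f = 0
  · subst hf
    have hc0 : c = 0 := LinearPMap.graph_fst_eq_zero_snd _ hc rfl
    have h1 : ∀ᵐ t ∂unitMeasure, (inner ℂ (scaledImage α σ φ 0 c a t) (x t) : ℂ) = 0 := by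
      filter_upwards [hmem] with t ht
      have ha0 : a t = 0 := LinearPMap.graph_fst_eq_zero_snd _ (hag t ⟨ht.1.le, ht.2.le⟩) rfl
      simp [scaledImage, hc0, ha0]
    rw [integral_eq_zero_of_ae h1]
    simp
  have hint := integrable_weight_term hα hφ hf ha hσ hN
  have hconj : ∀ t, HasDerivAt (fun t => starRingEnd ℂ (φ t)) (starRingEnd ℂ (deriv φ t)) t :=
    fun t => Complex.conjCLE.hasFDerivAt.comp_hasDerivAt t (hφ.hasDerivAt t)
  have hint' : Integrable (fun t => ((deriv α t / (2 * √(α t)) : ℝ) : ℂ) * starRingEnd ℂ (φ t))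
      unitMeasure := by
    refine (Complex.conjCLE.toContinuousLinearMap.integrable_comp hint).congr
      (Eventually.of_forall fun t => ?_)
    change starRingEnd ℂ _ = _
    rw [map_mul, Complex.conj_ofReal]
  -- The inner product is conjugate-linear in its first slot, so `φ` enters through its conjugate.
  have hparts := integral_weightedDeriv_mul_add hα hα_nonneg hpos hconj
    (Complex.continuous_conj.comp hφ.continuous_deriv)
    (by rw [hφ.eq_zero (by simp), map_zero]) (by rw [hφ.eq_zero (by simp), map_zero]) hint'
    (y := fun t => inner ℂ f (x t))
    (y' := fun t => inner ℂ f ((θ * Complex.I) • x t - Complex.I • z t))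
    (fun t ht => by
      have h := (hasDerivWithinAt_const t (Icc 0 1) f).inner ℂ (hx' t ht)
      rwa [inner_zero_left, add_zero] at h)
    (continuousOn_const.inner ((hxc.const_smul (θ * Complex.I)).sub (hzc.const_smul Complex.I)))
  have hi1 := integrable_inner_of_continuousOn hN hxc
  have hi2 : Integrable (fun t => (inner ℂ (((√(α t) : ℝ) * φ t) • f) (x t) : ℂ)) unitMeasure :=
    integrable_inner_of_continuousOn (integrable_of_continuousOn
      ((hs.mul hφ.1.continuous.continuousOn).smul continuousOn_const)) hxc
  rw [← sub_eq_zero, ← integral_const_mul, ← integral_sub hi1 (hi2.const_mul _),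
    ← mul_zero (σ : ℂ), ← hparts, ← integral_const_mul]
  refine integral_congr_ae ?_
  filter_upwards [hmem] with t ht
  have ht' : t ∈ Icc (0 : ℝ) 1 := ⟨ht.1.le, ht.2.le⟩
  have h1 := inner_graph_symm hC hc (show (x t, (lam : ℂ) • x t) ∈ C.graph from hx t ht')
  have h2 := inner_graph_symm (hAi t ht') (hag t ht') (hz t ht')
  rw [inner_smul_right] at h1
  simp only [scaledImage, weightedDeriv, inner_add_left, inner_smul_left, inner_sub_right,
    inner_smul_right, h1, h2, map_mul, map_add, Complex.conj_ofReal, Complex.conj_I]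
  ring

/-- A solution of `x' = iθ x - i A_i(t) x` in an eigenspace of `C` gives an eigenfunction of both
maximal operators. -/
theorem eigenfunction_mem (hα : ContDiffOn ℝ 2 α (Icc 0 1))
    (hα_nonneg : ∀ t ∈ Icc (0 : ℝ) 1, 0 ≤ α t) (hpos : ∀ᵐ t ∂unitMeasure, 0 < α t)
    (hC : IsSelfAdjoint C) (hAi : ∀ t ∈ Icc (0 : ℝ) 1, IsSelfAdjoint (Ai t))
    (hAi_C1 : ∀ f ∈ C.domain, ∃ a : ℝ → H, ContDiffOn ℝ 1 a (Icc 0 1) ∧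
      ∀ t ∈ Icc (0 : ℝ) 1, (f, a t) ∈ (Ai t).graph)
    (hae : ae (weight α) = ae unitMeasure)
    (hJ : ∀ u, J u =ᵐ[unitMeasure] fun t => √(α t) • u t)
    {x z : ℝ → H} {lam θ : ℝ} (hx : ∀ t ∈ Icc (0 : ℝ) 1, x t ∈ eigenspace C lam)
    (hz : ∀ t ∈ Icc (0 : ℝ) 1, (x t, z t) ∈ (Ai t).graph) (hzc : ContinuousOn z (Icc 0 1))
    (hx' : ∀ t ∈ Icc (0 : ℝ) 1,
      HasDerivWithinAt x ((θ * Complex.I) • x t - Complex.I • z t) (Icc 0 1) t)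
    {u : L2w H α} (hu : J u =ᵐ[unitMeasure] x) :
    (u, (lam + θ * Complex.I) • u) ∈ Lmax α C Ai ∧
      (u, (lam - θ * Complex.I) • u) ∈ LmaxPlus α C Ai := by
  have hmem : ∀ᵐ t ∂unitMeasure, t ∈ Ioo (0 : ℝ) 1 := ae_restrict_mem measurableSet_Ioo
  -- The adjoint relation on one generator. `L` is the adjoint of `L₀⁺`, so it corresponds to `σ =
  -- -1`, and `L⁺` to `σ = 1`.
  have key : ∀ (σ : ℝ), σ ≠ 0 → ∀ (p : L2w H α × L2w H α) (φ : ℝ → ℂ) (f c : H) (a : ℝ → H),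
      IsTest φ → (f, c) ∈ C.graph → ContinuousOn a (Icc 0 1) →
      (∀ t ∈ Icc (0 : ℝ) 1, (f, a t) ∈ (Ai t).graph) →
      p.1 =ᵐ[weight α] (fun t => φ t • f) →
      J p.2 =ᵐ[unitMeasure] scaledImage α σ φ f c a →
      inner ℂ p.2 u = inner ℂ p.1 ((lam - σ * (θ * Complex.I)) • u) := by
    intro σ hσ p φ f c a hφ hc ha hag hp1 hp2
    have hN : Integrable (scaledImage α σ φ f c a) unitMeasure :=
      ((Lp.memLp (J p.2)).integrable (by norm_num)).congr hp2
    have h1 := integral_inner_scaledImage hα hα_nonneg hpos hC hAi hφ hc ha hag hσ hN hx hz hzc hx'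
    rw [inner_smul_right, inner_weight_eq (J := J), inner_weight_eq (J := J)]
    have h2 : J p.1 =ᵐ[unitMeasure] fun t => ((√(α t) : ℝ) * φ t) • f := by
      rw [EventuallyEq, hae] at hp1
      filter_upwards [hJ p.1, hp1] with t h3 h4
      rw [h3, h4, ← Complex.coe_smul, smul_smul]
    rw [integral_congr_ae (g := fun t => inner ℂ (scaledImage α σ φ f c a t) (x t))
      (by filter_upwards [hp2, hu] with t h3 h4; rw [h3, h4]), h1]
    congr 1
    exact integral_congr_ae (by filter_upwards [h2, hu] with t h3 h4; rw [h3, h4])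
  constructor
  · refine mem_adjoint_closure_span ?_
    rintro p ⟨φ, f, a, hφ, hf, hg, hp1, hp2⟩
    obtain ⟨c, hc⟩ := LinearPMap.mem_domain_iff.1 hf
    obtain ⟨ai, hai, hag⟩ := hAi_C1 f hf
    have h1 := key (-1) (by norm_num) p φ f c ai hφ hc hai.continuousOn hag hp1 (by
      rw [EventuallyEq, hae] at hp2
      filter_upwards [hJ p.2, hp2, hmem, hpos] with t h3 h4 ht hαt
      have ht' : t ∈ Icc (0 : ℝ) 1 := ⟨ht.1.le, ht.2.le⟩
      have hdom : C.domain ≤ (Ai t).domain := fun f hf => by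
        obtain ⟨a, -, ha⟩ := hAi_C1 f hf
        exact LinearPMap.mem_domain_of_mem_graph (ha t ht')
      have h5 : a t = _ := LinearPMap.mem_graph_snd_inj _ (hg t ht)
        (mem_graph_A_adjoint hC (hAi t ht') hdom hc (hag t ht')) rfl
      rw [h3, h4, h5, sqrt_smul_generator_plus hα hφ f c (ai t) ht hαt]
      rfl)
    rw [h1]
    push_cast
    ring_nf
  · refine mem_adjoint_closure_span ?_
    rintro p ⟨φ, f, a, hφ, hf, hg, hp1, hp2⟩
    obtain ⟨c, hc⟩ := LinearPMap.mem_domain_iff.1 hf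
    obtain ⟨ai, hai, hag⟩ := hAi_C1 f hf
    have h1 := key 1 (by norm_num) p φ f c ai hφ hc hai.continuousOn hag hp1 (by
      rw [EventuallyEq, hae] at hp2
      filter_upwards [hJ p.2, hp2, hmem, hpos] with t h3 h4 ht hαt
      have ht' : t ∈ Icc (0 : ℝ) 1 := ⟨ht.1.le, ht.2.le⟩
      have h5 : a t = _ := LinearPMap.mem_graph_snd_inj _ (hg t ht)
        (mem_graph_A (α := α) hc (hag t ht')) rfl
      rw [h3, h4, h5, sqrt_smul_generator f c (ai t) hαt]
      rfl)
    rw [h1]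
    push_cast
    ring_nf

end Eigenfunctions

/-! ### Fourier coefficients of functions in the domain -/

section Coefficients

variable {H : Type*} [NormedAddCommGroup H] [InnerProductSpace ℂ H]
  {α : ℝ → ℝ} {C : H →ₗ.[ℂ] H} {Ai : ℝ → H →ₗ.[ℂ] H} {J : L2w H α ≃ₗᵢ[ℂ] L2unit H}

theorem integrable_inner_of_continuousOn_left {N x : ℝ → H} (hx : ContinuousOn x (Icc 0 1))
    (hN : Integrable N unitMeasure) :
    Integrable (fun t => (inner ℂ (x t) (N t) : ℂ)) unitMeasure := by
  refine (Complex.conjCLE.toContinuousLinearMap.integrable_comp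
    (integrable_inner_of_continuousOn hN hx)).congr (Eventually.of_forall fun t => ?_)
  exact inner_conj_symm _ _

/-- Test functions supported away from the zeros of `α` stay differentiable after multiplication
by `√α`. -/
theorem hasDerivAt_sqrt_mul (hα : ContDiffOn ℝ 2 α (Icc 0 1)) {φ : ℝ → ℂ} (hφ : IsTest φ)
    (hsupp : tsupport φ ⊆ Ioo 0 1 ∩ α ⁻¹' Ioi 0) :
    (∀ t, HasDerivAt (fun t => ((√(α t) : ℝ) : ℂ) * φ t) (weightedDeriv α φ (deriv φ) t) t) ∧
      Continuous (weightedDeriv α φ (deriv φ)) := by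
  have hzero : ∀ t, t ∉ tsupport φ → φ =ᶠ[𝓝 t] 0 := fun t ht =>
    notMem_tsupport_iff_eventuallyEq.1 ht
  have hd : ∀ t ∈ Ioo (0 : ℝ) 1, HasDerivAt α (deriv α t) t := fun t ht =>
    ((hα.differentiableOn (by norm_num)).differentiableAt (Icc_mem_nhds ht.1 ht.2)).hasDerivAt
  refine ⟨fun t => ?_, continuous_iff_continuousAt.2 fun t => ?_⟩
  · by_cases ht : t ∈ tsupport φ
    · have h1 := ((hd t (hsupp ht).1).sqrt (ne_of_gt (hsupp ht).2)).ofReal_comp.mul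
        (hφ.hasDerivAt t)
      refine h1.congr_deriv ?_
      rw [weightedDeriv]
      ring
    · have h1 : (fun t => ((√(α t) : ℝ) : ℂ) * φ t) =ᶠ[𝓝 t] fun _ => 0 := by
        filter_upwards [hzero t ht] with s hs
        rw [hs, Pi.zero_apply, mul_zero]
      have h2 : weightedDeriv α φ (deriv φ) t = 0 := by
        rw [weightedDeriv, (hzero t ht).deriv_eq, (hzero t ht).eq_of_nhds]
        simp
      rw [h2]
      exact (hasDerivAt_const t (0 : ℂ)).congr_of_eventuallyEq h1
  · by_cases ht : t ∈ tsupport φ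
    · have h1 : ContinuousAt (deriv α) t := by
        have h2 : ContDiffOn ℝ 2 α (Ioo 0 1) := hα.mono Ioo_subset_Icc_self
        exact (h2.continuousOn_deriv_of_isOpen isOpen_Ioo (by norm_num)).continuousAt
          (isOpen_Ioo.mem_nhds (hsupp ht).1)
      have h2 : ContinuousAt (fun t => √(α t)) t := (hd t (hsupp ht).1).continuousAt.sqrt
      have h3 : √(α t) ≠ 0 := (Real.sqrt_pos.2 (hsupp ht).2).ne'
      have h4 := Complex.continuous_ofReal.continuousAt.comp h2
      have h5 := Complex.continuous_ofReal.continuousAt.comp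
        (h1.div (continuousAt_const.mul h2) (mul_ne_zero two_ne_zero h3))
      exact (h4.mul hφ.continuous_deriv.continuousAt).add
        (h5.mul hφ.1.continuous.continuousAt)
    · have h1 : weightedDeriv α φ (deriv φ) =ᶠ[𝓝 t] fun _ => 0 := by
        filter_upwards [(hzero t ht).deriv, hzero t ht] with s hs hs'
        rw [weightedDeriv, hs, hs']
        simp
      exact continuousAt_const.congr h1.symm

variable [CompleteSpace H]

/-- The weak form of `w + C v + i A_i v = √α g` for `(u, g) ∈ L` and `v = √α u`. -/
theorem ae_inner_eq_of_mem_Lmax (hα : ContDiffOn ℝ 2 α (Icc 0 1))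
    (hpos : ∀ᵐ t ∂unitMeasure, 0 < α t)
    (hC : IsSelfAdjoint C) (hAi : ∀ t ∈ Icc (0 : ℝ) 1, IsSelfAdjoint (Ai t))
    (hdom : ∀ t ∈ Icc (0 : ℝ) 1, C.domain ≤ (Ai t).domain)
    (hae : ae (weight α) = ae unitMeasure)
    (hJ : ∀ u, J u =ᵐ[unitMeasure] fun t => √(α t) • u t)
    {u g : L2w H α} (hug : (u, g) ∈ Lmax α C Ai) {v w : ℝ → H} (hw : MemLp w 2 unitMeasure)
    (hv : ∀ t ∈ Icc (0 : ℝ) 1, v t = v 0 + ∫ r in (0 : ℝ)..t, w r) (huv : J u =ᵐ[unitMeasure] v)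
    {f c : H} (hc : (f, c) ∈ C.graph) {a : ℝ → H}
    (ha : ContinuousOn a (Icc 0 1)) (hag : ∀ t ∈ Icc (0 : ℝ) 1, (f, a t) ∈ (Ai t).graph) :
    ∀ᵐ t ∂unitMeasure, (inner ℂ f (J g t) : ℂ) =
      inner ℂ f (w t) + inner ℂ (c - Complex.I • a t) (v t) := by
  have hmem : ∀ᵐ t ∂unitMeasure, t ∈ Ioo (0 : ℝ) 1 := ae_restrict_mem measurableSet_Ioo
  have hαc : ContinuousOn α (Icc 0 1) := hα.continuousOn
  have hwi : Integrable w unitMeasure := hw.integrable (by norm_num)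
  have hvi : Integrable v unitMeasure := ((Lp.memLp (J u)).integrable (by norm_num)).congr huv
  have hgi : Integrable (J g) unitMeasure := (Lp.memLp (J g)).integrable (by norm_num)
  have hca : ContinuousOn (fun t => c - Complex.I • a t) (Icc 0 1) :=
    continuousOn_const.sub (ha.const_smul Complex.I)
  -- `k` is the residual of the weak equation; the goal is that it vanishes almost everywhere.
  set k : ℝ → ℂ := fun t =>
    inner ℂ f (w t) + inner ℂ (c - Complex.I • a t) (v t) - inner ℂ f (J g t) with hk
  have hki : Integrable k unitMeasure :=
    ((integrable_inner_of_continuousOn_left continuousOn_const hwi).add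
      (integrable_inner_of_continuousOn_left hca hvi)).sub
      (integrable_inner_of_continuousOn_left continuousOn_const hgi)
  -- On the open set `O` the function `√α φ` is continuously differentiable and the image of `φ f`
  -- is automatically square integrable. Testing there suffices, as `O` has full measure in `(0,1)`.
  set O : Set ℝ := Ioo 0 1 ∩ α ⁻¹' Ioi 0 with hO
  have hOo : IsOpen O := (hαc.mono Ioo_subset_Icc_self).isOpen_inter_preimage isOpen_Ioo isOpen_Ioi
  have hQ : Integrable (fun t => ((√(α t) : ℝ) : ℂ) * k t) unitMeasure := by
    obtain ⟨K, hK⟩ := isCompact_Icc.exists_bound_of_continuousOn hαc.sqrt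
    refine hki.bdd_mul (c := K) ?_ ?_
    · exact (integrable_of_continuousOn (Complex.continuous_ofReal.comp_continuousOn hαc.sqrt)).1
    · filter_upwards [hmem] with t ht
      rw [Complex.norm_real]
      exact hK t ⟨ht.1.le, ht.2.le⟩
  have hmain := hOo.ae_eq_zero_of_integral_contDiff_smul_eq_zero (μ := volume)
    (f := fun t => ((√(α t) : ℝ) : ℂ) * k t)
    (IntegrableOn.locallyIntegrableOn (IntegrableOn.mono_set hQ inter_subset_left)) (by
      intro η hη hηc hηO
      set φ : ℝ → ℂ := fun t => (η t : ℂ) with hφ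
      have hφsupp : tsupport φ ⊆ O := (closure_mono
        (fun t (ht : φ t ≠ 0) => show η t ≠ 0 from fun h => ht (by simp [hφ, h]))).trans hηO
      have hφt : IsTest φ := ⟨Complex.ofRealCLM.contDiff.comp hη,
        hηc.comp_left (g := fun x : ℝ => (x : ℂ)) Complex.ofReal_zero,
        hφsupp.trans inter_subset_left⟩
      obtain ⟨hψ, hψc⟩ := hasDerivAt_sqrt_mul hα hφt hφsupp
      set ψ : ℝ → ℂ := fun t => ((√(α t) : ℝ) : ℂ) * φ t with hψdef
      have hψcont : Continuous ψ := continuous_iff_continuousAt.2 fun t => (hψ t).continuousAt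
      have hψ0 : ∀ t ∉ Ioo (0 : ℝ) 1, ψ t = 0 := fun t ht => by
        simp only [hψdef, hφt.eq_zero ht, mul_zero]
      -- the generator with `φ f` as first component
      have hc1 : ContinuousOn (fun t => ψ t • f) (Icc 0 1) :=
        (hψcont.smul continuous_const).continuousOn
      have hc2 : ContinuousOn (scaledImage α (-1) φ f c a) (Icc 0 1) :=
        ((continuous_const.mul hψc).smul continuous_const).continuousOn.add
          (hψcont.continuousOn.smul (continuousOn_const.add (ha.const_smul _)))
      have hm1 := memLp_of_continuousOn hc1 2
      have hm2 := memLp_of_continuousOn hc2 2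
      set p₁ : L2w H α := J.symm (hm1.toLp _) with hp₁
      set p₂ : L2w H α := J.symm (hm2.toLp _) with hp₂
      have hJ1 : J p₁ =ᵐ[unitMeasure] fun t => ψ t • f := by
        rw [hp₁, J.apply_symm_apply]; exact hm1.coeFn_toLp
      have hJ2 : J p₂ =ᵐ[unitMeasure] scaledImage α (-1) φ f c a := by
        rw [hp₂, J.apply_symm_apply]; exact hm2.coeFn_toLp
      have hgen : (p₁, p₂) ∈ L0plus α C Ai := by
        refine Submodule.le_topologicalClosure _ (Submodule.subset_span ?_)
        refine ⟨φ, f, fun t => ((deriv α t / (2 * α t) : ℝ) : ℂ) • f + c - Complex.I • a t, hφt,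
          LinearPMap.mem_domain_of_mem_graph hc, fun t ht => ?_, ?_, ?_⟩
        · have ht' : t ∈ Icc (0 : ℝ) 1 := ⟨ht.1.le, ht.2.le⟩
          exact mem_graph_A_adjoint hC (hAi t ht') (hdom t ht') hc (hag t ht')
        · rw [EventuallyEq, hae]
          filter_upwards [hJ p₁, hJ1, hpos] with t h1 h2 hαt
          have hs0 : √(α t) ≠ 0 := (Real.sqrt_pos.2 hαt).ne'
          rw [h1, hψdef, ← smul_smul, Complex.coe_smul] at h2
          exact smul_right_injective H hs0 h2
        · rw [EventuallyEq, hae]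
          filter_upwards [hJ p₂, hJ2, hpos, hmem] with t h1 h2 hαt ht
          have hs0 : √(α t) ≠ 0 := (Real.sqrt_pos.2 hαt).ne'
          refine smul_right_injective H hs0 ?_
          have h3 := sqrt_smul_generator_plus hα hφt f c (a t) ht hαt
          simp only
          rw [h3, ← h1, h2]
          rfl
      have hpair := (Submodule.mem_adjoint_iff _ _).1 hug p₁ p₂ hgen
      simp only at hpair
      rw [inner_weight_eq (J := J), inner_weight_eq (J := J)] at hpair
      have hleft : ∫ t, (inner ℂ (J p₂ t) (J u t) : ℂ) ∂unitMeasure =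
          ∫ t, inner ℂ (scaledImage α (-1) φ f c a t) (v t) ∂unitMeasure :=
        integral_congr_ae (by filter_upwards [hJ2, huv] with t h3 h4; rw [h3, h4])
      have hright : ∫ t, (inner ℂ (J p₁ t) (J g t) : ℂ) ∂unitMeasure =
          ∫ t, inner ℂ (ψ t • f) (J g t) ∂unitMeasure :=
        integral_congr_ae (by filter_upwards [hJ1] with t h3; rw [h3])
      rw [hleft, hright] at hpair
      have hparts := integral_inner_deriv_add (x := fun t => ψ t • f)
        (x' := fun t => weightedDeriv α φ (deriv φ) t • f)
        (fun t _ => ((hψ t).smul_const f).hasDerivWithinAt)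
        (hψc.smul continuous_const).continuousOn hw hv
      rw [hψ0 0 (by simp), hψ0 1 (by simp), zero_smul, inner_zero_left, inner_zero_left,
        sub_zero] at hparts
      have hi1 := integrable_inner_of_continuousOn_left hc2 hvi
      have hi2 := integrable_inner_of_continuousOn_left hc1 hgi
      have hi3 : Integrable (fun t => (inner ℂ (weightedDeriv α φ (deriv φ) t • f) (v t) +
          inner ℂ (ψ t • f) (w t) : ℂ)) unitMeasure :=
        (integrable_inner_of_continuousOn_left
          (hψc.smul continuous_const).continuousOn hvi).add
          (integrable_inner_of_continuousOn_left hc1 hwi)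
      rw [← integral_sub hi1 hi2] at hpair
      have hsum := integral_add hi3 (hi1.sub hi2)
      simp only [Pi.sub_apply] at hsum
      rw [hparts, hpair, add_zero] at hsum
      have hsupp : ∫ t, η t • (((√(α t) : ℝ) : ℂ) * k t) =
          ∫ t, η t • (((√(α t) : ℝ) : ℂ) * k t) ∂unitMeasure := by
        refine (setIntegral_eq_integral_of_forall_compl_eq_zero fun t ht => ?_).symm
        have : η t = 0 := by
          have h0 : (η t : ℂ) = 0 := hφt.eq_zero ht
          exact_mod_cast h0
        rw [this, zero_smul]
      rw [hsupp, ← hsum]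
      refine integral_congr_ae (Eventually.of_forall fun t => ?_)
      simp only [hk, hψdef, scaledImage, inner_add_left, inner_sub_left, inner_smul_left, map_mul,
        Complex.conj_ofReal, Complex.conj_I, Complex.real_smul, map_neg, map_one, hφ,
        Complex.ofReal_neg, Complex.ofReal_one]
      ring)
  have hmain' : ∀ᵐ t ∂unitMeasure, t ∈ O → ((√(α t) : ℝ) : ℂ) * k t = 0 := ae_restrict_of_ae hmain
  filter_upwards [hmain', hmem, hpos] with t h1 ht hαt
  have hs0 : ((√(α t) : ℝ) : ℂ) ≠ 0 := by exact_mod_cast (Real.sqrt_pos.2 hαt).ne'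
  have h2 := (mul_eq_zero.1 (h1 ⟨ht, hαt⟩)).resolve_left hs0
  exact (sub_eq_zero.1 h2).symm

/-- The weak equation has a null set for each `f`. A finite basis of the eigenspace makes it
independent of `f`, which allows `f` to be replaced by a moving vector `x t`. -/
theorem ae_forall_eigenspace_inner_eq (hα : ContDiffOn ℝ 2 α (Icc 0 1))
    (hpos : ∀ᵐ t ∂unitMeasure, 0 < α t)
    (hC : IsSelfAdjoint C) (hAi : ∀ t ∈ Icc (0 : ℝ) 1, IsSelfAdjoint (Ai t))
    (hdom : ∀ t ∈ Icc (0 : ℝ) 1, C.domain ≤ (Ai t).domain)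
    (hae : ae (weight α) = ae unitMeasure)
    (hJ : ∀ u, J u =ᵐ[unitMeasure] fun t => √(α t) • u t)
    {S : H →L[ℂ] H} (hS : IsInverse C.graph S) {M : ℝ → H →L[ℂ] H}
    (hM : ∀ t ∈ Icc (0 : ℝ) 1, ∀ x, (S x, M t x) ∈ (Ai t).graph)
    (hMc : ∀ x, Continuous fun t => M t x)
    {u g : L2w H α} (hug : (u, g) ∈ Lmax α C Ai) {v w : ℝ → H} (hw : MemLp w 2 unitMeasure)
    (hv : ∀ t ∈ Icc (0 : ℝ) 1, v t = v 0 + ∫ r in (0 : ℝ)..t, w r) (huv : J u =ᵐ[unitMeasure] v)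
    {μ : ℝ} (hμ : μ ≠ 0) (hfd : FiniteDimensional ℂ (eigenspace C μ)) :
    ∀ᵐ t ∂unitMeasure, ∀ f ∈ eigenspace C μ, (inner ℂ f (J g t) : ℂ) =
      inner ℂ f (w t) + inner ℂ ((μ : ℂ) • f - Complex.I • (μ : ℂ) • M t f) (v t) := by
  have hμ' : (μ : ℂ) ≠ 0 := by exact_mod_cast hμ
  have hbasis : ∀ᵐ t ∂unitMeasure, ∀ i, (inner ℂ (Module.finBasis ℂ (eigenspace C μ) i : H)
      (J g t) : ℂ) = inner ℂ (Module.finBasis ℂ (eigenspace C μ) i : H) (w t) +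
        inner ℂ ((μ : ℂ) • (Module.finBasis ℂ (eigenspace C μ) i : H) -
          Complex.I • (μ : ℂ) • M t (Module.finBasis ℂ (eigenspace C μ) i : H)) (v t) := by
    refine ae_all_iff.2 fun i => ?_
    have hi := (Module.finBasis ℂ (eigenspace C μ) i).2
    refine ae_inner_eq_of_mem_Lmax hα hpos hC hAi hdom hae hJ hug hw hv huv hi
      (a := fun t => (μ : ℂ) • M t (Module.finBasis ℂ (eigenspace C μ) i : H))
      ((hMc _).const_smul _).continuousOn fun t ht => ?_
    have h := (Ai t).graph.smul_mem (μ : ℂ) (hM t ht (Module.finBasis ℂ (eigenspace C μ) i : H))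
    rwa [(mem_eigenspace_iff_resolvent hS hμ).1 hi, Prod.smul_mk, smul_smul, mul_inv_cancel₀ hμ',
      one_smul] at h
  filter_upwards [hbasis] with t ht f hf
  have hsum := congrArg Subtype.val ((Module.finBasis ℂ (eigenspace C μ)).sum_repr ⟨f, hf⟩)
  simp only [Submodule.coe_sum, Submodule.coe_smul] at hsum
  rw [← hsum]
  simp only [map_sum, map_smul, Finset.smul_sum, ← Finset.sum_sub_distrib, sum_inner,
    inner_smul_left, ht, ← Finset.sum_add_distrib, inner_sub_left]
  refine Finset.sum_congr rfl fun i _ => ?_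
  ring

/-- The Fourier coefficients of `u` and `g` for `(u, g) ∈ L` with respect to an eigenfunction
satisfying the same boundary condition. -/
theorem integral_inner_eq_of_mem_Lmax (hα : ContDiffOn ℝ 2 α (Icc 0 1))
    (hpos : ∀ᵐ t ∂unitMeasure, 0 < α t)
    (hC : IsSelfAdjoint C) (hAi : ∀ t ∈ Icc (0 : ℝ) 1, IsSelfAdjoint (Ai t))
    (hdom : ∀ t ∈ Icc (0 : ℝ) 1, C.domain ≤ (Ai t).domain)
    (hae : ae (weight α) = ae unitMeasure)
    (hJ : ∀ u, J u =ᵐ[unitMeasure] fun t => √(α t) • u t)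
    {S : H →L[ℂ] H} (hS : IsInverse C.graph S) {M : ℝ → H →L[ℂ] H}
    (hM : ∀ t ∈ Icc (0 : ℝ) 1, ∀ x, (S x, M t x) ∈ (Ai t).graph)
    (hMc : ∀ x, Continuous fun t => M t x)
    {u g : L2w H α} (hug : (u, g) ∈ Lmax α C Ai) {v w : ℝ → H} (hw : MemLp w 2 unitMeasure)
    (hv : ∀ t ∈ Icc (0 : ℝ) 1, v t = v 0 + ∫ r in (0 : ℝ)..t, w r) (huv : J u =ᵐ[unitMeasure] v)
    {μ : ℝ} (hμ : μ ≠ 0) (hfd : FiniteDimensional ℂ (eigenspace C μ))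
    {x : ℝ → H} {θ : ℝ} (hx : ∀ t ∈ Icc (0 : ℝ) 1, x t ∈ eigenspace C μ)
    (hz : ContinuousOn (fun t => (μ : ℂ) • M t (x t)) (Icc 0 1))
    (hx' : ∀ t ∈ Icc (0 : ℝ) 1, HasDerivWithinAt x
      ((θ * Complex.I) • x t - Complex.I • (μ : ℂ) • M t (x t)) (Icc 0 1) t)
    (hbdry : (inner ℂ (x 1) (v 1) : ℂ) = inner ℂ (x 0) (v 0)) :
    ∫ t, (inner ℂ (x t) (J g t) : ℂ) ∂unitMeasure =
      (μ + θ * Complex.I) * ∫ t, (inner ℂ (x t) (J u t) : ℂ) ∂unitMeasure := by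
  have hxc : ContinuousOn x (Icc 0 1) := fun t ht => (hx' t ht).continuousWithinAt
  have hmem : ∀ᵐ t ∂unitMeasure, t ∈ Ioo (0 : ℝ) 1 := ae_restrict_mem measurableSet_Ioo
  have hgi : Integrable (J g) unitMeasure := (Lp.memLp (J g)).integrable (by norm_num)
  have hui : Integrable (J u) unitMeasure := (Lp.memLp (J u)).integrable (by norm_num)
  have hparts := integral_inner_deriv_add hx'
    ((hxc.const_smul (θ * Complex.I)).sub (hz.const_smul Complex.I)) hw hv
  rw [hbdry, sub_self] at hparts
  have hi1 := integrable_inner_of_continuousOn_left hxc hgi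
  have hi2 := integrable_inner_of_continuousOn_left hxc hui
  rw [← sub_eq_zero, ← integral_const_mul, ← integral_sub hi1 (hi2.const_mul _), ← hparts]
  refine integral_congr_ae ?_
  filter_upwards [hmem, huv, ae_forall_eigenspace_inner_eq hα hpos hC hAi hdom hae hJ hS hM hMc
    hug hw hv huv hμ hfd] with t ht h1 h2
  rw [h2 _ (hx t ⟨ht.1.le, ht.2.le⟩), h1]
  simp only [inner_sub_left, inner_smul_left, map_mul, Complex.conj_ofReal, Complex.conj_I]
  ring

end Coefficients

/-! ### The eigenvalues of the operator with boundary condition -/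

section Eigenvalues

/-- The eigenvalues `λ_k + i (τ_k + 2 π m)`. -/
noncomputable def eigenvalue (lam τ : ℕ → ℝ) (p : ℕ × ℤ) : ℂ :=
  lam p.1 + ((τ p.1 + 2 * Real.pi * p.2 : ℝ) : ℂ) * Complex.I

variable {lam τ : ℕ → ℝ}

theorem norm_eigenvalue (p : ℕ × ℤ) :
    ‖eigenvalue lam τ p‖ = √(lam p.1 ^ 2 + (τ p.1 + 2 * Real.pi * p.2) ^ 2) := by
  rw [eigenvalue, Complex.norm_add_mul_I]

theorem le_norm_eigenvalue (p : ℕ × ℤ) : lam p.1 ≤ ‖eigenvalue lam τ p‖ := by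
  rw [norm_eigenvalue]
  exact Real.le_sqrt_of_sq_le (by nlinarith [sq_nonneg (τ p.1 + 2 * Real.pi * p.2)])

theorem eigenvalue_ne_zero (hpos : ∀ k, 0 < lam k) (p : ℕ × ℤ) : eigenvalue lam τ p ≠ 0 :=
  norm_pos_iff.1 ((hpos p.1).trans_le (le_norm_eigenvalue p))

theorem norm_inv_eigenvalue_le (hpos : ∀ k, 0 < lam k) (hmono : Monotone lam) (p : ℕ × ℤ) :
    ‖(eigenvalue lam τ p)⁻¹‖ ≤ (lam 0)⁻¹ := by
  rw [norm_inv]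
  exact inv_anti₀ (hpos 0) ((hmono (Nat.zero_le _)).trans (le_norm_eigenvalue p))

theorem setOf_le_norm_inv_eigenvalue (hpos : ∀ k, 0 < lam k) {μ : ℝ} (hμ : 0 < μ) :
    {p | μ ≤ ‖(eigenvalue lam τ p)⁻¹‖} = latticeDisc lam τ μ⁻¹ := by
  ext p
  change μ ≤ _ ↔ √(lam p.1 ^ 2 + (τ p.1 + 2 * Real.pi * p.2) ^ 2) ≤ μ⁻¹
  rw [norm_inv, ← norm_eigenvalue,
    le_inv_comm₀ hμ (norm_pos_iff.2 (eigenvalue_ne_zero hpos p))]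

/-- The entries of modulus at least `μ` are the lattice points in the disc of radius `1/μ`, so the
lattice asymptotics give both compactness and the decay of the `s`-numbers. -/
theorem isCompactOperator_and_sNumbers_of_isDiag {E : Type*} [NormedAddCommGroup E]
    [InnerProductSpace ℂ E] [CompleteSpace E] {b : HilbertBasis (ℕ × ℤ) ℂ E} {T : E →L[ℂ] E}
    (hT : IsDiag b (fun p => (eigenvalue lam τ p)⁻¹) T) (hpos : ∀ k, 0 < lam k)
    (hmono : Monotone lam) {c β : ℝ} (hc : 0 < c) (hβ : 0 < β)
    (hasymp : lam ~[atTop] fun n => c * ((n : ℝ) + 1) ^ β) :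
    IsCompactOperator T ∧ ∃ s : ℕ → ℝ, IsSNumberSeq T s ∧
      ∃ d : ℝ, 0 < d ∧ s ~[atTop] fun n => d * ((n : ℝ) + 1) ^ (-(β / (1 + β))) := by
  obtain ⟨hfin, K, hK, hcount⟩ := exists_tendsto_ncard_latticeDisc (τ := τ) hpos hc hβ hasymp
  have hfin' : ∀ ε : ℝ, 0 < ε → {p | ε ≤ ‖(eigenvalue lam τ p)⁻¹‖}.Finite := fun ε hε => by
    rw [setOf_le_norm_inv_eigenvalue hpos hε]
    exact hfin _
  refine ⟨hT.isCompactOperator hfin', ?_⟩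
  obtain ⟨s, hanti, hs0, hs⟩ := exists_decreasing_rearrangement
    (fun p => norm_pos_iff.2 (inv_ne_zero (eigenvalue_ne_zero (τ := τ) hpos p))) hfin'
  refine ⟨s, hT.isSNumberSeq (norm_inv_eigenvalue_le hpos hmono) hfin' hanti hs0 hs,
    K ^ (1 / ((1 + β) / β)), Real.rpow_pos_of_pos hK _, ?_⟩
  have h := rearrangement_isEquivalent (N := fun r => (latticeDisc lam τ r).ncard) hK
    (div_pos (by linarith) hβ) hs0 (fun n r hr => by
      rw [hs n _ (inv_pos.2 hr), setOf_le_norm_inv_eigenvalue hpos (inv_pos.2 hr), inv_inv]) hcount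
  have hp : 1 / ((1 + β) / β) = β / (1 + β) := one_div_div _ _
  rw [hp] at h ⊢
  exact h

end Eigenvalues

/-! ### The basis of eigenfunctions -/

section Eigenbasis

variable {H : Type*} [NormedAddCommGroup H] [InnerProductSpace ℂ H]
  {α : ℝ → ℝ} {C : H →ₗ.[ℂ] H} {Ai : ℝ → H →ₗ.[ℂ] H} {S : H →L[ℂ] H} {M : ℝ → H →L[ℂ] H}
  {lam τ : ℕ → ℝ}

theorem finite_setOf_eq_of_isEquivalent {c β : ℝ} (hc : 0 < c) (hβ : 0 < β)
    (hasymp : lam ~[atTop] fun n => c * ((n : ℝ) + 1) ^ β) (μ : ℝ) :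
    {n : ℕ | lam n = μ}.Finite := by
  have h1 : Tendsto (fun n : ℕ => c * ((n : ℝ) + 1) ^ β) atTop atTop :=
    ((tendsto_rpow_atTop hβ).comp
      (tendsto_atTop_add_const_right _ 1 tendsto_natCast_atTop_atTop)).const_mul_atTop hc
  have h2 := (hasymp.symm.tendsto_atTop h1).eventually_gt_atTop μ
  rw [← Nat.cofinite_eq_atTop] at h2
  exact h2.subset fun n hn => by
    rw [mem_ofPred_eq] at hn
    simp [hn]

/-- The solutions `x` of `x' + i A_i x = iθ x` with values in an eigenspace of `C` and
`x(1) = B x(0)`; here `A_i C⁻¹` is given by `M`. -/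
structure IsPeriodicEigenpath (C : H →ₗ.[ℂ] H) (M : ℝ → H →L[ℂ] H) (B : H →L[ℂ] H) (μ θ : ℝ)
    (x : ℝ → H) : Prop where
  mem_eigenspace : ∀ t, x t ∈ eigenspace C μ
  continuousOn_generator : ContinuousOn (fun t => (μ : ℂ) • M t (x t)) (Icc 0 1)
  hasDerivWithinAt : ∀ t ∈ Icc (0 : ℝ) 1, HasDerivWithinAt x
    ((θ * Complex.I) • x t - Complex.I • (μ : ℂ) • M t (x t)) (Icc 0 1) t
  boundary : x 1 = B (x 0)

theorem IsPeriodicEigenpath.continuousOn {B : H →L[ℂ] H} {μ θ : ℝ} {x : ℝ → H}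
    (hx : IsPeriodicEigenpath C M B μ θ x) : ContinuousOn x (Icc 0 1) :=
  fun t ht => (hx.hasDerivWithinAt t ht).continuousWithinAt

theorem IsPeriodicEigenpath.graph (hS : IsInverse C.graph S)
    (hM : ∀ t ∈ Icc (0 : ℝ) 1, ∀ x, (S x, M t x) ∈ (Ai t).graph) {B : H →L[ℂ] H} {μ θ : ℝ}
    (hμ : μ ≠ 0) {x : ℝ → H} (hx : IsPeriodicEigenpath C M B μ θ x) {t : ℝ}
    (ht : t ∈ Icc (0 : ℝ) 1) : (x t, (μ : ℂ) • M t (x t)) ∈ (Ai t).graph := by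
  have hμ' : (μ : ℂ) ≠ 0 := by exact_mod_cast hμ
  have h := (Ai t).graph.smul_mem (μ : ℂ) (hM t ht (x t))
  rwa [(mem_eigenspace_iff_resolvent hS hμ).1 (hx.mem_eigenspace t), Prod.smul_mk, smul_smul,
    mul_inv_cancel₀ hμ', one_smul] at h

variable [CompleteSpace H]

theorem exists_eigenbasis (hC : IsSelfAdjoint C) (hS : IsInverse C.graph S)
    (hScpt : IsCompactOperator S) (hAi : ∀ t ∈ Icc (0 : ℝ) 1, IsSelfAdjoint (Ai t))
    (hAi_comm : ∀ t ∈ Icc (0 : ℝ) 1, ∀ x y z : H,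
      (x, y) ∈ C.graph → (y, z) ∈ (Ai t).graph → ∃ w, (x, w) ∈ (Ai t).graph ∧ (w, z) ∈ C.graph)
    (hM : ∀ t ∈ Icc (0 : ℝ) 1, ∀ x, (S x, M t x) ∈ (Ai t).graph)
    (hMc : ∀ x, Continuous fun t => M t x) {K : ℝ} (hMK : ∀ t, ‖M t‖ ≤ K)
    {U : ℝ → ℝ → H →L[ℂ] H} (hU : IsEvolutionFamily C.domain Ai U)
    (W : H →ₗᵢ[ℂ] H) (hW : ∀ x y : H, (x, y) ∈ C.graph → (W x, W y) ∈ C.graph)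
    (hfin : ∀ μ, {n : ℕ | lam n = μ}.Finite)
    (hlam : ∀ μ : ℝ, {n : ℕ | lam n = μ}.encard =
      Cardinal.toENat (Module.rank ℂ (eigenspace C μ))) (hpos : ∀ k, 0 < lam k) :
    (∀ y z, (inner ℂ (U 1 0 (W y)) (U 1 0 (W z)) : ℂ) = inner ℂ y z) ∧
      ∃ (τ : ℕ → ℝ) (x : ℕ × ℤ → ℝ → H) (b : HilbertBasis (ℕ × ℤ) ℂ (L2unit H)),
        (∀ p, b p =ᵐ[unitMeasure] x p) ∧ ∀ p, IsPeriodicEigenpath C M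
          (U 1 0 ∘L W.toContinuousLinearMap) (lam p.1) (τ p.1 + 2 * Real.pi * p.2) (x p) := by
  obtain ⟨V, hVc, hV0, hV1, hV⟩ := exists_isometric_evolution hC hS hAi hAi_comm hM hU
  obtain ⟨e, τ, he, heC, heW⟩ := exists_joint_eigenvectors hC hfin hlam W hW
  have hVe : ∀ k, (∀ t, V t (e k) ∈ eigenspace C (lam k)) ∧ ∀ t ∈ Icc (0 : ℝ) 1,
      HasDerivWithinAt (fun r => V r (e k))
        (-(Complex.I • (lam k : ℂ) • M t (V t (e k)))) (Icc 0 1) t :=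
    fun k => hV _ (hpos k).ne' _ (heC k)
  have horth : ∀ t, Orthonormal ℂ fun k => V t (e k) := fun t => he.comp_linearIsometry (V t)
  -- Surjectivity of `V t` is not needed: `V t (e k)` is again an orthonormal sequence of
  -- eigenvectors with the full multiplicities, hence total.
  obtain ⟨b, hb⟩ := exists_moving_basis (fun k => hVc (e k)) horth
    (fun t => orthogonal_span_eigenvectors_eq_bot hC hS hScpt hfin hlam (horth t)
      fun k => (hVe k).1 t) τ
  refine ⟨fun y z => by rw [← hV1, ← hV1, (V 1).inner_map_map, W.inner_map_map], τ, _, b, hb,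
    fun p => ⟨fun t => Submodule.smul_mem _ _ ((hVe p.1).1 t), ?_, fun t ht => ?_, ?_⟩⟩
  · have h1 := continuous_uncurry_of_strong hMc hMK
    have h2 : Continuous fun t : ℝ => Complex.exp (((τ p.1 + 2 * Real.pi * p.2 : ℝ) : ℂ) * t *
        Complex.I) • V t (e p.1) :=
      Continuous.smul (by fun_prop) (hVc _)
    exact ((h1.comp (continuous_id.prodMk h2)).const_smul _).continuousOn
  · have h1 : HasDerivAt (fun t : ℝ => Complex.exp (((τ p.1 + 2 * Real.pi * p.2 : ℝ) : ℂ) * t *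
        Complex.I)) (Complex.exp (((τ p.1 + 2 * Real.pi * p.2 : ℝ) : ℂ) * t * Complex.I) *
          (((τ p.1 + 2 * Real.pi * p.2 : ℝ) : ℂ) * Complex.I)) t := by
      have h := (((hasDerivAt_id t).ofReal_comp.const_mul
        ((τ p.1 + 2 * Real.pi * p.2 : ℝ) : ℂ)).mul_const Complex.I).cexp
      refine h.congr_deriv ?_
      simp
    refine (h1.hasDerivWithinAt.smul ((hVe p.1).2 t ht)).congr_deriv ?_
    rw [map_smul]
    module
  · have h1 : Complex.exp (((τ p.1 + 2 * Real.pi * p.2 : ℝ) : ℂ) * (1 : ℝ) * Complex.I) =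
        Complex.exp (τ p.1 * Complex.I) := by
      rw [Complex.exp_eq_exp_iff_exists_int]
      exact ⟨p.2, by push_cast; ring⟩
    simp only [ContinuousLinearMap.comp_apply, LinearIsometry.coe_toContinuousLinearMap]
    rw [h1, Complex.ofReal_zero, mul_zero, zero_mul, Complex.exp_zero, one_smul, hV0, heW,
      map_smul, hV1]

end Eigenbasis

/-! ### The inverse of the operator with boundary condition -/

section Inverse

variable {H : Type*} [NormedAddCommGroup H] [InnerProductSpace ℂ H]
  {α : ℝ → ℝ} {C : H →ₗ.[ℂ] H} {Ai : ℝ → H →ₗ.[ℂ] H} {S : H →L[ℂ] H} {M : ℝ → H →L[ℂ] H}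
  {B : H →L[ℂ] H} {lam τ : ℕ → ℝ} {x : ℕ × ℤ → ℝ → H} {J : L2w H α ≃ₗᵢ[ℂ] L2unit H}

theorem boundaryCondition_of_mem (hae : ae (weight α) = ae unitMeasure)
    (hJ : ∀ u, J u =ᵐ[unitMeasure] fun t => √(α t) • u t) {u : L2w H α} {w : L2unit H}
    (h : (J u, w) ∈ boundarySpace B) : BoundaryCondition α B u := by
  obtain ⟨v₀, hv, hB⟩ := h
  refine ⟨fun t => v₀ + ∫ r in (0 : ℝ)..t, w r, ⟨w, Lp.memLp w, fun t _ => by simp⟩, ?_, ?_⟩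
  · rw [hae]
    filter_upwards [hJ u, hv] with t h1 h2
    rw [← h1, h2]
  · simp only [intervalIntegral.integral_same, add_zero]
    exact hB

variable [CompleteSpace H]

/-- The derivative of `T y` is a bounded operator applied to `y`: with `θ = τ_k + 2πm`, the ratios
`iθ/(λ + iθ)` and `λ/(λ + iθ)` have modulus at most one, and `A_i` acts on basis vectors as `λ A_i
C⁻¹`. Closedness of the boundary space extends the claim from the basis. -/
theorem exists_mem_boundarySpace_of_isDiag (hpos : ∀ k, 0 < lam k)
    (hMc : ∀ x, Continuous fun t => M t x) {K : ℝ} (hMK : ∀ t, ‖M t‖ ≤ K)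
    {b : HilbertBasis (ℕ × ℤ) ℂ (L2unit H)} (hb : ∀ p, b p =ᵐ[unitMeasure] x p)
    (hx : ∀ p, IsPeriodicEigenpath C M B (lam p.1) (τ p.1 + 2 * Real.pi * p.2) (x p))
    {T : L2unit H →L[ℂ] L2unit H} (hT : IsDiag b (fun p => (eigenvalue lam τ p)⁻¹) T)
    (y : L2unit H) :
    ∃ w, (T y, w) ∈ boundarySpace B := by
  obtain ⟨N, hN⟩ := exists_multiplication_operator hMc hMK
  obtain ⟨D₁, hD₁⟩ := exists_isDiag b (K := 1)
    (d := fun p => (eigenvalue lam τ p)⁻¹ *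
      (((τ p.1 + 2 * Real.pi * p.2 : ℝ) : ℂ) * Complex.I)) fun p => by
    have h0 := norm_pos_iff.2 (eigenvalue_ne_zero (τ := τ) hpos p)
    rw [norm_mul, norm_inv, inv_mul_le_iff₀ h0, mul_one, norm_mul, Complex.norm_I, mul_one,
      Complex.norm_real, norm_eigenvalue, Real.norm_eq_abs]
    exact Real.abs_le_sqrt (by nlinarith [sq_nonneg (lam p.1)])
  obtain ⟨D₂, hD₂⟩ := exists_isDiag b (K := 1)
    (d := fun p => (eigenvalue lam τ p)⁻¹ * lam p.1) fun p => by
    have h0 := norm_pos_iff.2 (eigenvalue_ne_zero (τ := τ) hpos p)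
    rw [norm_mul, norm_inv, inv_mul_le_iff₀ h0, mul_one, Complex.norm_real,
      Real.norm_of_nonneg (hpos _).le]
    exact le_norm_eigenvalue p
  refine ⟨(D₁ - Complex.I • N ∘L D₂) y, b.mem_of_isClosed (isClosed_boundarySpace B) T
    (D₁ - Complex.I • N ∘L D₂) (fun p => ?_) y⟩
  set θ : ℝ := τ p.1 + 2 * Real.pi * p.2 with hθ
  have hxp := hx p
  have hgen : (b p, ((θ : ℂ) * Complex.I) • b p - Complex.I • (lam p.1 : ℂ) • N (b p)) ∈
      boundarySpace B := by
    have hderiv : (((θ : ℂ) * Complex.I) • b p - Complex.I • (lam p.1 : ℂ) • N (b p) : L2unit H)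
        =ᵐ[unitMeasure]
          fun t => ((θ : ℂ) * Complex.I) • x p t - Complex.I • (lam p.1 : ℂ) • M t (x p t) := by
      filter_upwards [Lp.coeFn_sub (((θ : ℂ) * Complex.I) • b p)
        (Complex.I • (lam p.1 : ℂ) • N (b p)), Lp.coeFn_smul ((θ : ℂ) * Complex.I) (b p),
        Lp.coeFn_smul Complex.I ((lam p.1 : ℂ) • N (b p)), Lp.coeFn_smul (lam p.1 : ℂ) (N (b p)),
        hN (b p), hb p] with t h1 h2 h3 h4 h5 h6
      rw [h1, Pi.sub_apply, h2, h3, Pi.smul_apply, Pi.smul_apply, h4, Pi.smul_apply, h5, h6]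
    have hprim : ∀ t ∈ Icc (0 : ℝ) 1, ∫ r in (0 : ℝ)..t,
        (((θ : ℂ) * Complex.I) • b p - Complex.I • (lam p.1 : ℂ) • N (b p) : L2unit H) r =
          x p t - x p 0 := fun t ht => by
      rw [primitive_congr hderiv ht]
      exact integral_deriv_unit hxp.hasDerivWithinAt ((hxp.continuousOn.const_smul _).sub
        (hxp.continuousOn_generator.const_smul _)) ⟨le_rfl, zero_le_one⟩ ht ht.1
    refine ⟨x p 0, ?_, ?_⟩
    · filter_upwards [hb p, ae_restrict_mem measurableSet_Ioo] with t h1 ht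
      rw [h1, hprim t ⟨ht.1.le, ht.2.le⟩, add_sub_cancel]
    · rw [hprim 1 ⟨zero_le_one, le_rfl⟩, add_sub_cancel, hxp.boundary]
  have h := (boundarySpace B).smul_mem (eigenvalue lam τ p)⁻¹ hgen
  rw [Prod.smul_mk] at h
  rw [hT.apply_basis, sub_apply, smul_apply,
    ContinuousLinearMap.comp_apply, hD₁.apply_basis, hD₂.apply_basis]
  convert h using 2
  rw [map_smul, ← hθ]
  module

theorem isInverse_LW (hα : ContDiffOn ℝ 2 α (Icc 0 1))
    (hα_nonneg : ∀ t ∈ Icc (0 : ℝ) 1, 0 ≤ α t) (hα_pos : ∀ᵐ t ∂unitMeasure, 0 < α t)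
    (hC : IsSelfAdjoint C) (hAi : ∀ t ∈ Icc (0 : ℝ) 1, IsSelfAdjoint (Ai t))
    (hAi_C1 : ∀ f ∈ C.domain, ∃ a : ℝ → H, ContDiffOn ℝ 1 a (Icc 0 1) ∧
      ∀ t ∈ Icc (0 : ℝ) 1, (f, a t) ∈ (Ai t).graph)
    (hae : ae (weight α) = ae unitMeasure)
    (hJ : ∀ u, J u =ᵐ[unitMeasure] fun t => √(α t) • u t)
    (hS : IsInverse C.graph S) (hM : ∀ t ∈ Icc (0 : ℝ) 1, ∀ x, (S x, M t x) ∈ (Ai t).graph)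
    (hMc : ∀ x, Continuous fun t => M t x) {K : ℝ} (hMK : ∀ t, ‖M t‖ ≤ K)
    (hfd : ∀ k, FiniteDimensional ℂ (eigenspace C (lam k))) (hpos : ∀ k, 0 < lam k)
    (hB : ∀ y z, (inner ℂ (B y) (B z) : ℂ) = inner ℂ y z)
    (hx : ∀ p, IsPeriodicEigenpath C M B (lam p.1) (τ p.1 + 2 * Real.pi * p.2) (x p))
    {b : HilbertBasis (ℕ × ℤ) ℂ (L2unit H)} (hb : ∀ p, b p =ᵐ[unitMeasure] x p)
    {b' : HilbertBasis (ℕ × ℤ) ℂ (L2w H α)} (hb' : ∀ p, J (b' p) = b p)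
    {T : L2w H α →L[ℂ] L2w H α} (hT : IsDiag b' (fun p => (eigenvalue lam τ p)⁻¹) T) :
    IsInverse (LW α C Ai B) T := by
  have hdom : ∀ t ∈ Icc (0 : ℝ) 1, C.domain ≤ (Ai t).domain := fun t ht f hf => by
    obtain ⟨a, -, ha⟩ := hAi_C1 f hf
    exact LinearPMap.mem_domain_of_mem_graph (ha t ht)
  have hne := eigenvalue_ne_zero (τ := τ) hpos
  have hJx : ∀ p, J (b' p) =ᵐ[unitMeasure] x p := fun p => by rw [hb' p]; exact hb p
  intro u g
  constructor
  · rintro ⟨hL, -, v, ⟨w, hw, hv⟩, huv, hvB⟩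
    simp only at huv
    rw [hae] at huv
    have huv' : J u =ᵐ[unitMeasure] v := (hJ u).trans huv
    -- Equality of all Fourier coefficients suffices; the boundary terms agree as both functions
    -- satisfy the same condition and `B` preserves inner products.
    refine b'.ext_inner fun p => ?_
    have hcoeff := integral_inner_eq_of_mem_Lmax hα hα_pos hC hAi hdom hae hJ hS hM hMc hL hw hv
      huv' (hpos p.1).ne' (hfd p.1) (fun t _ => (hx p).mem_eigenspace t)
      (hx p).continuousOn_generator (hx p).hasDerivWithinAt
      (by rw [(hx p).boundary, hvB, hB])
    have hint : ∀ q : L2w H α,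
        (inner ℂ (b' p) q : ℂ) = ∫ t, (inner ℂ (x p t) (J q t) : ℂ) ∂unitMeasure := fun q => by
      rw [inner_weight_eq (J := J)]
      exact integral_congr_ae (by filter_upwards [hJx p] with t h; rw [h])
    rw [hT, hint, hint, hcoeff]
    exact inv_mul_cancel_left₀ (hne p) _
  · rintro rfl
    have heig := fun p => eigenfunction_mem hα hα_nonneg hα_pos hC hAi hAi_C1 hae hJ
      (fun t _ => (hx p).mem_eigenspace t) (fun t ht => (hx p).graph hS hM (hpos p.1).ne' ht)
      (hx p).continuousOn_generator (hx p).hasDerivWithinAt (hJx p)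
    refine ⟨?_, ?_, ?_⟩
    · refine b'.mem_of_isClosed (Z := Lmax α C Ai) (isClosed_graph_adjoint _) T
        (ContinuousLinearMap.id ℂ _) (fun p => ?_) g
      have h := (Lmax α C Ai).smul_mem (eigenvalue lam τ p)⁻¹ (heig p).1
      rw [Prod.smul_mk, smul_smul] at h
      rw [hT.apply_basis, ContinuousLinearMap.id_apply]
      convert h using 2
      rw [← eigenvalue, inv_mul_cancel₀ (hne p), one_smul]
    -- On a basis vector `L⁺` acts by the conjugate eigenvalue, so `L⁺ T` is diagonal with entries
    -- of modulus one, hence bounded.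
    · obtain ⟨T', hT'⟩ := exists_isDiag b' (K := 1)
        (d := fun p => (eigenvalue lam τ p)⁻¹ * starRingEnd ℂ (eigenvalue lam τ p)) fun p => by
        rw [norm_mul, norm_inv, RCLike.norm_conj, inv_mul_cancel₀ (norm_ne_zero_iff.2 (hne p))]
      refine ⟨T' g, b'.mem_of_isClosed (Z := LmaxPlus α C Ai) (isClosed_graph_adjoint _) T T'
        (fun p => ?_) g⟩
      have h := (LmaxPlus α C Ai).smul_mem (eigenvalue lam τ p)⁻¹ (heig p).2
      rw [Prod.smul_mk, smul_smul] at h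
      rw [hT.apply_basis, hT'.apply_basis]
      convert h using 4
      rw [eigenvalue, map_add, map_mul, Complex.conj_ofReal, Complex.conj_ofReal, Complex.conj_I]
      ring
    · set T' : L2unit H →L[ℂ] L2unit H := J.toContinuousLinearEquiv.toContinuousLinearMap ∘L T ∘L
        J.symm.toContinuousLinearEquiv.toContinuousLinearMap with hT'
      have hdiag : IsDiag b (fun p => (eigenvalue lam τ p)⁻¹) T' := fun y p => by
        have h := hT (J.symm y) p
        rw [← J.inner_map_map, ← J.inner_map_map (b' p) (J.symm y), J.apply_symm_apply,
          hb'] at h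
        exact h
      obtain ⟨w, hw⟩ := exists_mem_boundarySpace_of_isDiag hpos hMc hMK hb hx hdiag (J g)
      have hTg : T' (J g) = J (T g) := by
        change J (T (J.symm (J g))) = _
        rw [J.symm_apply_apply]
      rw [hTg] at hw
      exact boundaryCondition_of_mem hae hJ hw

end Inverse

end WeightedExt

/-! ### The main theorem -/

open WeightedExt in
theorem theorem10 {H : Type*} [NormedAddCommGroup H] [InnerProductSpace ℂ H] [CompleteSpace H]
    [TopologicalSpace.SeparableSpace H]
    -- the weight: `α ∈ C²[0,1]`, `α ≥ 0`, with a null set of zeros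
    (α : ℝ → ℝ) (hα : ContDiffOn ℝ 2 α (Icc 0 1)) (hα_nonneg : ∀ t ∈ Icc (0 : ℝ) 1, 0 ≤ α t)
    (hα_zero : volume {t ∈ Icc (0 : ℝ) 1 | α t = 0} = 0)
    -- the positive self-adjoint operator `C` in `A_r(t) = (α'(t) / (2 α(t))) I + C`
    (C : H →ₗ.[ℂ] H) (hC : IsSelfAdjoint C)
    (hC_pos : ∀ x : C.domain, 0 ≤ (inner ℂ (x : H) (C x)).re)
    -- the self-adjoint operators `A_i(t)`, commuting with `C`, strongly `C¹` on `D(A) = D(C)`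
    (Ai : ℝ → H →ₗ.[ℂ] H) (hAi : ∀ t ∈ Icc (0 : ℝ) 1, IsSelfAdjoint (Ai t))
    (hAi_comm : ∀ t ∈ Icc (0 : ℝ) 1, ∀ x y z : H,
      (x, y) ∈ C.graph → (y, z) ∈ (Ai t).graph → ∃ w, (x, w) ∈ (Ai t).graph ∧ (w, z) ∈ C.graph)
    (hAi_C1 : ∀ f ∈ C.domain, ∃ a : ℝ → H, ContDiffOn ℝ 1 a (Icc 0 1) ∧
      ∀ t ∈ Icc (0 : ℝ) 1, (f, a t) ∈ (Ai t).graph)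
    -- the evolution operators `U(t, s)` and the unitary operator `W` with `C W = W C`
    (U : ℝ → ℝ → H →L[ℂ] H) (hU : IsEvolutionFamily C.domain Ai U)
    (W : H ≃ₗᵢ[ℂ] H) (hW : ∀ x y : H, (x, y) ∈ C.graph ↔ (W x, W y) ∈ C.graph)
    -- `C⁻¹` is compact and `λ_n(C) ~ c n^β`
    (hC_inv : ∃ S : H →L[ℂ] H, IsInverse C.graph S ∧ IsCompactOperator S)
    (lam : ℕ → ℝ) (hlam : IsEigenvalueSeq C lam) (c β : ℝ) (hc : 0 < c) (hβ : 0 < β)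
    (hasymp : lam ~[atTop] fun n => c * ((n : ℝ) + 1) ^ β) :
    ∃ T : L2w H α →L[ℂ] L2w H α,
      IsInverse (LW α C Ai (U 1 0 ∘L (W : H →L[ℂ] H))) T ∧ IsCompactOperator T ∧
      ∃ s : ℕ → ℝ, IsSNumberSeq T s ∧
        ∃ d : ℝ, 0 < d ∧ s ~[atTop] fun n => d * ((n : ℝ) + 1) ^ (-(β / (1 + β))) := by
  obtain ⟨hmono, hrank⟩ := hlam
  obtain ⟨S, hS, hScpt⟩ := hC_inv
  have hfin := finite_setOf_eq_of_isEquivalent hc hβ hasymp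
  -- These eigenvectors serve only to show that every `λ_k` is an eigenvalue, hence positive.
  obtain ⟨e, -, he, heC, -⟩ := exists_joint_eigenvectors hC hfin hrank W.toLinearIsometry
    fun x y h => (hW x y).1 h
  have hpos : ∀ k, 0 < lam k := fun k => eigenvalue_pos hC_pos hS (he.ne_zero k) (heC k)
  have hmeas : AEMeasurable α unitMeasure :=
    (hα.continuousOn.mono Ioo_subset_Icc_self).aemeasurable measurableSet_Ioo
  have hα_pos : ∀ᵐ t ∂unitMeasure, 0 < α t := by
    filter_upwards [ae_restrict_mem measurableSet_Ioo,
      ae_restrict_of_ae (measure_eq_zero_iff_ae_notMem.1 hα_zero)] with t ht h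
    have ht' : t ∈ Icc (0 : ℝ) 1 := ⟨ht.1.le, ht.2.le⟩
    exact (hα_nonneg t ht').lt_of_ne fun h0 => h ⟨ht', h0.symm⟩
  have hae := ae_weight_eq hmeas hα_pos
  obtain ⟨J, hJ⟩ := exists_weight_isometry (H := H) hmeas hα_pos
  obtain ⟨M, hM, hMc, K, hMK⟩ := exists_bounded_comp_resolvent hS hAi hAi_C1
  obtain ⟨hB, τ, x, b, hb, hx⟩ := exists_eigenbasis hC hS hScpt hAi hAi_comm hM hMc hMK hU
    W.toLinearIsometry (fun x y h => (hW x y).1 h) hfin hrank hpos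
  -- Composing coordinates with `J` pulls the eigenbasis back to the weighted space.
  have hb' : ∀ p, J (HilbertBasis.ofRepr (J.trans b.repr) p) = b p := fun p => by
    rw [← HilbertBasis.repr_symm_single, ← HilbertBasis.repr_symm_single]
    exact J.apply_symm_apply _
  obtain ⟨T, hT⟩ := exists_isDiag (HilbertBasis.ofRepr (J.trans b.repr))
    (norm_inv_eigenvalue_le (τ := τ) hpos hmono)
  exact ⟨T, isInverse_LW hα hα_nonneg hα_pos hC hAi hAi_C1 hae hJ hS hM hMc hMK
    (fun k => (finrank_eigenspace_eq_card (hfin _) (hrank _)).1) hpos hB hx hb hb' hT,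
    isCompactOperator_and_sNumbers_of_isDiag hT hpos hmono hc hβ hasymp⟩
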